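/- **Definitions.** A *PROP* is a symmetric strict monoidal category with objects the natural numbers and tensor product on objects given by addition; a morphism of PROPs is an identity-on-objects symmetric strict monoidal functor. A *finite interfaced dag (idag)* from a set $I$ to a set $O$ is a finite set $N$ of internal nodes with a relation $R\subseteq (I+N)\times(O+N)$ such that the transitive closure of the restriction of $R$ to $N$ is irreflexive. Two idags $(N,R)$, $(N',R')$ from $I$ to $O$ are isomorphic if there is a bijection $\sigma:N\cong N'$ with $(\mathrm{id}+\sigma)\circ R=R'\circ(\mathrm{id}+\sigma)$. The *concatenation* of $(N,R)$ from $I$ to $M$ and $(N',R')$ from $M$ to $O$ has internal nodes $N+N'$ and edge relation the composite $$I+N+N'\xrightarrow{R+\mathrm{id}}M+N+N'\cong M+N'+N\xrightarrow{R'+\mathrm{id}}O+N'+N\cong O+N+N',$$ and the *juxtaposition* of $(N,R)$ from $I$ to $O$ and $(N',R')$ from $I'$ to $O'$ is the idag from $I+I'$ to $O+O'$ with internal nodes $N+N'$ and edges $R+R'$. Let $\mathbf D$ be the PROP whose morphisms $n\to m$ are the isomorphism classes of finite idags from $\{0,\dots,n-1\}$ to $\{0,\dots,m-1\}$, with composition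 by concatenation, tensor by juxtaposition, and identities and symmetries given by the idags without internal nodes on the evident bijections. A *symmetric monoidal equational theory* $T$ is a set of operators with arities and coarities together with a set of equations between expressions of equal arity and coarity, built from the operators, identities, composition, $\otimes$ and symmetries. The *free PROP* on $T$ has as morphisms $n\to m$ the expressions of arity $n$ and coarity $m$ modulo the laws of symmetric strict monoidal categories and the equations of $T$. A *$T$-algebra* in a symmetric monoidal category $\mathcal C$ is an object $A$ with a morphism $A^{\otimes n}\to A^{\otimes m}$ for every operator $n\to m$, satisfying the equations; homomorphisms are the morphisms of $\mathcal C$ that commute with the operators. Let $T$ be the theory of degenerate commutative bialgebras with a node, that is, the sum (disjoint union of operators and of equations) of the theory with one operator $\lambda:1\to1$ and no equations and the theory of degenerate commutative bialgebras, with operators $\eta:0\to1$, $\nabla:2\to1$, $\epsilon:1\to0$, $\Delta:1\to2$ and equations, for $\gamma$ the symmetry $1\otimes 1\to 1\otimes 1$, $$\nabla(\eta\otimes\mathrm{id}_1)=\mathrm{id}_1=\nabla(\mathrm{id}_1\otimes\eta),\quad \nabla(\nabla\otimes\mathrm{id}_1)=\nabla(\mathrm{id}_1\otimes\nabla),\quad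 \nabla\gamma=\nabla,$$ $$(\epsilon\otimes\mathrm{id}_1)\Delta=\mathrm{id}_1=(\mathrm{id}_1\otimes\epsilon)\Delta,\quad (\Delta\otimes\mathrm{id}_1)\Delta=(\mathrm{id}_1\otimes\Delta)\Delta,\quad \gamma\Delta=\Delta,$$ $$\epsilon\eta=\mathrm{id}_0,\quad \epsilon\nabla=\epsilon\otimes\epsilon,\quad \Delta\eta=\eta\otimes\eta,\quad \Delta\nabla=(\nabla\otimes\nabla)(\mathrm{id}_1\otimes\gamma\otimes\mathrm{id}_1)(\Delta\otimes\Delta),\quad \nabla\Delta=\mathrm{id}_1.$$ **Theorem.** The PROP $\mathbf D$ of finite abstract idags is free on $T$. Explicitly, interpret $\eta,\nabla,\epsilon,\Delta$ as the idags without internal nodes and with an edge from every input to every output, and $\lambda$ as the idag $1\to1$ with one internal node $x$ and exactly the two edges from the input to $x$ and from $x$ to the output. Then: 1. these idags satisfy the equations of $T$ in $\mathbf D$; 2. there is an isomorphism of PROPs from the free PROP on $T$ to $\mathbf D$ that sends every operator to its idag; 3. for every symmetric monoidal category $\mathcal C$, evaluation at the object $1$ with these idags is an equivalence from the category of symmetric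 (strong) monoidal functors $\mathbf D\to\mathcal C$ and monoidal natural transformations to the category of $T$-algebras in $\mathcal C$; and these equivalences are natural in $\mathcal C$ with respect to symmetric monoidal functors. -/

import Mathlib

universe w w' v v' u u'

open CategoryTheory MonoidalCategory

/-- Transport of a family indexed by arity and coarity along equalities of natural numbers. -/
def castHom {H : ℕ → ℕ → Type*} {a a' b b' : ℕ} (ha : a = a') (hb : b = b') (f : H a b) : H a' b' :=
  ha ▸ hb ▸ f

/-- A PROP: a symmetric strict monoidal category with objects the natural numbers and tensor
product on objects given by addition. Composition is written in diagrammatic order. The casts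
only move between hom-sets whose indices are equal natural numbers, such as `(a + b) + c` and
`a + (b + c)`. -/
structure PROP where
  Hom : ℕ → ℕ → Type w
  id : ∀ a, Hom a a
  comp : ∀ {a b c}, Hom a b → Hom b c → Hom a c
  tensor : ∀ {a b c d}, Hom a b → Hom c d → Hom (a + c) (b + d)
  symm : ∀ a b, Hom (a + b) (b + a)
  id_comp : ∀ {a b} (f : Hom a b), comp (id a) f = f
  comp_id : ∀ {a b} (f : Hom a b), comp f (id b) = f
  assoc : ∀ {a b c d} (f : Hom a b) (g : Hom b c) (h : Hom c d),
    comp (comp f g) h = comp f (comp g h)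
  tensor_id : ∀ a b, tensor (id a) (id b) = id (a + b)
  tensor_comp : ∀ {a b c a' b' c'} (f : Hom a b) (g : Hom b c) (f' : Hom a' b') (g' : Hom b' c'),
    tensor (comp f g) (comp f' g') = comp (tensor f f') (tensor g g')
  tensor_assoc : ∀ {a b a' b' a'' b''} (f : Hom a b) (g : Hom a' b') (h : Hom a'' b''),
    castHom (Nat.add_assoc a a' a'') (Nat.add_assoc b b' b'') (tensor (tensor f g) h)
      = tensor f (tensor g h)
  unit_tensor : ∀ {a b} (f : Hom a b),
    castHom (Nat.zero_add a) (Nat.zero_add b) (tensor (id 0) f) = f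
  tensor_unit : ∀ {a b} (f : Hom a b), tensor f (id 0) = f
  symm_naturality : ∀ {a b c d} (f : Hom a b) (g : Hom c d),
    comp (tensor f g) (symm b d) = comp (symm a c) (tensor g f)
  symm_symm : ∀ a b, comp (symm a b) (symm b a) = id (a + b)
  hexagon : ∀ a b c,
    symm a (b + c) =
      comp (castHom (Nat.add_assoc a b c) (Nat.add_assoc b a c) (tensor (symm a b) (id c)))
        (castHom rfl (Nat.add_assoc b c a).symm (tensor (id b) (symm a c)))

namespace PROP

/-- The objects of a PROP, that is, the natural numbers. -/
@[ext]
structure Obj (P : PROP.{w}) where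
  n : ℕ

instance (P : PROP.{w}) : Category.{w} P.Obj where
  Hom a b := P.Hom a.n b.n
  id a := P.id a.n
  comp f g := P.comp f g
  id_comp := P.id_comp
  comp_id := P.comp_id
  assoc := P.assoc

theorem castHom_eq (P : PROP.{w}) {a a' b b' : P.Obj} (ha : a = a') (hb : b = b') (f : a ⟶ b) :
    (castHom (H := P.Hom) (congrArg Obj.n ha) (congrArg Obj.n hb) f : a' ⟶ b') =
      eqToHom ha.symm ≫ f ≫ eqToHom hb := by
  subst ha hb
  simp [castHom]

instance (P : PROP.{w}) : MonoidalCategoryStruct P.Obj where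
  tensorObj a b := ⟨a.n + b.n⟩
  tensorUnit := ⟨0⟩
  tensorHom f g := P.tensor f g
  whiskerLeft a _ _ f := P.tensor (P.id a.n) f
  whiskerRight f a := P.tensor f (P.id a.n)
  associator a b c := eqToIso (Obj.ext (Nat.add_assoc a.n b.n c.n))
  leftUnitor a := eqToIso (Obj.ext (Nat.zero_add a.n))
  rightUnitor a := eqToIso (Obj.ext (Nat.add_zero a.n))

theorem obj_assoc (P : PROP.{w}) (a b c : P.Obj) : (a ⊗ b) ⊗ c = a ⊗ (b ⊗ c) :=
  Obj.ext (Nat.add_assoc a.n b.n c.n)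

theorem unit_obj (P : PROP.{w}) (a : P.Obj) : 𝟙_ P.Obj ⊗ a = a := Obj.ext (Nat.zero_add a.n)

theorem obj_unit (P : PROP.{w}) (a : P.Obj) : a ⊗ 𝟙_ P.Obj = a := Obj.ext (Nat.add_zero a.n)

theorem associator_hom_eq (P : PROP.{w}) (a b c : P.Obj) :
    (α_ a b c).hom = eqToHom (P.obj_assoc a b c) := rfl

theorem leftUnitor_hom_eq (P : PROP.{w}) (a : P.Obj) :
    (λ_ a).hom = eqToHom (P.unit_obj a) := rfl

theorem rightUnitor_hom_eq (P : PROP.{w}) (a : P.Obj) :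
    (ρ_ a).hom = eqToHom (P.obj_unit a) := rfl

theorem eqToHom_tensor_eqToHom (P : PROP.{w}) {a a' b b' : P.Obj} (ha : a = a') (hb : b = b') :
    (eqToHom ha ⊗ₘ eqToHom hb : a ⊗ b ⟶ a' ⊗ b') = eqToHom (by rw [ha, hb]) := by
  subst ha hb
  exact P.tensor_id a.n b.n

instance (P : PROP.{w}) : MonoidalCategory P.Obj :=
  MonoidalCategory.ofTensorHom
    (id_tensorHom_id := fun a b => P.tensor_id a.n b.n)
    (id_tensorHom := fun _ _ _ _ => rfl)
    (tensorHom_id := fun _ _ => rfl)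
    (tensorHom_comp_tensorHom := fun f g f' g' => (P.tensor_comp f f' g g').symm)
    (associator_naturality := fun {a a' a'' b b' b''} f g h => by
      have h3 : (f ⊗ₘ (g ⊗ₘ h)) = eqToHom (P.obj_assoc a a' a'').symm ≫ ((f ⊗ₘ g) ⊗ₘ h) ≫
          eqToHom (P.obj_assoc b b' b'') :=
        (P.tensor_assoc f g h).symm.trans
          (P.castHom_eq (P.obj_assoc a a' a'') (P.obj_assoc b b' b'') ((f ⊗ₘ g) ⊗ₘ h))
      rw [h3, associator_hom_eq, associator_hom_eq]
      simp)
    (leftUnitor_naturality := fun {a b} f => by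
      have h3 : f = eqToHom (P.unit_obj a).symm ≫ (𝟙 (𝟙_ P.Obj) ⊗ₘ f) ≫ eqToHom (P.unit_obj b) :=
        (P.unit_tensor f).symm.trans
          (P.castHom_eq (P.unit_obj a) (P.unit_obj b) (𝟙 (𝟙_ P.Obj) ⊗ₘ f))
      conv_rhs => rw [h3]
      rw [leftUnitor_hom_eq, leftUnitor_hom_eq]
      simp)
    (rightUnitor_naturality := fun {a b} f => by
      have h3 : f ⊗ₘ 𝟙 (𝟙_ P.Obj) = f := P.tensor_unit f
      rw [h3, rightUnitor_hom_eq, rightUnitor_hom_eq]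
      exact (Category.comp_id f).trans (Category.id_comp f).symm)
    (pentagon := fun a b c d => by
      simp only [associator_hom_eq, ← eqToHom_refl, eqToHom_tensor_eqToHom, eqToHom_trans])
    (triangle := fun a b => by
      simp only [associator_hom_eq, leftUnitor_hom_eq, rightUnitor_hom_eq, ← eqToHom_refl,
        eqToHom_tensor_eqToHom, eqToHom_trans])

/-- A PROP is a symmetric monoidal category. -/
instance (P : PROP.{w}) : SymmetricCategory P.Obj :=
  let β (a b : P.Obj) : a ⊗ b ≅ b ⊗ a :=
    ⟨P.symm a.n b.n, P.symm b.n a.n, P.symm_symm a.n b.n, P.symm_symm b.n a.n⟩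
  have hex : ∀ a b c : P.Obj, (α_ a b c).hom ≫ (β a (b ⊗ c)).hom ≫ (α_ b c a).hom =
      (β a b).hom ▷ c ≫ (α_ b a c).hom ≫ b ◁ (β a c).hom := fun a b c => by
    have h3 : (β a (b ⊗ c)).hom =
        (eqToHom (P.obj_assoc a b c).symm ≫ (β a b).hom ▷ c ≫ eqToHom (P.obj_assoc b a c)) ≫
        (eqToHom rfl ≫ b ◁ (β a c).hom ≫ eqToHom (P.obj_assoc b c a).symm) :=
      (P.hexagon a.n b.n c.n).trans (congrArg₂ P.comp
        (P.castHom_eq (P.obj_assoc a b c) (P.obj_assoc b a c) ((β a b).hom ▷ c))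
        (P.castHom_eq rfl (P.obj_assoc b c a).symm (b ◁ (β a c).hom)))
    rw [h3]
    simp only [associator_hom_eq, Category.assoc, eqToHom_trans_assoc, eqToHom_trans,
      eqToHom_refl, Category.id_comp, Category.comp_id]
  { braiding := β
    braiding_naturality_right := fun a _ _ f => P.symm_naturality (P.id a.n) f
    braiding_naturality_left := fun f c => P.symm_naturality f (P.id c.n)
    hexagon_forward := hex
    hexagon_reverse := fun a b c => by
      have h1 := hex c a b
      have h2 : ((α_ c a b) ≪≫ (β c (a ⊗ b)) ≪≫ (α_ a b c)) =
        (whiskerRightIso (β c a) b ≪≫ (α_ a c b) ≪≫ whiskerLeftIso a (β c b)) := Iso.ext h1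
      have h3 := congrArg Iso.inv h2
      simpa using h3
    symmetry := fun a b => P.symm_symm a.n b.n }

/-- A morphism of PROPs: an identity-on-objects symmetric strict monoidal functor. -/
structure Morphism (P : PROP.{w}) (Q : PROP.{w'}) where
  map : ∀ {a b}, P.Hom a b → Q.Hom a b
  map_id : ∀ a, map (P.id a) = Q.id a
  map_comp : ∀ {a b c} (f : P.Hom a b) (g : P.Hom b c), map (P.comp f g) = Q.comp (map f) (map g)
  map_tensor : ∀ {a b c d} (f : P.Hom a b) (g : P.Hom c d),
    map (P.tensor f g) = Q.tensor (map f) (map g)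
  map_symm : ∀ a b, map (P.symm a b) = Q.symm a b

/-- A morphism of PROPs is an isomorphism when it is bijective on all hom-sets. -/
def Morphism.IsIso {P : PROP.{w}} {Q : PROP.{w'}} (φ : P.Morphism Q) : Prop :=
  ∀ a b, Function.Bijective (φ.map : P.Hom a b → Q.Hom a b)

end PROP

/-- A signature: a set of operators with an assignment of arity/coarity pairs. -/
structure Signature where
  Op : Type
  dom : Op → ℕ
  cod : Op → ℕ

/-- Expressions, with their arity and coarity, in the language of symmetric strict monoidal
categories over the additive monoid of natural numbers together with the operators of `S`. -/
inductive Expr (S : Signature) : ℕ → ℕ → Type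
  | op (o : S.Op) : Expr S (S.dom o) (S.cod o)
  | id (a : ℕ) : Expr S a a
  | comp {a b c : ℕ} (f : Expr S a b) (g : Expr S b c) : Expr S a c
  | tensor {a b c d : ℕ} (f : Expr S a b) (g : Expr S c d) : Expr S (a + c) (b + d)
  | symm (a b : ℕ) : Expr S (a + b) (b + a)

/-- Substitution of expressions for operators. -/
def Expr.bind {S S' : Signature} (φ : ∀ o : S.Op, Expr S' (S.dom o) (S.cod o)) :
    ∀ {a b : ℕ}, Expr S a b → Expr S' a b
  | _, _, .op o => φ o
  | _, _, .id a => .id a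
  | _, _, .comp f g => .comp (f.bind φ) (g.bind φ)
  | _, _, .tensor f g => .tensor (f.bind φ) (g.bind φ)
  | _, _, .symm a b => .symm a b

/-- A symmetric monoidal equational theory: a signature with a set of pairs of expressions of the
same arity and coarity. -/
structure SMTheory extends Signature where
  Eqn : ∀ {a b : ℕ}, Expr toSignature a b → Expr toSignature a b → Prop

/-- The congruence on expressions generated by the laws of symmetric strict monoidal categories
and the equations of the theory `T`. -/
inductive SMTheory.Provable (T : SMTheory) :
    ∀ {a b : ℕ}, Expr T.toSignature a b → Expr T.toSignature a b → Prop
  | eqn {a b} {f g : Expr T.toSignature a b} : T.Eqn f g → Provable T f g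
  | refl {a b} (f : Expr T.toSignature a b) : Provable T f f
  | symm {a b} {f g : Expr T.toSignature a b} : Provable T f g → Provable T g f
  | trans {a b} {f g h : Expr T.toSignature a b} :
      Provable T f g → Provable T g h → Provable T f h
  | comp_congr {a b c} {f f' : Expr T.toSignature a b} {g g' : Expr T.toSignature b c} :
      Provable T f f' → Provable T g g' → Provable T (f.comp g) (f'.comp g')
  | tensor_congr {a b c d} {f f' : Expr T.toSignature a b} {g g' : Expr T.toSignature c d} :
      Provable T f f' → Provable T g g' → Provable T (f.tensor g) (f'.tensor g')
  | id_comp {a b} (f : Expr T.toSignature a b) : Provable T ((Expr.id a).comp f) f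
  | comp_id {a b} (f : Expr T.toSignature a b) : Provable T (f.comp (Expr.id b)) f
  | assoc {a b c d} (f : Expr T.toSignature a b) (g : Expr T.toSignature b c)
      (h : Expr T.toSignature c d) : Provable T ((f.comp g).comp h) (f.comp (g.comp h))
  | tensor_id (a b : ℕ) : Provable T ((Expr.id a).tensor (Expr.id b)) (Expr.id (a + b))
  | tensor_comp {a b c a' b' c'} (f : Expr T.toSignature a b) (g : Expr T.toSignature b c)
      (f' : Expr T.toSignature a' b') (g' : Expr T.toSignature b' c') :
      Provable T ((f.comp g).tensor (f'.comp g')) ((f.tensor f').comp (g.tensor g'))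
  | tensor_assoc {a b a' b' a'' b''} (f : Expr T.toSignature a b) (g : Expr T.toSignature a' b')
      (h : Expr T.toSignature a'' b'') :
      Provable T
        (castHom (Nat.add_assoc a a' a'') (Nat.add_assoc b b' b'') ((f.tensor g).tensor h))
        (f.tensor (g.tensor h))
  | unit_tensor {a b} (f : Expr T.toSignature a b) :
      Provable T (castHom (Nat.zero_add a) (Nat.zero_add b) ((Expr.id 0).tensor f)) f
  | tensor_unit {a b} (f : Expr T.toSignature a b) : Provable T (f.tensor (Expr.id 0)) f
  | symm_naturality {a b c d} (f : Expr T.toSignature a b) (g : Expr T.toSignature c d) :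
      Provable T ((f.tensor g).comp (Expr.symm b d)) ((Expr.symm a c).comp (g.tensor f))
  | symm_symm (a b : ℕ) :
      Provable T ((Expr.symm a b).comp (Expr.symm b a)) (Expr.id (a + b))
  | hexagon (a b c : ℕ) :
      Provable T (Expr.symm a (b + c))
        ((castHom (Nat.add_assoc a b c) (Nat.add_assoc b a c)
            ((Expr.symm a b).tensor (Expr.id c))).comp
          (castHom rfl (Nat.add_assoc b c a).symm ((Expr.id b).tensor (Expr.symm a c))))

/-- Provable equality as an equivalence relation. -/
def SMTheory.setoid (T : SMTheory) (a b : ℕ) : Setoid (Expr T.toSignature a b) where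
  r := T.Provable
  iseqv := ⟨.refl, .symm, .trans⟩

theorem castHom_natural {H : ℕ → ℕ → Type*} {K : ℕ → ℕ → Type*} (φ : ∀ {a b}, H a b → K a b)
    {a a' b b' : ℕ} (ha : a = a') (hb : b = b') (f : H a b) :
    castHom ha hb (φ f) = φ (castHom ha hb f) := by
  subst ha hb
  rfl

/-- The free PROP on a theory: expressions modulo provable equality. -/
def SMTheory.freeProp (T : SMTheory) : PROP.{0} where
  Hom a b := Quotient (T.setoid a b)
  id a := Quotient.mk _ (.id a)
  comp := Quotient.map₂ Expr.comp fun _ _ h _ _ h' => .comp_congr h h'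
  tensor := Quotient.map₂ Expr.tensor fun _ _ h _ _ h' => .tensor_congr h h'
  symm a b := Quotient.mk _ (.symm a b)
  id_comp := by rintro a b ⟨f⟩; exact Quotient.sound (.id_comp f)
  comp_id := by rintro a b ⟨f⟩; exact Quotient.sound (.comp_id f)
  assoc := by rintro a b c d ⟨f⟩ ⟨g⟩ ⟨h⟩; exact Quotient.sound (.assoc f g h)
  tensor_id a b := Quotient.sound (.tensor_id a b)
  tensor_comp := by
    rintro a b c a' b' c' ⟨f⟩ ⟨g⟩ ⟨f'⟩ ⟨g'⟩; exact Quotient.sound (.tensor_comp f g f' g')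
  tensor_assoc := by
    rintro a b a' b' a'' b'' ⟨f⟩ ⟨g⟩ ⟨h⟩
    exact (castHom_natural (fun {a b} => Quotient.mk (T.setoid a b)) _ _ _).trans
      (Quotient.sound (.tensor_assoc f g h))
  unit_tensor := by
    rintro a b ⟨f⟩
    exact (castHom_natural (fun {a b} => Quotient.mk (T.setoid a b)) _ _ _).trans
      (Quotient.sound (.unit_tensor f))
  tensor_unit := by rintro a b ⟨f⟩; exact Quotient.sound (.tensor_unit f)
  symm_naturality := by rintro a b c d ⟨f⟩ ⟨g⟩; exact Quotient.sound (.symm_naturality f g)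
  symm_symm a b := Quotient.sound (.symm_symm a b)
  hexagon a b c := by
    have e1 := castHom_natural (fun {a b} => Quotient.mk (T.setoid a b)) (Nat.add_assoc a b c)
      (Nat.add_assoc b a c) ((Expr.symm a b).tensor (Expr.id c))
    have e2 := castHom_natural (fun {a b} => Quotient.mk (T.setoid a b)) rfl
      (Nat.add_assoc b c a).symm ((Expr.id b).tensor (Expr.symm a c))
    refine (Quotient.sound (.hexagon a b c) : _ = Quotient.mk (T.setoid _ _) _).trans ?_
    exact (congrArg₂ 
      (Quotient.map₂ Expr.comp fun _ _ h _ _ h' => SMTheory.Provable.comp_congr h h') e1 e2).symm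

/-- The class of an operator in the free PROP. -/
def SMTheory.gen (T : SMTheory) (o : T.Op) : T.freeProp.Hom (T.dom o) (T.cod o) :=
  Quotient.mk _ (.op o)

/-- The interpretation of expressions in a PROP, given an interpretation of the operators as
morphisms of the same arity and coarity. -/
def Expr.evalProp {S : Signature} (P : PROP.{w}) (m : ∀ o : S.Op, P.Hom (S.dom o) (S.cod o)) :
    ∀ {a b : ℕ}, Expr S a b → P.Hom a b
  | _, _, .op o => m o
  | _, _, .id a => P.id a
  | _, _, .comp f g => P.comp (f.evalProp P m) (g.evalProp P m)
  | _, _, .tensor f g => P.tensor (f.evalProp P m) (g.evalProp P m)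
  | _, _, .symm a b => P.symm a b

/-- An algebra structure for the theory `T` on the generating object `1` of a PROP, whose tensor
powers are the objects `a`. -/
structure GenAlg (T : SMTheory) (P : PROP.{w}) where
  op : ∀ o : T.Op, P.Hom (T.dom o) (T.cod o)
  eqn : ∀ {a b : ℕ} {f g : Expr T.toSignature a b}, T.Eqn f g →
    f.evalProp P op = g.evalProp P op

/-- The disjoint union of two signatures. -/
def Signature.sum (S S' : Signature) : Signature where
  Op := S.Op ⊕ S'.Op
  dom := Sum.elim S.dom S'.dom
  cod := Sum.elim S.cod S'.cod

/-- Expressions over the first signature, seen over the sum. -/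
def Expr.inl {S S' : Signature} {a b : ℕ} (f : Expr S a b) : Expr (S.sum S') a b :=
  f.bind fun o => .op (S := S.sum S') (Sum.inl o)

/-- Expressions over the second signature, seen over the sum. -/
def Expr.inr {S S' : Signature} {a b : ℕ} (f : Expr S' a b) : Expr (S.sum S') a b :=
  f.bind fun o => .op (S := S.sum S') (Sum.inr o)

/-- The equations of the sum of two theories: those of either theory. -/
inductive SumEqn (T T' : SMTheory) : ∀ {a b : ℕ},
    Expr (T.toSignature.sum T'.toSignature) a b →
    Expr (T.toSignature.sum T'.toSignature) a b → Prop
  | inl {a b} {f g : Expr T.toSignature a b} : T.Eqn f g → SumEqn T T' f.inl g.inl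
  | inr {a b} {f g : Expr T'.toSignature a b} : T'.Eqn f g → SumEqn T T' f.inr g.inr

/-- The sum of two theories. -/
def SMTheory.sum (T T' : SMTheory) : SMTheory where
  toSignature := T.toSignature.sum T'.toSignature
  Eqn := SumEqn T T'

/-- The operators of bialgebras. -/
inductive BialgOp
  | eta
  | nabla
  | eps
  | delta

/-- The signature of bialgebras: `η : 0 → 1`, `∇ : 2 → 1`, `ε : 1 → 0`, `Δ : 1 → 2`. -/
def bialgSig : Signature where
  Op := BialgOp
  dom
    | .eta => 0
    | .nabla => 2
    | .eps => 1
    | .delta => 1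
  cod
    | .eta => 1
    | .nabla => 1
    | .eps => 0
    | .delta => 2

namespace Bialg

/-- The unit. -/
def η : Expr bialgSig 0 1 := .op (S := bialgSig) .eta

/-- The multiplication. -/
def m : Expr bialgSig 2 1 := .op (S := bialgSig) .nabla

/-- The counit. -/
def ε : Expr bialgSig 1 0 := .op (S := bialgSig) .eps

/-- The comultiplication. -/
def Δ : Expr bialgSig 1 2 := .op (S := bialgSig) .delta

/-- The identity on `1`. -/
def i : Expr bialgSig 1 1 := .id 1

/-- The symmetry on `1, 1`. -/
def γ : Expr bialgSig 2 2 := .symm 1 1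

/-- The equations of degenerate commutative bialgebras; `m` stands for the multiplication `∇` and
compositions are in diagrammatic order. -/
inductive Eqn : ∀ {a b : ℕ}, Expr bialgSig a b → Expr bialgSig a b → Prop
  | unit_left : Eqn ((η.tensor i).comp m) i
  | unit_right : Eqn ((i.tensor η).comp m) i
  | mul_assoc : Eqn ((m.tensor i).comp m) ((i.tensor m).comp m)
  | mul_comm : Eqn (γ.comp m) m
  | counit_left : Eqn (Δ.comp (ε.tensor i)) i
  | counit_right : Eqn (Δ.comp (i.tensor ε)) i
  | comul_assoc : Eqn (Δ.comp (Δ.tensor i)) (Δ.comp (i.tensor Δ))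
  | comul_comm : Eqn (Δ.comp γ) Δ
  | unit_counit : Eqn (η.comp ε) (.id 0)
  | mul_counit : Eqn (m.comp ε) (ε.tensor ε)
  | unit_comul : Eqn (η.comp Δ) (η.tensor η)
  | mul_comul : Eqn (m.comp Δ) (((Δ.tensor Δ).comp ((i.tensor γ).tensor i)).comp (m.tensor m))
  | degenerate : Eqn (Δ.comp m) i

end Bialg

/-- The theory of degenerate commutative bialgebras. -/
def degCommBialg : SMTheory where
  toSignature := bialgSig
  Eqn := Bialg.Eqn

/-- The theory of nodes labelled by `L`: unary operators `1 → 1` without equations. -/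
def nodes (L : Type) : SMTheory where
  Op := L
  dom _ := 1
  cod _ := 1
  Eqn _ _ := False

/-- The theory of degenerate commutative bialgebras with a node. -/
def dagTheory : SMTheory := degCommBialg.sum (nodes Unit)

/-- A finite interfaced dag with input interface `I` and output interface `O`: a finite set `N` of
internal nodes and a relation `R ⊆ (I + N) × (O + N)` such that the transitive closure of its
restriction to `N` is irreflexive. -/
structure IDag (I O : Type) where
  N : Type
  finite : Finite N
  R : I ⊕ N → O ⊕ N → Prop
  acyclic : ∀ n, ¬ Relation.TransGen (fun x y => R (Sum.inr x) (Sum.inr y)) n n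

namespace IDag

/-- Isomorphism of idags over fixed interfaces. -/
def Iso {I O : Type} (D D' : IDag I O) : Prop :=
  ∃ σ : D.N ≃ D'.N, ∀ x y, D.R x y ↔ D'.R (Sum.map id σ x) (Sum.map id σ y)

/-- Isomorphism as an equivalence relation. -/
def setoid (I O : Type) : Setoid (IDag I O) where
  r := Iso
  iseqv :=
    ⟨fun D => ⟨Equiv.refl _, by simp⟩,
     fun {D D'} ⟨σ, h⟩ => ⟨σ.symm, fun x y => by simp [h, Sum.map_map]⟩,
     fun {D D' D''} ⟨σ, h⟩ ⟨τ, k⟩ => ⟨σ.trans τ, fun x y => by simp [h, k, Sum.map_map]⟩⟩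

/-- The edges of the concatenation. Edges of the first idag into the middle interface `M` are
composed with the edges of the second one out of `M`; all the other edges are kept. -/
def concatRel {I M O N N' : Type} (R : I ⊕ N → M ⊕ N → Prop) (R' : M ⊕ N' → O ⊕ N' → Prop) :
    I ⊕ (N ⊕ N') → O ⊕ (N ⊕ N') → Prop
  | .inl i, .inl o => ∃ m, R (.inl i) (.inl m) ∧ R' (.inl m) (.inl o)
  | .inl i, .inr (.inl n) => R (.inl i) (.inr n)
  | .inl i, .inr (.inr n') => ∃ m, R (.inl i) (.inl m) ∧ R' (.inl m) (.inr n')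
  | .inr (.inl n), .inl o => ∃ m, R (.inr n) (.inl m) ∧ R' (.inl m) (.inl o)
  | .inr (.inl n), .inr (.inl k) => R (.inr n) (.inr k)
  | .inr (.inl n), .inr (.inr n') => ∃ m, R (.inr n) (.inl m) ∧ R' (.inl m) (.inr n')
  | .inr (.inr n'), .inl o => R' (.inr n') (.inl o)
  | .inr (.inr _), .inr (.inl _) => False
  | .inr (.inr n'), .inr (.inr k') => R' (.inr n') (.inr k')

/-- If a relation on `N + N'` has no step from `N'` to `N`, and restricts to irreflexive
transitive closures on both parts, then its transitive closure is irreflexive. -/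
theorem acyclic_sum {N N' : Type} {r : N ⊕ N' → N ⊕ N' → Prop} {p : N → N → Prop}
    {q : N' → N' → Prop} (hp : ∀ n, ¬ Relation.TransGen p n n)
    (hq : ∀ n, ¬ Relation.TransGen q n n) (h₁ : ∀ x y, r (.inl x) (.inl y) → p x y)
    (h₂ : ∀ x y, r (.inr x) (.inr y) → q x y) (h₃ : ∀ x y, ¬ r (.inr x) (.inl y)) :
    ∀ n, ¬ Relation.TransGen r n n := by
  have key : ∀ x y, Relation.TransGen r x y →
      match x, y with
      | .inl a, .inl b => Relation.TransGen p a b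
      | .inl _, .inr _ => True
      | .inr _, .inl _ => False
      | .inr a, .inr b => Relation.TransGen q a b := by
    intro x y h
    induction h with
    | single h =>
      rename_i z
      rcases x with x | x <;> rcases z with z | z
      · exact .single (h₁ _ _ h)
      · trivial
      · exact h₃ _ _ h
      · exact .single (h₂ _ _ h)
    | tail _ h ih =>
      rename_i z t _
      rcases x with x | x <;> rcases z with z | z <;> rcases t with t | t
      · exact ih.tail (h₁ _ _ h)
      · trivial
      · exact (h₃ _ _ h).elim
      · trivial
      · exact ih.elim
      · exact ih.elim
      · exact h₃ _ _ h
      · exact ih.tail (h₂ _ _ h)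
  rintro (n | n) h
  · exact hp n (key _ _ h)
  · exact hq n (key _ _ h)

/-- Concatenation, in diagrammatic order: first `D`, then `D'`. -/
def concat {I M O : Type} (D : IDag I M) (D' : IDag M O) : IDag I O where
  N := D.N ⊕ D'.N
  finite := by
    have := D.finite
    have := D'.finite
    infer_instance
  R := concatRel D.R D'.R
  acyclic := acyclic_sum D.acyclic D'.acyclic (fun _ _ h => h) (fun _ _ h => h) (fun _ _ h => h)

/-- The edges of the juxtaposition: those of both idags. -/
def juxtRel {I O I' O' N N' : Type} (R : I ⊕ N → O ⊕ N → Prop) (R' : I' ⊕ N' → O' ⊕ N' → Prop) :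
    (I ⊕ I') ⊕ (N ⊕ N') → (O ⊕ O') ⊕ (N ⊕ N') → Prop
  | .inl (.inl i), .inl (.inl o) => R (.inl i) (.inl o)
  | .inl (.inl i), .inr (.inl n) => R (.inl i) (.inr n)
  | .inr (.inl n), .inl (.inl o) => R (.inr n) (.inl o)
  | .inr (.inl n), .inr (.inl k) => R (.inr n) (.inr k)
  | .inl (.inr i), .inl (.inr o) => R' (.inl i) (.inl o)
  | .inl (.inr i), .inr (.inr n) => R' (.inl i) (.inr n)
  | .inr (.inr n), .inl (.inr o) => R' (.inr n) (.inl o)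
  | .inr (.inr n), .inr (.inr k) => R' (.inr n) (.inr k)
  | _, _ => False

/-- Juxtaposition. -/
def juxt {I O I' O' : Type} (D : IDag I O) (D' : IDag I' O') : IDag (I ⊕ I') (O ⊕ O') where
  N := D.N ⊕ D'.N
  finite := by
    have := D.finite
    have := D'.finite
    infer_instance
  R := juxtRel D.R D'.R
  acyclic := acyclic_sum D.acyclic D'.acyclic (fun _ _ h => h) (fun _ _ h => h) (fun _ _ h => h)

/-- Renaming of the interfaces along bijections, on edges. -/
def reindexRel {I I' O O' N : Type} (e : I ≃ I') (f : O ≃ O') (R : I ⊕ N → O ⊕ N → Prop) :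
    I' ⊕ N → O' ⊕ N → Prop :=
  fun x y => R (Sum.map e.symm id x) (Sum.map f.symm id y)

/-- Renaming of the interfaces along bijections. -/
def reindex {I I' O O' : Type} (e : I ≃ I') (f : O ≃ O') (D : IDag I O) : IDag I' O' where
  N := D.N
  finite := D.finite
  R := reindexRel e f D.R
  acyclic := D.acyclic

/-- Juxtaposition of idags between finite ordinals, where the sum of the ordinals `a` and `b` is
identified with the ordinal `a + b` in the usual way. -/
def juxtFin {a b c d : ℕ} (D : IDag (Fin a) (Fin b)) (D' : IDag (Fin c) (Fin d)) :
    IDag (Fin (a + c)) (Fin (b + d)) :=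
  (D.juxt D').reindex finSumFinEquiv finSumFinEquiv

/-- The edges of an idag without internal nodes. -/
def ofRelRel {I O : Type} (r : I → O → Prop) : I ⊕ Empty → O ⊕ Empty → Prop
  | .inl i, .inl o => r i o

/-- A relation as an idag without internal nodes. -/
def ofRel {I O : Type} (r : I → O → Prop) : IDag I O where
  N := Empty
  finite := inferInstance
  R := ofRelRel r
  acyclic n := n.elim

theorem concatRel_congr {I M O N N' L L' : Type} {R : I ⊕ N → M ⊕ N → Prop}
    {R' : M ⊕ N' → O ⊕ N' → Prop} {S : I ⊕ L → M ⊕ L → Prop} {S' : M ⊕ L' → O ⊕ L' → Prop}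
    {σ : N ≃ L} {σ' : N' ≃ L'} (h : ∀ x y, R x y ↔ S (Sum.map id σ x) (Sum.map id σ y))
    (h' : ∀ x y, R' x y ↔ S' (Sum.map id σ' x) (Sum.map id σ' y)) (x y) :
    concatRel R R' x y ↔ concatRel S S' (Sum.map id (Equiv.sumCongr σ σ') x)
      (Sum.map id (Equiv.sumCongr σ σ') y) := by
  rcases x with x | x | x <;> rcases y with y | y | y <;> simp [concatRel, h, h']

theorem concatRel_assoc {I M O P N N' N'' : Type} (R : I ⊕ N → M ⊕ N → Prop)
    (R' : M ⊕ N' → O ⊕ N' → Prop) (R'' : O ⊕ N'' → P ⊕ N'' → Prop) (x y) :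
    concatRel (concatRel R R') R'' x y ↔ concatRel R (concatRel R' R'')
      (Sum.map id (Equiv.sumAssoc N N' N'') x) (Sum.map id (Equiv.sumAssoc N N' N'') y) := by
  rcases x with x | (x | x) | x <;> rcases y with y | (y | y) | y <;> simp [concatRel] <;> grind

theorem concatRel_id {I O N : Type} (R : I ⊕ N → O ⊕ N → Prop) (x y) :
    concatRel R (ofRelRel Eq) x y ↔ R (Sum.map id (Equiv.sumEmpty N Empty) x)
      (Sum.map id (Equiv.sumEmpty N Empty) y) := by
  rcases x with x | x | ⟨⟨⟩⟩ <;> rcases y with y | y | ⟨⟨⟩⟩ <;> simp [concatRel, ofRelRel]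

theorem id_concatRel {I O N : Type} (R : I ⊕ N → O ⊕ N → Prop) (x y) :
    concatRel (ofRelRel Eq) R x y ↔ R (Sum.map id (Equiv.emptySum Empty N) x)
      (Sum.map id (Equiv.emptySum Empty N) y) := by
  rcases x with x | ⟨⟨⟩⟩ | x <;> rcases y with y | ⟨⟨⟩⟩ | y <;> simp [concatRel, ofRelRel]

theorem juxtRel_congr {I O I' O' N N' L L' : Type} {R : I ⊕ N → O ⊕ N → Prop}
    {R' : I' ⊕ N' → O' ⊕ N' → Prop} {S : I ⊕ L → O ⊕ L → Prop} {S' : I' ⊕ L' → O' ⊕ L' → Prop}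
    {σ : N ≃ L} {σ' : N' ≃ L'} (h : ∀ x y, R x y ↔ S (Sum.map id σ x) (Sum.map id σ y))
    (h' : ∀ x y, R' x y ↔ S' (Sum.map id σ' x) (Sum.map id σ' y)) (x y) :
    juxtRel R R' x y ↔ juxtRel S S' (Sum.map id (Equiv.sumCongr σ σ') x)
      (Sum.map id (Equiv.sumCongr σ σ') y) := by
  rcases x with (x | x) | x | x <;> rcases y with (y | y) | y | y <;> simp [juxtRel, h, h']

theorem juxtRel_concatRel {I M O I' M' O' N₁ N₂ N₁' N₂' : Type} (R₁ : I ⊕ N₁ → M ⊕ N₁ → Prop)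
    (R₂ : M ⊕ N₂ → O ⊕ N₂ → Prop) (R₁' : I' ⊕ N₁' → M' ⊕ N₁' → Prop)
    (R₂' : M' ⊕ N₂' → O' ⊕ N₂' → Prop) (x y) :
    juxtRel (concatRel R₁ R₂) (concatRel R₁' R₂') x y ↔
      concatRel (juxtRel R₁ R₁') (juxtRel R₂ R₂')
        (Sum.map id (Equiv.sumSumSumComm N₁ N₂ N₁' N₂') x)
        (Sum.map id (Equiv.sumSumSumComm N₁ N₂ N₁' N₂') y) := by
  rcases x with (x | x) | (x | x) | x | x <;> rcases y with (y | y) | (y | y) | y | y <;>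
    simp [juxtRel, concatRel]

theorem concatRel_reindexRel {I I' M M' O O' N N' : Type} (e : I ≃ I') (f : M ≃ M') (g : O ≃ O')
    (R : I ⊕ N → M ⊕ N → Prop) (R' : M ⊕ N' → O ⊕ N' → Prop) :
    concatRel (reindexRel e f R) (reindexRel f g R') = reindexRel e g (concatRel R R') := by
  ext x y
  rcases x with x | x | x <;> rcases y with y | y | y <;>
    simp [reindexRel, concatRel, f.symm.exists_congr_left]

/-- Case distinction on `Fin (a + (b + c))`. -/
theorem addCases₃ {a b c : ℕ} {p : Fin (a + (b + c)) → Prop}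
    (h₁ : ∀ i, p (Fin.castAdd (b + c) i)) (h₂ : ∀ i, p (Fin.natAdd a (Fin.castAdd c i)))
    (h₃ : ∀ i, p (Fin.natAdd a (Fin.natAdd b i))) (x : Fin (a + (b + c))) : p x :=
  Fin.addCases h₁ (fun y => Fin.addCases h₂ h₃ y) x

theorem cast_left {a b c : ℕ} (h : a + (b + c) = a + b + c) (i : Fin a) :
    Fin.cast h (Fin.castAdd (b + c) i) = Fin.castAdd c (Fin.castAdd b i) := rfl

theorem cast_middle {a b c : ℕ} (h : a + (b + c) = a + b + c) (i : Fin b) :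
    Fin.cast h (Fin.natAdd a (Fin.castAdd c i)) = Fin.castAdd c (Fin.natAdd a i) := rfl

theorem cast_right {a b c : ℕ} (h : a + (b + c) = a + b + c) (i : Fin c) :
    Fin.cast h (Fin.natAdd a (Fin.natAdd b i)) = Fin.natAdd (a + b) i :=
  Fin.ext (Nat.add_assoc a b i).symm

theorem cast_zero {a : ℕ} (h : a = 0 + a) (i : Fin a) : Fin.cast h i = Fin.natAdd 0 i :=
  Fin.ext (Nat.zero_add i).symm

theorem juxtFinRel_assoc {a b a' b' a'' b'' : ℕ} {N N' N'' : Type}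
    (h : a + a' + a'' = a + (a' + a'')) (k : b + b' + b'' = b + (b' + b''))
    (R : Fin a ⊕ N → Fin b ⊕ N → Prop) (R' : Fin a' ⊕ N' → Fin b' ⊕ N' → Prop)
    (R'' : Fin a'' ⊕ N'' → Fin b'' ⊕ N'' → Prop) (x y) :
    reindexRel (finCongr h) (finCongr k) (reindexRel finSumFinEquiv finSumFinEquiv
      (juxtRel (reindexRel finSumFinEquiv finSumFinEquiv (juxtRel R R')) R'')) x y ↔
    reindexRel finSumFinEquiv finSumFinEquiv
      (juxtRel R (reindexRel finSumFinEquiv finSumFinEquiv (juxtRel R' R'')))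
      (Sum.map id (Equiv.sumAssoc N N' N'') x) (Sum.map id (Equiv.sumAssoc N N' N'') y) := by
  rcases x with x | (x | x) | x
  · induction x using addCases₃ <;> rcases y with y | (y | y) | y <;>
      (try induction y using addCases₃) <;>
      simp [reindexRel, juxtRel, cast_left, cast_middle, cast_right]
  all_goals
    rcases y with y | (y | y) | y <;> (try induction y using addCases₃) <;>
      simp [reindexRel, juxtRel, cast_left, cast_middle, cast_right]

theorem unit_juxtFinRel {a b : ℕ} {N : Type} (h : 0 + a = a) (k : 0 + b = b)
    (R : Fin a ⊕ N → Fin b ⊕ N → Prop) (x y) :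
    reindexRel (finCongr h) (finCongr k) (reindexRel finSumFinEquiv finSumFinEquiv
      (juxtRel (ofRelRel (Eq : Fin 0 → Fin 0 → Prop)) R)) x y ↔
    R (Sum.map id (Equiv.emptySum Empty N) x) (Sum.map id (Equiv.emptySum Empty N) y) := by
  rcases x with x | ⟨⟨⟩⟩ | x <;> rcases y with y | ⟨⟨⟩⟩ | y <;>
    simp [reindexRel, juxtRel, cast_zero, -Fin.natAdd_zero]

theorem juxtFinRel_unit {a b : ℕ} {N : Type} (R : Fin a ⊕ N → Fin b ⊕ N → Prop)
    (x : Fin a ⊕ (N ⊕ Empty)) (y : Fin b ⊕ (N ⊕ Empty)) :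
    reindexRel (finSumFinEquiv (n := 0)) (finSumFinEquiv (n := 0))
      (juxtRel R (ofRelRel (Eq : Fin 0 → Fin 0 → Prop))) x y ↔
    R (Sum.map id (Equiv.sumEmpty N Empty) x) (Sum.map id (Equiv.sumEmpty N Empty) y) := by
  have h (n : ℕ) (z : Fin n) : (finSumFinEquiv (n := 0)).symm z = Sum.inl z :=
    finSumFinEquiv_symm_apply_castAdd z
  rcases x with x | x | ⟨⟨⟩⟩ <;> rcases y with y | y | ⟨⟨⟩⟩ <;> simp [reindexRel, juxtRel, h]

theorem flipRel_naturality {a b c d : ℕ} {N N' : Type} (R : Fin a ⊕ N → Fin b ⊕ N → Prop)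
    (R' : Fin c ⊕ N' → Fin d ⊕ N' → Prop) (x y) :
    concatRel (reindexRel finSumFinEquiv finSumFinEquiv (juxtRel R R'))
      (ofRelRel fun x y => finAddFlip x = y) x y ↔
    concatRel (ofRelRel fun x y => finAddFlip x = y)
      (reindexRel finSumFinEquiv finSumFinEquiv (juxtRel R' R))
      (Sum.map id (((Equiv.sumEmpty _ _).trans (Equiv.sumComm _ _)).trans
        (Equiv.emptySum Empty _).symm) x)
      (Sum.map id (((Equiv.sumEmpty _ _).trans (Equiv.sumComm _ _)).trans
        (Equiv.emptySum Empty _).symm) y) := by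
  have h1 : ∀ {m n : ℕ} (x : Fin (m + n)) (y : Fin (n + m)),
    finAddFlip x = y ↔ x = finAddFlip y := fun x y => by
      rw [← Equiv.eq_symm_apply]; rfl
  rcases x with x | (x | x) | ⟨⟨⟩⟩ <;> rcases y with y | (y | y) | ⟨⟨⟩⟩ <;>
    (try induction x using Fin.addCases) <;> (try induction y using Fin.addCases) <;>
    simp [reindexRel, juxtRel, concatRel, ofRelRel, h1]

theorem flipRel_hexagon {a b c : ℕ} (h : a + b + c = a + (b + c)) (k : b + a + c = b + (a + c))
    (l : b + (c + a) = b + c + a) (x : Fin (a + (b + c))) (y : Fin (b + c + a)) :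
    finAddFlip x = y ↔
    concatRel (reindexRel (finCongr h) (finCongr k) (reindexRel finSumFinEquiv finSumFinEquiv
        (juxtRel (ofRelRel fun (x : Fin (a + b)) y => finAddFlip x = y)
          (ofRelRel (Eq : Fin c → Fin c → Prop)))))
      (reindexRel (finCongr rfl) (finCongr l) (reindexRel finSumFinEquiv finSumFinEquiv
        (juxtRel (ofRelRel (Eq : Fin b → Fin b → Prop))
          (ofRelRel fun (x : Fin (a + c)) y => finAddFlip x = y))))
      (Sum.inl x) (Sum.inl y) := by
  have hy : ∃ y', y = Fin.cast l y' := ⟨Fin.cast l.symm y, rfl⟩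
  obtain ⟨y, rfl⟩ := hy
  have e : ∀ p : Fin (b + (a + c)) → Prop, (∃ z, p z) ↔ (∃ i, p (Fin.castAdd _ i)) ∨
      (∃ i, p (Fin.natAdd _ (Fin.castAdd _ i))) ∨ (∃ i, p (Fin.natAdd _ (Fin.natAdd _ i))) := by
    intro p
    refine ⟨fun ⟨z, hz⟩ => ?_, by rintro (⟨i, h⟩ | ⟨i, h⟩ | ⟨i, h⟩) <;> exact ⟨_, h⟩⟩
    induction z using addCases₃
    · exact .inl ⟨_, hz⟩
    · exact .inr (.inl ⟨_, hz⟩)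
    · exact .inr (.inr ⟨_, hz⟩)
  have hy : (finCongr l).symm (Fin.cast l y) = y := (finCongr l).symm_apply_apply y
  have ne : ∀ {m n : ℕ} (i : Fin m) (j : Fin n), Fin.castAdd n i ≠ Fin.natAdd m j := by
    intro m n i j hij
    have := congrArg Fin.val hij
    simp at this
    omega
  have ne' : ∀ {m n : ℕ} (i : Fin m) (j : Fin n), Fin.natAdd m j ≠ Fin.castAdd n i :=
    fun i j => (ne i j).symm
  simp only [concatRel, reindexRel, Sum.map_inl, hy, e]
  induction x using addCases₃ <;> induction y using addCases₃ <;>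
    simp [juxtRel, ofRelRel, ne, ne', cast_left, cast_middle, cast_right]

theorem concat_iso {I M O : Type} {D E : IDag I M} {D' E' : IDag M O} (h : D.Iso E)
    (h' : D'.Iso E') : (D.concat D').Iso (E.concat E') := by
  obtain ⟨σ, h⟩ := h
  obtain ⟨σ', h'⟩ := h'
  exact ⟨Equiv.sumCongr σ σ', concatRel_congr h h'⟩

theorem juxtFin_iso {a b c d : ℕ} {D E : IDag (Fin a) (Fin b)} {D' E' : IDag (Fin c) (Fin d)}
    (h : D.Iso E) (h' : D'.Iso E') : (D.juxtFin D').Iso (E.juxtFin E') := by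
  obtain ⟨σ, h⟩ := h
  obtain ⟨σ', h'⟩ := h'
  refine ⟨Equiv.sumCongr σ σ', fun x y => (juxtRel_congr h h' _ _).trans ?_⟩
  rcases x with x | x <;> rcases y with y | y <;> exact Iff.rfl

/-- The idag of the node `λ : 1 → 1`: one internal node, with an edge from the input and an edge
to the output. -/
def nodeRel : Fin 1 ⊕ Unit → Fin 1 ⊕ Unit → Prop
  | .inl _, .inr _ => True
  | .inr _, .inl _ => True
  | _, _ => False

/-- The idag of the node `λ : 1 → 1`. -/
def node : IDag (Fin 1) (Fin 1) where
  N := Unit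
  finite := inferInstance
  R := nodeRel
  acyclic n h := by
    obtain ⟨_, _, h⟩ := Relation.TransGen.tail'_iff.1 h
    exact h

end IDag

/-- Abstract idags between finite ordinals: isomorphism classes of finite idags. -/
def AbsIDag (a b : ℕ) : Type 1 := Quotient (IDag.setoid (Fin a) (Fin b))

namespace AbsIDag

/-- The abstract idag of an idag. -/
def mk {a b : ℕ} (D : IDag (Fin a) (Fin b)) : AbsIDag a b := Quotient.mk _ D

theorem castHom_mk {a a' b b' : ℕ} (ha : a = a') (hb : b = b') (D : IDag (Fin a) (Fin b)) :
    castHom ha hb (mk D) = mk (D.reindex (finCongr ha) (finCongr hb)) := by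
  subst ha hb
  exact Quotient.sound ⟨Equiv.refl _, fun x y => by
    rcases x with x | x <;> rcases y with y | y <;> exact Iff.rfl⟩

end AbsIDag

open IDag AbsIDag in
/-- The PROP of finite abstract idags: the objects are the finite ordinals, the morphisms are
isomorphism classes of finite idags, composition is concatenation, tensor is juxtaposition, and
identities and symmetries are the graphs of the evident bijections. -/
def dagProp : PROP.{1} where
  Hom := AbsIDag
  id a := mk (ofRel Eq)
  comp := Quotient.map₂ concat fun _ _ h _ _ h' => concat_iso h h'
  tensor := Quotient.map₂ juxtFin fun _ _ h _ _ h' => juxtFin_iso h h'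
  symm a b := mk (ofRel fun x y => finAddFlip x = y)
  id_comp := by
    rintro a b ⟨D⟩
    exact Quotient.sound ⟨Equiv.emptySum Empty D.N, id_concatRel D.R⟩
  comp_id := by
    rintro a b ⟨D⟩
    exact Quotient.sound ⟨Equiv.sumEmpty D.N Empty, concatRel_id D.R⟩
  assoc := by
    rintro a b c d ⟨D⟩ ⟨D'⟩ ⟨D''⟩
    exact Quotient.sound ⟨Equiv.sumAssoc _ _ _, concatRel_assoc D.R D'.R D''.R⟩
  tensor_id a b := by
    refine Quotient.sound ⟨Equiv.sumEmpty Empty Empty, ?_⟩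
    rintro (x | ⟨⟨⟩⟩ | ⟨⟨⟩⟩) (y | ⟨⟨⟩⟩ | ⟨⟨⟩⟩)
    change juxtRel (ofRelRel Eq) (ofRelRel Eq) (Sum.inl (finSumFinEquiv.symm x))
      (Sum.inl (finSumFinEquiv.symm y)) ↔ x = y
    rw [← finSumFinEquiv.symm.apply_eq_iff_eq (x := x)]
    rcases finSumFinEquiv.symm x with x | x <;> rcases finSumFinEquiv.symm y with y | y <;>
      simp [juxtRel, ofRelRel]
  tensor_comp := by
    rintro a b c a' b' c' ⟨D⟩ ⟨E⟩ ⟨D'⟩ ⟨E'⟩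
    refine Quotient.sound ⟨Equiv.sumSumSumComm _ _ _ _, fun x y => ?_⟩
    change reindexRel finSumFinEquiv finSumFinEquiv
      (juxtRel (concatRel D.R E.R) (concatRel D'.R E'.R)) x y ↔
      concatRel (reindexRel finSumFinEquiv finSumFinEquiv (juxtRel D.R D'.R))
        (reindexRel finSumFinEquiv finSumFinEquiv (juxtRel E.R E'.R)) _ _
    rw [concatRel_reindexRel]
    refine (juxtRel_concatRel _ _ _ _ _ _).trans ?_
    rcases x with x | x <;> rcases y with y | y <;> exact Iff.rfl
  tensor_assoc := by
    rintro a b a' b' a'' b'' ⟨D⟩ ⟨D'⟩ ⟨D''⟩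
    exact (castHom_mk _ _ _).trans (Quotient.sound
      ⟨Equiv.sumAssoc _ _ _, juxtFinRel_assoc _ _ D.R D'.R D''.R⟩)
  unit_tensor := by
    rintro a b ⟨D⟩
    exact (castHom_mk _ _ _).trans (Quotient.sound
      ⟨Equiv.emptySum Empty D.N, unit_juxtFinRel _ _ D.R⟩)
  tensor_unit := by
    rintro a b ⟨D⟩
    exact Quotient.sound ⟨Equiv.sumEmpty D.N Empty, juxtFinRel_unit D.R⟩
  symm_naturality := by
    rintro a b c d ⟨D⟩ ⟨D'⟩
    exact Quotient.sound ⟨_, flipRel_naturality D.R D'.R⟩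
  symm_symm a b := by
    refine Quotient.sound ⟨Equiv.sumEmpty Empty Empty, fun x y => ?_⟩
    change concatRel (ofRelRel fun x y => finAddFlip x = y)
      (ofRelRel fun x y => finAddFlip x = y) x y ↔ ofRelRel Eq _ _
    rcases x with x | ⟨⟨⟩⟩ | ⟨⟨⟩⟩
    rcases y with y | ⟨⟨⟩⟩ | ⟨⟨⟩⟩
    induction x using Fin.addCases <;> simp [concatRel, ofRelRel]
  hexagon a b c := by
    refine Eq.trans ?_ (congrArg₂ (Quotient.map₂ concat fun _ _ h _ _ h' => concat_iso h h')
      (castHom_mk _ _ _) (castHom_mk _ _ _)).symm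
    refine Quotient.sound ⟨(Equiv.equivEmpty ((Empty ⊕ Empty) ⊕ (Empty ⊕ Empty))).symm, ?_⟩
    rintro (x | ⟨⟨⟩⟩) (y | ⟨⟨⟩⟩)
    exact flipRel_hexagon _ _ _ x y

open IDag AbsIDag in
/-- The operators as idags between finite ordinals: `η`, `∇`, `ε` and `Δ` have no internal node and
an edge from every input to every output; `λ` is the idag with one internal node on the edge from
the input to the output. -/
def dagOp : ∀ o : dagTheory.Op, dagProp.Hom (dagTheory.dom o) (dagTheory.cod o)
  | .inl .eta => mk (ofRel fun (_ : Fin 0) (_ : Fin 1) => True)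
  | .inl .nabla => mk (ofRel fun (_ : Fin 2) (_ : Fin 1) => True)
  | .inl .eps => mk (ofRel fun (_ : Fin 1) (_ : Fin 0) => True)
  | .inl .delta => mk (ofRel fun (_ : Fin 1) (_ : Fin 2) => True)
  | .inr _ => mk node

section Algebras

variable {C : Type u} [Category.{v} C] [MonoidalCategory C]

/-- The tensor powers of an object, bracketed to the left:
`𝟙`, `𝟙 ⊗ A`, `(𝟙 ⊗ A) ⊗ A`, and so on. -/
def tpow (A : C) : ℕ → C
  | 0 => 𝟙_ C
  | n + 1 => tpow A n ⊗ A

/-- The canonical isomorphism between the `(a + b)`-th tensor power and the tensor product of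
the `a`-th and the `b`-th one. -/
def tpowAdd (A : C) (a : ℕ) : ∀ b : ℕ, tpow A (a + b) ≅ tpow A a ⊗ tpow A b
  | 0 => (ρ_ (tpow A a)).symm
  | b + 1 => whiskerRightIso (tpowAdd A a b) A ≪≫ α_ (tpow A a) (tpow A b) A

/-- The tensor powers of a morphism. -/
def tpowMap {A B : C} (f : A ⟶ B) : ∀ n : ℕ, tpow A n ⟶ tpow B n
  | 0 => 𝟙 _
  | n + 1 => tpowMap f n ⊗ₘ f

theorem tpowMap_id (A : C) (n : ℕ) : tpowMap (𝟙 A) n = 𝟙 _ := by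
  induction n with
  | zero => rfl
  | succ n ih => simp [tpowMap, ih, tpow]

theorem tpowMap_comp {A B D : C} (f : A ⟶ B) (g : B ⟶ D) (n : ℕ) :
    tpowMap (f ≫ g) n = tpowMap f n ≫ tpowMap g n := by
  induction n with
  | zero => exact (Category.id_comp _).symm
  | succ n ih => exact (congrArg (· ⊗ₘ (f ≫ g)) ih).trans (tensorHom_comp_tensorHom _ _ _ _).symm

variable [SymmetricCategory C]

/-- The interpretation of expressions in a symmetric monoidal category, given an object `A` and
an interpretation of the operators as morphisms between tensor powers of `A`. -/
def Expr.interp {S : Signature} (A : C) (m : ∀ o : S.Op, tpow A (S.dom o) ⟶ tpow A (S.cod o)) :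
    ∀ {a b : ℕ}, Expr S a b → (tpow A a ⟶ tpow A b)
  | _, _, .op o => m o
  | _, _, .id a => 𝟙 (tpow A a)
  | _, _, .comp f g => f.interp A m ≫ g.interp A m
  | _, _, .tensor (a := a) (b := b) (c := c) (d := d) f g =>
      (tpowAdd A a c).hom ≫ (f.interp A m ⊗ₘ g.interp A m) ≫ (tpowAdd A b d).inv
  | _, _, .symm a b =>
      (tpowAdd A a b).hom ≫ (β_ (tpow A a) (tpow A b)).hom ≫ (tpowAdd A b a).inv

variable (C) in
/-- The algebras of a theory in a symmetric monoidal category. -/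
structure Alg (T : SMTheory) where
  carrier : C
  op : ∀ o : T.Op, tpow carrier (T.dom o) ⟶ tpow carrier (T.cod o)
  eqn : ∀ {a b : ℕ} {f g : Expr T.toSignature a b}, T.Eqn f g →
    f.interp carrier op = g.interp carrier op

namespace Alg

/-- Homomorphisms of algebras. -/
@[ext]
structure Hom {T : SMTheory} (A B : Alg C T) where
  hom : A.carrier ⟶ B.carrier
  comm : ∀ o : T.Op, tpowMap hom (T.dom o) ≫ B.op o = A.op o ≫ tpowMap hom (T.cod o)

instance (T : SMTheory) : Category (Alg C T) where
  Hom := Hom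
  id A := ⟨𝟙 _, by simp [tpowMap_id]⟩
  comp f g := ⟨f.hom ≫ g.hom, fun o => by
    rw [tpowMap_comp, tpowMap_comp, Category.assoc, g.comm, ← Category.assoc, f.comm,
      Category.assoc]⟩
  id_comp f := Hom.ext (Category.id_comp f.hom)
  comp_id f := Hom.ext (Category.comp_id f.hom)
  assoc f g h := Hom.ext (Category.assoc f.hom g.hom h.hom)

end Alg

end Algebras

section Powers

open Functor.LaxMonoidal Functor.OplaxMonoidal Functor.Monoidal

variable {D : Type u'} [Category.{v'} D] [MonoidalCategory D]
variable {C : Type u} [Category.{v} C] [MonoidalCategory C]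

/-- A monoidal functor preserves tensor powers up to a canonical isomorphism. -/
def tpowIso (G : D ⥤ C) [G.Monoidal] (A : D) : ∀ n : ℕ, tpow (G.obj A) n ≅ G.obj (tpow A n)
  | 0 => εIso G
  | n + 1 => whiskerRightIso (tpowIso G A n) (G.obj A) ≪≫ μIso G (tpow A n) A

theorem tpowIso_add (G : D ⥤ C) [G.Monoidal] (A : D) (a b : ℕ) :
    tpowIso G A (a + b) = tpowAdd (G.obj A) a b ≪≫ (tpowIso G A a ⊗ᵢ tpowIso G A b) ≪≫
      μIso G (tpow A a) (tpow A b) ≪≫ (G.mapIso (tpowAdd A a b)).symm := by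
  suffices h : (tpowIso G A (a + b)).hom ≫ G.map (tpowAdd A a b).hom =
      (tpowAdd (G.obj A) a b).hom ≫ ((tpowIso G A a).hom ⊗ₘ (tpowIso G A b).hom) ≫
        μ G (tpow A a) (tpow A b) by
    ext
    rw [← cancel_mono (G.map (tpowAdd A a b).hom), h]
    simp [← G.map_comp]
  induction b with
  | zero =>
    change (tpowIso G A a).hom ≫ G.map (ρ_ (tpow A a)).inv =
      (ρ_ (tpow (G.obj A) a)).inv ≫ ((tpowIso G A a).hom ⊗ₘ ε G) ≫ μ G (tpow A a) (𝟙_ D)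
    rw [MonoidalCategory.tensorHom_def, Category.assoc, ← rightUnitor_inv_naturality_assoc,
      Functor.Monoidal.map_rightUnitor_inv]
  | succ b ih =>
    change ((tpowIso G A (a + b)).hom ▷ G.obj A ≫ μ G (tpow A (a + b)) A) ≫
        G.map ((tpowAdd A a b).hom ▷ A ≫ (α_ (tpow A a) (tpow A b) A).hom) =
      ((tpowAdd (G.obj A) a b).hom ▷ G.obj A ≫
        (α_ (tpow (G.obj A) a) (tpow (G.obj A) b) (G.obj A)).hom) ≫
        ((tpowIso G A a).hom ⊗ₘ ((tpowIso G A b).hom ▷ G.obj A ≫ μ G (tpow A b) A)) ≫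
          μ G (tpow A a) (tpow A b ⊗ A)
    rw [G.map_comp, Category.assoc, ← μ_natural_left_assoc, ← comp_whiskerRight_assoc, ih]
    simp [MonoidalCategory.tensorHom_def]

theorem tpowIso_natural (G : D ⥤ C) [G.Monoidal] {A B : D} (f : A ⟶ B) (n : ℕ) :
    tpowMap (G.map f) n ≫ (tpowIso G B n).hom = (tpowIso G A n).hom ≫ G.map (tpowMap f n) := by
  induction n with
  | zero =>
    change 𝟙 _ ≫ ε G = ε G ≫ G.map (𝟙 _)
    simp
  | succ n ih =>
    change (tpowMap (G.map f) n ⊗ₘ G.map f) ≫ (tpowIso G B n).hom ▷ G.obj B ≫ μ G (tpow B n) B =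
      ((tpowIso G A n).hom ▷ G.obj A ≫ μ G (tpow A n) A) ≫ G.map (tpowMap f n ⊗ₘ f)
    rw [Category.assoc, ← μ_natural, ← tensorHom_id, ← tensorHom_id,
      tensorHom_comp_tensorHom_assoc, tensorHom_comp_tensorHom_assoc, ih]
    simp

/-- The value of a monoidal functor on the object `n` of a PROP is canonically the `n`-th tensor
power of its value on the object `1`. -/
def genIso {P : PROP.{w}} (F : P.Obj ⥤ C) [F.Monoidal] :
    ∀ n : ℕ, tpow (F.obj ⟨1⟩) n ≅ F.obj ⟨n⟩
  | 0 => εIso F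
  | n + 1 => whiskerRightIso (genIso F n) (F.obj ⟨1⟩) ≪≫ μIso F ⟨n⟩ ⟨1⟩

theorem genIso_add {P : PROP.{w}} (F : P.Obj ⥤ C) [F.Monoidal] (a b : ℕ) :
    genIso F (a + b) = tpowAdd (F.obj ⟨1⟩) a b ≪≫ (genIso F a ⊗ᵢ genIso F b) ≪≫
      μIso F ⟨a⟩ ⟨b⟩ := by
  ext
  induction b with
  | zero =>
    change (genIso F a).hom = (ρ_ (tpow (F.obj ⟨1⟩) a)).inv ≫ ((genIso F a).hom ⊗ₘ ε F) ≫
      μ F ⟨a⟩ (𝟙_ P.Obj)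
    have h : F.map (ρ_ (⟨a⟩ : P.Obj)).inv = 𝟙 (F.obj ⟨a⟩) := F.map_id _
    rw [MonoidalCategory.tensorHom_def, Category.assoc, ← rightUnitor_inv_naturality_assoc,
      ← Functor.Monoidal.map_rightUnitor_inv, h]
    exact (Category.comp_id _).symm
  | succ b ih =>
    change (genIso F (a + b)).hom ▷ F.obj ⟨1⟩ ≫ μ F ⟨a + b⟩ ⟨1⟩ =
      ((tpowAdd (F.obj ⟨1⟩) a b).hom ▷ F.obj ⟨1⟩ ≫
        (α_ (tpow (F.obj ⟨1⟩) a) (tpow (F.obj ⟨1⟩) b) (F.obj ⟨1⟩)).hom) ≫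
        ((genIso F a).hom ⊗ₘ ((genIso F b).hom ▷ F.obj ⟨1⟩ ≫ μ F ⟨b⟩ ⟨1⟩)) ≫
          μ F ⟨a⟩ (⟨b⟩ ⊗ ⟨1⟩)
    have h : F.map (α_ (⟨a⟩ : P.Obj) ⟨b⟩ ⟨1⟩).hom = 𝟙 (F.obj ⟨a + b + 1⟩) := F.map_id _
    have h2 := Functor.LaxMonoidal.associativity F (⟨a⟩ : P.Obj) ⟨b⟩ ⟨1⟩
    rw [h] at h2
    have h3 : μ F (⟨a⟩ : P.Obj) ⟨b⟩ ▷ F.obj ⟨1⟩ ≫ μ F ⟨a + b⟩ ⟨1⟩ =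
      (α_ (F.obj ⟨a⟩) (F.obj ⟨b⟩) (F.obj ⟨1⟩)).hom ≫ F.obj ⟨a⟩ ◁ μ F ⟨b⟩ ⟨1⟩ ≫
        μ F ⟨a⟩ (⟨b⟩ ⊗ ⟨1⟩) := by
      rw [← h2]
      exact congrArg (_ ≫ ·) (Category.comp_id _).symm
    rw [ih]
    simp [MonoidalCategory.tensorHom_def, h3]

theorem genIso_natural {P : PROP.{w}} {F G : P.Obj ⥤ C} [F.Monoidal] [G.Monoidal] (α : F ⟶ G)
    [NatTrans.IsMonoidal α] (n : ℕ) :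
    tpowMap (α.app ⟨1⟩) n ≫ (genIso G n).hom = (genIso F n).hom ≫ α.app ⟨n⟩ := by
  induction n with
  | zero =>
    change 𝟙 _ ≫ ε G = ε F ≫ α.app (𝟙_ P.Obj)
    simp
  | succ n ih =>
    change (tpowMap (α.app ⟨1⟩) n ⊗ₘ α.app ⟨1⟩) ≫ (genIso G n).hom ▷ G.obj ⟨1⟩ ≫ μ G ⟨n⟩ ⟨1⟩ =
      ((genIso F n).hom ▷ F.obj ⟨1⟩ ≫ μ F ⟨n⟩ ⟨1⟩) ≫ α.app (⟨n⟩ ⊗ ⟨1⟩)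
    rw [Category.assoc, NatTrans.IsMonoidal.tensor, ← tensorHom_id, ← tensorHom_id,
      tensorHom_comp_tensorHom_assoc, tensorHom_comp_tensorHom_assoc, ih]
    simp

end Powers

section Functors

open Functor.LaxMonoidal Functor.OplaxMonoidal Functor.Monoidal

variable (D : Type u') [Category.{v'} D] [MonoidalCategory D] [SymmetricCategory D]
variable (C : Type u) [Category.{v} C] [MonoidalCategory C] [SymmetricCategory C]

/-- Symmetric (strong) monoidal functors. -/
structure SymMonFunctor where
  F : D ⥤ C
  braided : F.Braided

attribute [instance] SymMonFunctor.braided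

variable {D C}

namespace SymMonFunctor

/-- Monoidal natural transformations between symmetric monoidal functors. -/
@[ext]
structure Hom (F G : SymMonFunctor D C) where
  nat : F.F ⟶ G.F
  isMonoidal : NatTrans.IsMonoidal nat

attribute [instance] Hom.isMonoidal

instance : Category (SymMonFunctor D C) where
  Hom := Hom
  id F := ⟨𝟙 F.F, inferInstance⟩
  comp f g := ⟨f.nat ≫ g.nat, inferInstance⟩
  id_comp f := Hom.ext (Category.id_comp f.nat)
  comp_id f := Hom.ext (Category.comp_id f.nat)
  assoc f g h := Hom.ext (Category.assoc f.nat g.nat h.nat)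

/-- Postcomposition with a symmetric monoidal functor. -/
def postcomp {E : Type*} [Category* E] [MonoidalCategory E] [SymmetricCategory E]
    (G : SymMonFunctor D C) : SymMonFunctor E D ⥤ SymMonFunctor E C where
  obj F := ⟨F.F ⋙ G.F, inferInstance⟩
  map α := ⟨Functor.whiskerRight α.nat G.F, inferInstance⟩
  map_id _ := Hom.ext (Functor.whiskerRight_id' G.F)
  map_comp α β := Hom.ext (Functor.whiskerRight_comp α.nat β.nat G.F)

end SymMonFunctor

theorem interp_map {S : Signature} (G : D ⥤ C) [G.Braided] (A : D)
    (m : ∀ o : S.Op, tpow A (S.dom o) ⟶ tpow A (S.cod o)) {a b : ℕ} (f : Expr S a b) :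
    f.interp (G.obj A)
        (fun o => (tpowIso G A (S.dom o)).hom ≫ G.map (m o) ≫ (tpowIso G A (S.cod o)).inv) =
      (tpowIso G A a).hom ≫ G.map (f.interp A m) ≫ (tpowIso G A b).inv := by
  induction f with
  | op o => rfl
  | id a => simp [Expr.interp]
  | comp f g hf hg => simp [Expr.interp, hf, hg]
  | tensor f g hf hg =>
    simp only [Expr.interp, hf, hg, tpowIso_add, ← tensorHom_comp_tensorHom]
    simp [-tensorHom_comp_tensorHom, -tensorHom_comp_tensorHom_assoc]
    rw [← μ_natural_assoc, Functor.Monoidal.μ_δ_assoc]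
  | symm a b =>
    simp only [Expr.interp, tpowIso_add]
    simp

/-- The image of an algebra under a symmetric monoidal functor. -/
def Alg.map {T : SMTheory} (G : SymMonFunctor D C) : Alg D T ⥤ Alg C T where
  obj A :=
    { carrier := G.F.obj A.carrier
      op := fun o => (tpowIso G.F A.carrier (T.dom o)).hom ≫ G.F.map (A.op o) ≫
        (tpowIso G.F A.carrier (T.cod o)).inv
      eqn := fun h => by rw [interp_map, interp_map, A.eqn h] }
  map {A B} f :=
    { hom := G.F.map f.hom
      comm := fun o => by
        have h := tpowIso_natural G.F f.hom
        have h' : (tpowIso G.F A.carrier (T.cod o)).inv ≫ tpowMap (G.F.map f.hom) (T.cod o) =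
            G.F.map (tpowMap f.hom (T.cod o)) ≫ (tpowIso G.F B.carrier (T.cod o)).inv := by
          rw [Iso.inv_comp_eq, ← Category.assoc, ← h, Category.assoc, Iso.hom_inv_id,
            Category.comp_id]
        rw [Category.assoc, Category.assoc, h', ← G.F.map_comp_assoc, ← f.comm,
          G.F.map_comp_assoc, ← Category.assoc, h, Category.assoc] }
  map_id A := Hom.ext (G.F.map_id _)
  map_comp f g := Hom.ext (G.F.map_comp f.hom g.hom)

theorem interp_gen {S : Signature} {P : PROP.{w}} (F : P.Obj ⥤ C) [F.Braided]
    (m : ∀ o : S.Op, P.Hom (S.dom o) (S.cod o)) {a b : ℕ} (f : Expr S a b) :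
    f.interp (F.obj ⟨1⟩) (fun o => (genIso F (S.dom o)).hom ≫
        F.map (m o : (⟨S.dom o⟩ : P.Obj) ⟶ ⟨S.cod o⟩) ≫ (genIso F (S.cod o)).inv) =
      (genIso F a).hom ≫ F.map (f.evalProp P m : (⟨a⟩ : P.Obj) ⟶ ⟨b⟩) ≫ (genIso F b).inv := by
  induction f with
  | op o => rfl
  | id a =>
    change 𝟙 _ = (genIso F a).hom ≫ F.map (𝟙 (⟨a⟩ : P.Obj)) ≫ (genIso F a).inv
    simp
  | @comp a b c f g hf hg =>
    change _ ≫ _ = (genIso F a).hom ≫ F.map ((f.evalProp P m : (⟨a⟩ : P.Obj) ⟶ ⟨b⟩) ≫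
      (g.evalProp P m : (⟨b⟩ : P.Obj) ⟶ ⟨c⟩)) ≫ (genIso F c).inv
    rw [hf, hg]
    simp
  | @tensor a b c d f g hf hg =>
    change _ ≫ (_ ⊗ₘ _) ≫ _ = (genIso F (a + c)).hom ≫ F.map
      ((f.evalProp P m : (⟨a⟩ : P.Obj) ⟶ ⟨b⟩) ⊗ₘ (g.evalProp P m : (⟨c⟩ : P.Obj) ⟶ ⟨d⟩)) ≫
        (genIso F (b + d)).inv
    rw [hf, hg, genIso_add, genIso_add]
    simp only [← tensorHom_comp_tensorHom]
    simp [-tensorHom_comp_tensorHom, -tensorHom_comp_tensorHom_assoc]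
    rw [← μ_natural_assoc, Functor.Monoidal.μ_δ_assoc]
  | symm a b =>
    change _ = (genIso F (a + b)).hom ≫ F.map (β_ (⟨a⟩ : P.Obj) ⟨b⟩).hom ≫ (genIso F (b + a)).inv
    rw [genIso_add, genIso_add]
    simp [Expr.interp]

/-- Evaluation at the generic algebra: a symmetric monoidal functor `F` on a PROP carrying an
algebra structure on its generating object `1` goes to the induced algebra structure on `F 1`. -/
def GenAlg.ev {T : SMTheory} {P : PROP.{w}} (M : GenAlg T P) (C : Type u) [Category.{v} C]
    [MonoidalCategory C] [SymmetricCategory C] : SymMonFunctor P.Obj C ⥤ Alg C T where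
  obj F :=
    { carrier := F.F.obj ⟨1⟩
      op := fun o => (genIso F.F (T.dom o)).hom ≫
        F.F.map (M.op o : (⟨T.dom o⟩ : P.Obj) ⟶ ⟨T.cod o⟩) ≫ (genIso F.F (T.cod o)).inv
      eqn := fun h => by rw [interp_gen, interp_gen, M.eqn h] }
  map {F G} α :=
    { hom := α.nat.app ⟨1⟩
      comm := fun o => by
        have h := genIso_natural α.nat
        have h' : (genIso F.F (T.cod o)).inv ≫ tpowMap (α.nat.app ⟨1⟩) (T.cod o) =
            α.nat.app ⟨T.cod o⟩ ≫ (genIso G.F (T.cod o)).inv := by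
          rw [Iso.inv_comp_eq, ← Category.assoc, ← h, Category.assoc, Iso.hom_inv_id,
            Category.comp_id]
        rw [Category.assoc, Category.assoc, h', ← Category.assoc, h, Category.assoc,
          α.nat.naturality_assoc] }
  map_id _ := rfl
  map_comp _ _ := rfl

end Functors

/-! Let `P` be any PROP with an algebra `M` of the theory. The idea is to attach to every idag one
well-defined morphism of `P`, and to show that every expression evaluates in `P` to the morphism
attached to the idag that it denotes.

Idags without nodes are relations. The operators Δ and ε make `1`, and hence every `n`, a
cocommutative comonoid. By Fox's argument the tensor product is a cartesian product for the
morphisms of comonoids (`IsCopy`), and `0` is terminal, so such a morphism is determined by its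
coordinates (`IsCopy.ext`). The bialgebra equations say that η and ∇ are morphisms of comonoids.
Convolution with ∇ then makes the comonoid morphisms `n → 1` a join semilattice with bottom; the
degenerate equation ∇Δ = id is idempotence. A relation `r` gives the morphism `mat r` whose `j`-th
coordinate is the join of the projections `i` with `r i j`. Comparing upper bounds shows that `mat`
respects composition, tensor and symmetries.

The node λ need not be a morphism of comonoids, so nodes are added one by one. Given a node `x`
without internal predecessors, one copies all wires, joins a new wire to the predecessors of `x`,
applies λ to it (`step`), and goes on with the idag in which `x` has become an input (`Peel`). The
result (`Nf`) does not depend on the order: two minimal nodes can be exchanged by `step_comm`, and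
`Nf.unique` follows by induction on the number of nodes. Normal forms are stable under concatenation
and juxtaposition, which gives `Nf.evalProp`.

Hence expressions with the same idag agree in every `P`. In the free PROP this says that they are
provably equal. Conversely, the same removal of minimal nodes shows that every idag is the value of
an expression (`IsGen.mk`). Together these two facts give the isomorphism with the free PROP.

The universal property is then formal. An algebra in `C` with carrier `A` is an algebra in the PROP
`endProp A` of morphisms between the tensor powers of `A`, so freeness yields a morphism of PROPs
into it, that is, a symmetric monoidal functor. Fullness holds because homomorphisms commute with
all expressions, faithfulness because a monoidal transformation is determined at the object `1`. -/

/-! ### Comonoids in a symmetric monoidal category: the tensor product as a cartesian product. -/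

section CommutativeComonoids

open ComonObj

variable {C : Type u} [Category.{v} C] [MonoidalCategory C]
variable {X Y Z W : C}

/-- The pairing of two morphisms out of a comonoid. -/
def comonLift [ComonObj X] (f : X ⟶ Y) (g : X ⟶ Z) : X ⟶ Y ⊗ Z := Δ[X] ≫ (f ⊗ₘ g)

theorem comp_comonLift [ComonObj W] [ComonObj X] (h : W ⟶ X) [IsComonHom h] (f : X ⟶ Y)
    (g : X ⟶ Z) : h ≫ comonLift f g = comonLift (h ≫ f) (h ≫ g) := by
  simp [comonLift]

theorem comonLift_comp_tensorHom [ComonObj X] {Y' Z' : C} (f : X ⟶ Y) (g : X ⟶ Z) (f' : Y ⟶ Y')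
    (g' : Z ⟶ Z') : comonLift f g ≫ (f' ⊗ₘ g') = comonLift (f ≫ f') (g ≫ g') := by
  simp [comonLift]

variable (X Y) in
/-- The first projection from a tensor product with a comonoid. -/
def comonFst [ComonObj Y] : X ⊗ Y ⟶ X := X ◁ ε[Y] ≫ (ρ_ X).hom

variable (X Y) in
/-- The second projection from a tensor product with a comonoid. -/
def comonSnd [ComonObj X] : X ⊗ Y ⟶ Y := ε[X] ▷ Y ≫ (λ_ Y).hom

variable [ComonObj X] [ComonObj Y] [ComonObj Z] [ComonObj W]

/-- The unit object is terminal among comonoids, and the counit underlies the unique morphism to it.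
-/
theorem isComonHom_counit :
    let _ := ComonObj.instTensorUnit C
    IsComonHom ε[X] :=
  (default : Comon.mk X ⟶ Comon.trivial C).isComonHom_hom

/-- Only the component that gets discarded has to be a morphism of comonoids. -/
theorem comonLift_fst {Y : C} (f : X ⟶ Y) (g : X ⟶ Z) [IsComonHom g] :
    comonLift f g ≫ comonFst Y Z = f := by
  rw [comonLift, comonFst, Category.assoc, ← id_tensorHom, ← Category.assoc (f ⊗ₘ g),
    tensorHom_comp_tensorHom, IsComonHom.hom_counit, ← Category.assoc, comul_counit_hom]
  simp

theorem comonLift_snd {Z : C} (f : X ⟶ Y) (g : X ⟶ Z) [IsComonHom f] :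
    comonLift f g ≫ comonSnd Y Z = g := by
  rw [comonLift, comonSnd, Category.assoc, ← tensorHom_id, ← Category.assoc (f ⊗ₘ g),
    tensorHom_comp_tensorHom, IsComonHom.hom_counit, ← Category.assoc, counit_comul_hom]
  simp

theorem tensorHom_comonFst {X Y : C} (f : X ⟶ Y) (g : Z ⟶ W) [IsComonHom g] :
    (f ⊗ₘ g) ≫ comonFst Y W = comonFst X Z ≫ f := by
  rw [comonFst, comonFst, ← id_tensorHom, ← Category.assoc, tensorHom_comp_tensorHom,
    IsComonHom.hom_counit, Category.comp_id, MonoidalCategory.tensorHom_def']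
  simp

theorem tensorHom_comonSnd {Z W : C} (f : X ⟶ Y) (g : Z ⟶ W) [IsComonHom f] :
    (f ⊗ₘ g) ≫ comonSnd Y W = comonSnd X Z ≫ g := by
  rw [comonSnd, comonSnd, ← tensorHom_id, ← Category.assoc, tensorHom_comp_tensorHom,
    IsComonHom.hom_counit, Category.comp_id, MonoidalCategory.tensorHom_def]
  simp

variable [SymmetricCategory C]

instance isComonHom_tensorHom (f : X ⟶ Y) (g : Z ⟶ W) [IsComonHom f] [IsComonHom g] :
    IsComonHom (f ⊗ₘ g) := by
  have h := (MonoidalCategoryStruct.tensorHom (C := Comon C) (X₁ := .mk X) (Y₁ := .mk Y)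
    (X₂ := .mk Z) (Y₂ := .mk W) (Comon.Hom.mk f)
    (Comon.Hom.mk g)).isComonHom_hom
  rwa [Comon.monoidal_tensorHom_hom] at h

/-- The structure isomorphisms of the monoidal category `Comon C` have those of `C` as underlying
morphisms. The same argument serves for both unitors. -/
theorem isComonHom_associator_hom : IsComonHom (α_ X Y Z).hom := by
  have e : (α_ (Comon.mk X) (Comon.mk Y) (Comon.mk Z)).hom.hom = (α_ X Y Z).hom := by
    rw [Comon.monoidal_associator_hom_hom]
    change 𝟙 (X ⊗ Y) ▷ Z ≫ (α_ X Y Z).hom ≫ X ◁ 𝟙 (Y ⊗ Z) = _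
    simp
  rw [← e]
  exact (α_ (Comon.mk X) (Comon.mk Y) (Comon.mk Z)).hom.isComonHom_hom

theorem isComonHom_leftUnitor_hom :
    let _ := ComonObj.instTensorUnit C
    IsComonHom (λ_ X).hom := by
  have e : (λ_ (Comon.mk X)).hom.hom = (λ_ X).hom := by
    rw [Comon.monoidal_leftUnitor_hom_hom]
    change 𝟙 (𝟙_ C) ▷ X ≫ (λ_ X).hom = _
    simp
  rw [← e]
  exact (λ_ (Comon.mk X)).hom.isComonHom_hom

theorem isComonHom_rightUnitor_hom :
    let _ := ComonObj.instTensorUnit C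
    IsComonHom (ρ_ X).hom := by
  have e : (ρ_ (Comon.mk X)).hom.hom = (ρ_ X).hom := by
    rw [Comon.monoidal_rightUnitor_hom_hom]
    change X ◁ 𝟙 (𝟙_ C) ≫ (ρ_ X).hom = _
    simp
  rw [← e]
  exact (ρ_ (Comon.mk X)).hom.isComonHom_hom

instance isComonHom_comul [IsCommComonObj X] : IsComonHom Δ[X] where
  hom_counit := by
    rw [Comon.tensorObj_counit, ← Category.assoc, counit_comul_hom]
    simp
  hom_comul := by
    -- Coassociativity makes the two middle copies come from a single comultiplication. The braiding
    -- of these copies inside `tensorμ` is then absorbed by cocommutativity.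
    have h : Δ[X] ≫ (Δ[X] ⊗ₘ Δ[X]) = Δ[X] ≫ X ◁ (Δ[X] ≫ Δ[X] ▷ X ≫ (α_ X X X).hom) ≫
        (α_ X X (X ⊗ X)).inv := by
      rw [← comul_assoc, MonoidalCategory.whiskerLeft_comp_assoc,
        associator_inv_naturality_right, ← comul_assoc_flip_assoc,
        MonoidalCategory.tensorHom_def]
    rw [Comon.tensorObj_comul, ← Category.assoc, h]
    simp only [tensorμ, Category.assoc, Iso.inv_hom_id_assoc, Iso.hom_inv_id_assoc,
      ← MonoidalCategory.whiskerLeft_comp_assoc]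
    rw [← comp_whiskerRight_assoc, IsCommComonObj.comul_comm]

/-- The comultiplication of `X ⊗ Y` interleaves two copies; discarding `Y` in the first and `X` in
the second leaves the identity by the counit laws. This is the uniqueness half of the product
property. -/
theorem comonLift_fst_snd : comonLift (comonFst X Y) (comonSnd X Y) = 𝟙 (X ⊗ Y) := by
  rw [comonLift, comonFst, comonSnd, Comon.tensorObj_comul, ← tensorHom_comp_tensorHom,
    ← id_tensorHom, ← tensorHom_id, Category.assoc, ← tensorμ_natural_assoc,
    tensorHom_comp_tensorHom_assoc]
  rw [id_tensorHom, comul_counit, tensorHom_id, counit_comul, tensorμ, braiding_tensorUnit_left]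
  monoidal

theorem tensor_hom_ext {f g : X ⟶ Y ⊗ Z} [IsComonHom f] [IsComonHom g]
    (h₁ : f ≫ comonFst Y Z = g ≫ comonFst Y Z) (h₂ : f ≫ comonSnd Y Z = g ≫ comonSnd Y Z) :
    f = g := by
  rw [← Category.comp_id f, ← Category.comp_id g, ← comonLift_fst_snd, comp_comonLift,
    comp_comonLift, h₁, h₂]

instance [IsCommComonObj X] (f : X ⟶ Y) (g : X ⟶ Z) [IsComonHom f] [IsComonHom g] :
    IsComonHom (comonLift f g) :=
  inferInstanceAs (IsComonHom (Δ[X] ≫ (f ⊗ₘ g)))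

instance : IsComonHom (comonFst X Y) := by
  let _ := ComonObj.instTensorUnit C
  have := isComonHom_counit (X := Y)
  have := isComonHom_rightUnitor_hom (X := X)
  rw [comonFst, ← id_tensorHom]
  infer_instance

instance : IsComonHom (comonSnd X Y) := by
  let _ := ComonObj.instTensorUnit C
  have := isComonHom_counit (X := X)
  have := isComonHom_leftUnitor_hom (X := Y)
  rw [comonSnd, ← tensorHom_id]
  infer_instance

/-- Write the identity as the pairing of the projections and move the braiding through it by
naturality: it meets the comultiplication, which absorbs it by cocommutativity. -/
theorem braiding_eq_comonLift [IsCommComonObj X] [IsCommComonObj Y] :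
    (β_ X Y).hom = comonLift (comonSnd X Y) (comonFst X Y) := by
  rw [← Category.id_comp (β_ X Y).hom, ← comonLift_fst_snd, comonLift, comonLift, Category.assoc,
    BraidedCategory.braiding_naturality, ← Category.assoc, IsCommComonObj.comul_comm]

instance isComonHom_braiding [IsCommComonObj X] [IsCommComonObj Y] :
    IsComonHom (β_ X Y).hom := by
  rw [braiding_eq_comonLift]
  infer_instance

theorem associator_hom_comonFst {X : C} : (α_ X Y Z).hom ≫ comonFst X (Y ⊗ Z) =
    comonFst (X ⊗ Y) Z ≫ comonFst X Y := by
  rw [comonFst, ← IsComonHom.hom_counit (comonFst Y Z)]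
  simp [comonFst]

theorem associator_hom_comonSnd_comonFst {Y : C} :
    (α_ X Y Z).hom ≫ comonSnd X (Y ⊗ Z) ≫ comonFst Y Z =
    comonFst (X ⊗ Y) Z ≫ comonSnd X Y := by
  have h := tensorHom_comonSnd (𝟙 X) (comonFst Y Z)
  rw [← h, ← Category.assoc]
  congr 1
  simp [comonFst]

theorem associator_hom_comonSnd_comonSnd {Z : C} :
    (α_ X Y Z).hom ≫ comonSnd X (Y ⊗ Z) ≫ comonSnd Y Z =
    comonSnd (X ⊗ Y) Z := by
  simp [comonSnd, MonoidalCategory.tensorHom_def]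

/-- Turns a coherence isomorphism that happens to be an identity, as occurs in a PROP, into an
equality of comonoid structures. -/
theorem ComonObj.eq_of_isComonHom_id {C : Type u} [Category.{v} C] [MonoidalCategory C] {X : C}
    (s t : ComonObj X) (h : @IsComonHom C _ _ X X s t (𝟙 X)) : s = t := by
  have h₁ := @IsComonHom.hom_counit C _ _ X X s t _ h
  have h₂ := @IsComonHom.hom_comul C _ _ X X s t _ h
  rw [Category.id_comp] at h₁ h₂
  rw [id_tensorHom_id, Category.comp_id] at h₂
  cases s
  cases t
  cases h₁
  cases h₂
  rfl

end CommutativeComonoids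

/-! ### Comonoid structures and projections in a PROP with an algebra. -/

namespace GenAlg

variable {P : PROP.{w}} (M : GenAlg dagTheory P)

/-- The unit. -/
def eta : P.Hom 0 1 := M.op (.inl .eta)

/-- The multiplication. -/
def nabla : P.Hom 2 1 := M.op (.inl .nabla)

/-- The counit. -/
def eps : P.Hom 1 0 := M.op (.inl .eps)

/-- The comultiplication. -/
def delta : P.Hom 1 2 := M.op (.inl .delta)

/-- The node. -/
def lam : P.Hom 1 1 := M.op (.inr ())

theorem eta_nabla : P.comp (P.tensor M.eta (P.id 1)) M.nabla = P.id 1 :=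
  M.eqn (SumEqn.inl Bialg.Eqn.unit_left)

theorem nabla_assoc : P.comp (P.tensor M.nabla (P.id 1)) M.nabla =
    P.comp (P.tensor (P.id 1) M.nabla) M.nabla :=
  M.eqn (SumEqn.inl Bialg.Eqn.mul_assoc)

theorem symm_nabla : P.comp (P.symm 1 1) M.nabla = M.nabla :=
  M.eqn (SumEqn.inl Bialg.Eqn.mul_comm)

theorem delta_nabla : P.comp M.delta M.nabla = P.id 1 :=
  M.eqn (SumEqn.inl Bialg.Eqn.degenerate)

theorem nabla_eps : P.comp M.nabla M.eps = P.tensor M.eps M.eps :=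
  M.eqn (SumEqn.inl Bialg.Eqn.mul_counit)

theorem eta_eps : P.comp M.eta M.eps = P.id 0 :=
  M.eqn (SumEqn.inl Bialg.Eqn.unit_counit)

theorem eta_delta : P.comp M.eta M.delta = P.tensor M.eta M.eta :=
  M.eqn (SumEqn.inl Bialg.Eqn.unit_comul)

theorem nabla_delta : P.comp M.nabla M.delta =
    P.comp (b := 4) (P.comp (b := 4) (P.tensor M.delta M.delta)
      (P.tensor (a := 3) (b := 3) (P.tensor (P.id 1) (P.symm 1 1)) (P.id 1)))
        (P.tensor M.nabla M.nabla) :=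
  M.eqn (SumEqn.inl Bialg.Eqn.mul_comul)

/-- The comonoid structure on the generating object. -/
abbrev comonOne : ComonObj (⟨1⟩ : P.Obj) where
  counit := M.eps
  comul := M.delta
  counit_comul := M.eqn (SumEqn.inl Bialg.Eqn.counit_left)
  comul_counit := M.eqn (SumEqn.inl Bialg.Eqn.counit_right)
  comul_assoc := (M.eqn (SumEqn.inl Bialg.Eqn.comul_assoc)).symm.trans
    (congrArg (P.comp M.delta) (P.comp_id (P.tensor M.delta (P.id 1))).symm)

theorem isCommComonObj_comonOne : @IsCommComonObj P.Obj _ _ _ ⟨1⟩ M.comonOne :=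
  letI := M.comonOne
  ⟨M.eqn (SumEqn.inl Bialg.Eqn.comul_comm)⟩


/-- The comonoid structure on every object. -/
def comon : ∀ n : ℕ, ComonObj (⟨n⟩ : P.Obj)
  | 0 => ComonObj.instTensorUnit P.Obj
  | n + 1 =>
    letI := comon n
    letI := M.comonOne
    (inferInstance : ComonObj ((⟨n⟩ : P.Obj) ⊗ ⟨1⟩))

theorem isCommComonObj_comon : ∀ n : ℕ, @IsCommComonObj P.Obj _ _ _ ⟨n⟩ (M.comon n)
  | 0 => CommComon.instCommComonObjUnit
  | n + 1 =>
    letI := M.comon n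
    letI := M.comonOne
    have := isCommComonObj_comon n
    have := M.isCommComonObj_comonOne
    (inferInstance : IsCommComonObj ((⟨n⟩ : P.Obj) ⊗ ⟨1⟩))

theorem comon_one : M.comon 1 = M.comonOne :=
  letI := M.comonOne
  ComonObj.eq_of_isComonHom_id _ _ (isComonHom_leftUnitor_hom (X := (⟨1⟩ : P.Obj)))

/-- Since `a + 0` and `a + (b + 1)` reduce by definition, the right unitor and the associators with
third object `1` are identities of the PROP; being morphisms of comonoids, they identify the
structures. -/
theorem comon_add (a b : ℕ) : M.comon (a + b) =
    (letI := M.comon a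
    letI := M.comon b
    (inferInstance : ComonObj ((⟨a⟩ : P.Obj) ⊗ ⟨b⟩))) := by
  induction b with
  | zero =>
    let _ := M.comon a
    exact (ComonObj.eq_of_isComonHom_id _ _
      (isComonHom_rightUnitor_hom (X := (⟨a⟩ : P.Obj)))).symm
  | succ b ih =>
    have h : M.comon (a + (b + 1)) =
        (letI := M.comon (a + b)
        letI := M.comonOne
        (inferInstance : ComonObj ((⟨a + b⟩ : P.Obj) ⊗ ⟨1⟩))) := rfl
    rw [h, ih]
    let _ := M.comon a
    let _ := M.comon b
    let _ := M.comonOne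
    exact ComonObj.eq_of_isComonHom_id _ _
      (isComonHom_associator_hom (X := (⟨a⟩ : P.Obj)) (Y := ⟨b⟩) (Z := ⟨1⟩))

/-- The morphisms of comonoids in a PROP. -/
def IsCopy {a b : ℕ} (f : P.Hom a b) : Prop :=
  @IsComonHom P.Obj _ _ ⟨a⟩ ⟨b⟩ (M.comon a) (M.comon b) f

/-- The counit of every object. -/
def discard (a : ℕ) : P.Hom a 0 := (M.comon a).counit

/-- The pairing. -/
def lift {a b c : ℕ} (f : P.Hom a b) (g : P.Hom a c) : P.Hom a (b + c) :=
  @comonLift P.Obj _ _ ⟨a⟩ ⟨b⟩ ⟨c⟩ (M.comon a) f g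

/-- The first projection. -/
def fst (a b : ℕ) : P.Hom (a + b) a := @comonFst P.Obj _ _ ⟨a⟩ ⟨b⟩ (M.comon b)

/-- The second projection. -/
def snd (a b : ℕ) : P.Hom (a + b) b := @comonSnd P.Obj _ _ ⟨a⟩ ⟨b⟩ (M.comon a)

theorem discard_one : M.discard 1 = M.eps :=
  congrArg (fun s : ComonObj (⟨1⟩ : P.Obj) => s.counit) M.comon_one

theorem fst_zero (a : ℕ) : M.fst a 0 = P.id a :=
  (P.comp_id _).trans (P.tensor_id a 0)

theorem snd_zero_one : M.snd 0 1 = P.id 1 :=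
  (P.comp_id _).trans (P.tensor_id 0 1)

theorem lift_comp_tensor {a b c b' c' : ℕ} (f : P.Hom a b) (g : P.Hom a c) (f' : P.Hom b b')
    (g' : P.Hom c c') :
    P.comp (M.lift f g) (P.tensor f' g') = M.lift (P.comp f f') (P.comp g g') :=
  let _ := M.comon a
  comonLift_comp_tensorHom (X := (⟨a⟩ : P.Obj)) (Y := ⟨b⟩) (Z := ⟨c⟩) (Y' := ⟨b'⟩) (Z' := ⟨c'⟩)
    f g f' g'

variable {M}

namespace IsCopy

theorem id (a : ℕ) : M.IsCopy (P.id a) :=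
  let _ := M.comon a
  (inferInstance : IsComonHom (𝟙 (⟨a⟩ : P.Obj)))

theorem comp {a b c : ℕ} {f : P.Hom a b} {g : P.Hom b c} (hf : M.IsCopy f) (hg : M.IsCopy g) :
    M.IsCopy (P.comp f g) :=
  let _ := M.comon a
  let _ := M.comon b
  let _ := M.comon c
  have : IsComonHom (M := (⟨a⟩ : P.Obj)) (N := ⟨b⟩) f := hf
  have : IsComonHom (M := (⟨b⟩ : P.Obj)) (N := ⟨c⟩) g := hg
  (inferInstance : IsComonHom (CategoryStruct.comp (X := (⟨a⟩ : P.Obj)) (Y := ⟨b⟩) (Z := ⟨c⟩) f g))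

theorem tensor {a b c d : ℕ} {f : P.Hom a b} {g : P.Hom c d} (hf : M.IsCopy f)
    (hg : M.IsCopy g) : M.IsCopy (P.tensor f g) := by
  unfold IsCopy
  rw [comon_add, comon_add]
  let _ := M.comon a
  let _ := M.comon b
  let _ := M.comon c
  let _ := M.comon d
  have : IsComonHom (M := (⟨a⟩ : P.Obj)) (N := ⟨b⟩) f := hf
  have : IsComonHom (M := (⟨c⟩ : P.Obj)) (N := ⟨d⟩) g := hg
  exact isComonHom_tensorHom (X := (⟨a⟩ : P.Obj)) (Y := ⟨b⟩) (Z := ⟨c⟩) (W := ⟨d⟩) f g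

theorem lift {a b c : ℕ} {f : P.Hom a b} {g : P.Hom a c} (hf : M.IsCopy f)
    (hg : M.IsCopy g) : M.IsCopy (M.lift f g) := by
  unfold IsCopy
  rw [comon_add]
  let _ := M.comon a
  let _ := M.comon b
  let _ := M.comon c
  have := M.isCommComonObj_comon a
  have : IsComonHom (M := (⟨a⟩ : P.Obj)) (N := ⟨b⟩) f := hf
  have : IsComonHom (M := (⟨a⟩ : P.Obj)) (N := ⟨c⟩) g := hg
  exact (inferInstance : IsComonHom
    (comonLift (X := (⟨a⟩ : P.Obj)) (Y := ⟨b⟩) (Z := ⟨c⟩) f g))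

theorem fst (a b : ℕ) : M.IsCopy (M.fst a b) := by
  unfold IsCopy
  rw [comon_add]
  let _ := M.comon a
  let _ := M.comon b
  exact (inferInstance : IsComonHom (comonFst (⟨a⟩ : P.Obj) ⟨b⟩))

theorem snd (a b : ℕ) : M.IsCopy (M.snd a b) := by
  unfold IsCopy
  rw [comon_add]
  let _ := M.comon a
  let _ := M.comon b
  exact (inferInstance : IsComonHom (comonSnd (⟨a⟩ : P.Obj) ⟨b⟩))

theorem discard (a : ℕ) : M.IsCopy (M.discard a) :=
  let _ := M.comon a
  isComonHom_counit (X := (⟨a⟩ : P.Obj))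

theorem symm (a b : ℕ) : M.IsCopy (P.symm a b) := by
  unfold IsCopy
  rw [comon_add, comon_add]
  let _ := M.comon a
  let _ := M.comon b
  have := M.isCommComonObj_comon a
  have := M.isCommComonObj_comon b
  exact isComonHom_braiding (X := (⟨a⟩ : P.Obj)) (Y := ⟨b⟩)

theorem comp_discard {a b : ℕ} {f : P.Hom a b} (hf : M.IsCopy f) :
    P.comp f (M.discard b) = M.discard a :=
  @IsComonHom.hom_counit P.Obj _ _ ⟨a⟩ ⟨b⟩ (M.comon a) (M.comon b) f hf

theorem eq_discard {a : ℕ} {f : P.Hom a 0} (hf : M.IsCopy f) : f = M.discard a :=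
  (P.comp_id f).symm.trans hf.comp_discard

theorem comp_lift {a b c d : ℕ} {h : P.Hom a b} (hh : M.IsCopy h) (f : P.Hom b c)
    (g : P.Hom b d) : P.comp h (M.lift f g) = M.lift (P.comp h f) (P.comp h g) :=
  let _ := M.comon a
  let _ := M.comon b
  have : IsComonHom (M := (⟨a⟩ : P.Obj)) (N := ⟨b⟩) h := hh
  comp_comonLift (W := (⟨a⟩ : P.Obj)) (X := ⟨b⟩) (Y := ⟨c⟩) (Z := ⟨d⟩) h f g

theorem lift_fst {a b c : ℕ} (f : P.Hom a b) {g : P.Hom a c} (hg : M.IsCopy g) :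
    P.comp (M.lift f g) (M.fst b c) = f :=
  let _ := M.comon a
  let _ := M.comon c
  have : IsComonHom (M := (⟨a⟩ : P.Obj)) (N := ⟨c⟩) g := hg
  comonLift_fst (X := (⟨a⟩ : P.Obj)) (Y := ⟨b⟩) (Z := ⟨c⟩) f g

theorem lift_snd {a b c : ℕ} {f : P.Hom a b} (hf : M.IsCopy f) (g : P.Hom a c) :
    P.comp (M.lift f g) (M.snd b c) = g :=
  let _ := M.comon a
  let _ := M.comon b
  have : IsComonHom (M := (⟨a⟩ : P.Obj)) (N := ⟨b⟩) f := hf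
  comonLift_snd (X := (⟨a⟩ : P.Obj)) (Y := ⟨b⟩) (Z := ⟨c⟩) f g

theorem tensor_fst {a b c d : ℕ} (f : P.Hom a b) {g : P.Hom c d} (hg : M.IsCopy g) :
    P.comp (P.tensor f g) (M.fst b d) = P.comp (M.fst a c) f :=
  let _ := M.comon c
  let _ := M.comon d
  have : IsComonHom (M := (⟨c⟩ : P.Obj)) (N := ⟨d⟩) g := hg
  tensorHom_comonFst (X := (⟨a⟩ : P.Obj)) (Y := ⟨b⟩) (Z := ⟨c⟩) (W := ⟨d⟩) f g

theorem tensor_snd {a b c d : ℕ} {f : P.Hom a b} (hf : M.IsCopy f) (g : P.Hom c d) :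
    P.comp (P.tensor f g) (M.snd b d) = P.comp (M.snd a c) g :=
  let _ := M.comon a
  let _ := M.comon b
  have : IsComonHom (M := (⟨a⟩ : P.Obj)) (N := ⟨b⟩) f := hf
  tensorHom_comonSnd (X := (⟨a⟩ : P.Obj)) (Y := ⟨b⟩) (Z := ⟨c⟩) (W := ⟨d⟩) f g

theorem add_ext {a b c : ℕ} {f g : P.Hom a (b + c)} (hf : M.IsCopy f) (hg : M.IsCopy g)
    (h₁ : P.comp f (M.fst b c) = P.comp g (M.fst b c))
    (h₂ : P.comp f (M.snd b c) = P.comp g (M.snd b c)) : f = g := by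
  unfold IsCopy at hf hg
  rw [comon_add] at hf hg
  let _ := M.comon a
  let _ := M.comon b
  let _ := M.comon c
  have : IsComonHom (M := (⟨a⟩ : P.Obj)) (N := ⟨b⟩ ⊗ ⟨c⟩) f := hf
  have : IsComonHom (M := (⟨a⟩ : P.Obj)) (N := ⟨b⟩ ⊗ ⟨c⟩) g := hg
  exact tensor_hom_ext (X := (⟨a⟩ : P.Obj)) (Y := ⟨b⟩) (Z := ⟨c⟩) (f := f) (g := g) h₁ h₂

end IsCopy

theorem symm_fst (a b : ℕ) : P.comp (P.symm a b) (M.fst b a) = M.snd a b := by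
  let _ := M.comon a
  let _ := M.comon b
  have := M.isCommComonObj_comon a
  have := M.isCommComonObj_comon b
  have h : (β_ (⟨a⟩ : P.Obj) ⟨b⟩).hom ≫ comonFst (⟨b⟩ : P.Obj) ⟨a⟩ =
      comonSnd (⟨a⟩ : P.Obj) ⟨b⟩ := by
    rw [braiding_eq_comonLift, comonLift_fst]
  exact h

theorem symm_snd (a b : ℕ) : P.comp (P.symm a b) (M.snd b a) = M.fst a b := by
  let _ := M.comon a
  let _ := M.comon b
  have := M.isCommComonObj_comon a
  have := M.isCommComonObj_comon b
  have h : (β_ (⟨a⟩ : P.Obj) ⟨b⟩).hom ≫ comonSnd (⟨b⟩ : P.Obj) ⟨a⟩ =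
      comonFst (⟨a⟩ : P.Obj) ⟨b⟩ := by
    rw [braiding_eq_comonLift, comonLift_snd]
  exact h

/-- This and the next two identities express that the projections are compatible with the
associator, here an identity. They match the recursion that defines `proj`. -/
theorem fst_add_one (a b : ℕ) : M.fst a (b + 1) = P.comp (M.fst (a + b) 1) (M.fst a b) := by
  unfold fst
  rw [M.comon_add b 1]
  let _ := M.comon b
  let _ := M.comon 1
  refine Eq.trans ?_ (associator_hom_comonFst (X := (⟨a⟩ : P.Obj)) (Y := ⟨b⟩) (Z := ⟨1⟩))
  exact (Category.id_comp _).symm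

theorem snd_fst (a b : ℕ) : P.comp (M.snd a (b + 1)) (M.fst b 1) =
    P.comp (M.fst (a + b) 1) (M.snd a b) :=
  let _ := M.comon a
  let _ := M.comon 1
  (Category.id_comp _).symm.trans
    (associator_hom_comonSnd_comonFst (X := (⟨a⟩ : P.Obj)) (Y := ⟨b⟩) (Z := ⟨1⟩))

theorem snd_snd (a b : ℕ) : P.comp (M.snd a (b + 1)) (M.snd b 1) = M.snd (a + b) 1 := by
  unfold snd
  rw [comon_add]
  let _ := M.comon a
  let _ := M.comon b
  exact (Category.id_comp _).symm.trans
    (associator_hom_comonSnd_comonSnd (X := (⟨a⟩ : P.Obj)) (Y := ⟨b⟩) (Z := ⟨1⟩))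

namespace IsCopy

theorem eta : M.IsCopy M.eta := by
  unfold IsCopy
  rw [comon_one]
  let _ := ComonObj.instTensorUnit P.Obj
  let _ := M.comonOne
  exact IsComonHom.mk (M := 𝟙_ P.Obj) (N := ⟨1⟩) (f := M.eta) M.eta_eps
    (M.eta_delta.trans (P.id_comp _).symm)

/-- The equations for ε∇ and Δ∇ are the two laws of a morphism of comonoids from `1 ⊗ 1` to `1`. -/
theorem nabla : M.IsCopy M.nabla := by
  unfold IsCopy
  rw [show M.comon 2 = _ from M.comon_add 1 1, comon_one]
  let _ := M.comonOne
  -- All associators in `tensorμ` are identities here, so that only the exchange of the two middle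
  -- wires remains, up to bracketing.
  have hμ : tensorμ (⟨1⟩ : P.Obj) ⟨1⟩ ⟨1⟩ ⟨1⟩ =
      P.tensor (a := 3) (b := 3) (P.tensor (P.id 1) (P.symm 1 1)) (P.id 1) := by
    change P.comp (P.id 4) (P.comp (P.tensor (P.id 1) (P.id 3)) (P.comp (P.tensor (P.id 1)
      (P.tensor (P.symm 1 1) (P.id 1))) (P.comp (P.tensor (P.id 1) (P.id 3)) (P.id 4)))) = _
    rw [P.tensor_id 1 3]
    refine (P.id_comp _).trans ((P.id_comp _).trans ((congrArg _ (P.id_comp _)).trans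
      ((P.comp_id _).trans ?_)))
    exact (P.tensor_assoc (P.id 1) (P.symm 1 1) (P.id 1)).symm
  refine IsComonHom.mk (M := (⟨1⟩ ⊗ ⟨1⟩ : P.Obj)) (N := ⟨1⟩) (f := M.nabla) ?_ ?_
  · exact M.nabla_eps.trans (P.comp_id _).symm
  · rw [Comon.tensorObj_comul, hμ]
    exact M.nabla_delta

end IsCopy

variable (M) in
/-- The projections. -/
def proj : ∀ {n : ℕ}, Fin n → P.Hom n 1
  | n + 1, j => Fin.lastCases (M.snd n 1) (fun i => P.comp (M.fst n 1) (proj i)) j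

theorem proj_last (n : ℕ) : M.proj (Fin.last n) = M.snd n 1 := by
  simp [proj]

theorem proj_castSucc {n : ℕ} (j : Fin n) :
    M.proj j.castSucc = P.comp (M.fst n 1) (M.proj j) := by
  simp [proj]

theorem proj_castAdd {a b : ℕ} (j : Fin a) :
    M.proj (Fin.castAdd b j) = P.comp (M.fst a b) (M.proj j) := by
  induction b with
  | zero => exact (P.id_comp _).symm.trans (congrArg (P.comp · _) (M.fst_zero a).symm)
  | succ b ih =>
    rw [fst_add_one, P.assoc, ← ih, ← proj_castSucc]
    rfl

theorem proj_natAdd {a b : ℕ} (j : Fin b) :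
    M.proj (Fin.natAdd a j) = P.comp (M.snd a b) (M.proj j) := by
  induction b with
  | zero => exact j.elim0
  | succ b ih =>
    refine Fin.lastCases ?_ (fun j => ?_) j
    · rw [proj_last, snd_snd, ← proj_last]
      rfl
    · rw [proj_castSucc, ← P.assoc, snd_fst, P.assoc, ← ih, ← proj_castSucc]
      rfl

theorem IsCopy.proj {n : ℕ} (j : Fin n) : M.IsCopy (M.proj j) := by
  induction n with
  | zero => exact j.elim0
  | succ n ih =>
    refine Fin.lastCases ?_ (fun j => ?_) j
    · rw [proj_last]
      exact .snd n 1
    · rw [proj_castSucc]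
      exact (IsCopy.fst n 1).comp (ih j)

/-- Uniqueness of pairings, applied one coordinate at a time; the induction starts because `0` is
terminal for morphisms of comonoids. -/
theorem IsCopy.ext {a b : ℕ} {f g : P.Hom a b} (hf : M.IsCopy f) (hg : M.IsCopy g)
    (h : ∀ j, P.comp f (M.proj j) = P.comp g (M.proj j)) : f = g := by
  induction b with
  | zero => rw [hf.eq_discard, hg.eq_discard]
  | succ b ih =>
    refine hf.add_ext hg (ih (hf.comp (.fst b 1)) (hg.comp (.fst b 1)) fun j => ?_) ?_
    · rw [P.assoc, P.assoc, ← proj_castSucc, h]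
    · rw [← proj_last, h]

theorem proj_zero_one : M.proj (0 : Fin 1) = P.id 1 :=
  (proj_last 0).trans M.snd_zero_one

/-! ### The semilattice of comonoid morphisms to the generating object. -/

variable (M) in
/-- The morphisms of comonoids to the generating object. -/
abbrev CopyHom (a : ℕ) := {f : P.Hom a 1 // M.IsCopy f}

/-- Convolution: copy the input, apply both morphisms, multiply. The result is again a morphism of
comonoids because ∇ is one. -/
instance (a : ℕ) : Max (M.CopyHom a) where
  max f g := ⟨P.comp (M.lift f.1 g.1) M.nabla, (f.2.lift g.2).comp .nabla⟩

theorem coe_sup {a : ℕ} (f g : M.CopyHom a) :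
    (f ⊔ g).1 = P.comp (M.lift f.1 g.1) M.nabla := rfl

theorem lift_symm {a b c : ℕ} {f : P.Hom a b} {g : P.Hom a c} (hf : M.IsCopy f)
    (hg : M.IsCopy g) : P.comp (M.lift f g) (P.symm b c) = M.lift g f := by
  refine ((hf.lift hg).comp (.symm b c)).add_ext (hg.lift hf) ?_ ?_
  · rw [P.assoc, symm_fst, IsCopy.lift_snd hf, IsCopy.lift_fst _ hf]
  · rw [P.assoc, symm_snd, IsCopy.lift_fst _ hg, IsCopy.lift_snd hg]

theorem lift_assoc {a b c : ℕ} {f : P.Hom a b} {g : P.Hom a c} {h : P.Hom a 1}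
    (hf : M.IsCopy f) (hg : M.IsCopy g) (hh : M.IsCopy h) :
    M.lift (M.lift f g) h = M.lift f (M.lift g h) := by
  -- The object `b + (c + 1)` is `b + c + 1` by definition, so the right-hand side can be tested
  -- against the projections of the left-hand one.
  have hr : M.IsCopy (a := a) (b := b + c + 1) (M.lift f (M.lift g h) : P.Hom a (b + (c + 1))) :=
    hf.lift (hg.lift hh)
  refine ((hf.lift hg).lift hh).add_ext hr ?_ ?_
  · rw [IsCopy.lift_fst _ hh]
    refine (hf.lift hg).add_ext (hr.comp (.fst (b + c) 1)) ?_ ?_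
    · rw [P.assoc, ← fst_add_one, IsCopy.lift_fst _ hg]
      exact (IsCopy.lift_fst _ (hg.lift hh)).symm
    · rw [P.assoc, ← snd_fst, ← P.assoc, IsCopy.lift_snd hf]
      exact ((congrArg (P.comp · _) (IsCopy.lift_snd hf _)).trans
        (IsCopy.lift_fst _ hh)).symm
  · rw [IsCopy.lift_snd (hf.lift hg), ← snd_snd, ← P.assoc]
    exact ((congrArg (P.comp · _) (IsCopy.lift_snd hf _)).trans (IsCopy.lift_snd hg _)).symm

theorem lift_self {a : ℕ} {f : P.Hom a 1} (hf : M.IsCopy f) :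
    M.lift f f = P.comp f M.delta := by
  have h : M.lift (P.id 1) (P.id 1) = M.delta :=
    (congrArg (P.comp _) (P.tensor_id 1 1)).trans ((P.comp_id _).trans
      (congrArg (fun s : ComonObj (⟨1⟩ : P.Obj) => s.comul) M.comon_one))
  rw [← h, hf.comp_lift, P.comp_id]

/-- Commutativity and associativity are those of ∇. Idempotence is the degenerate equation, because
pairing a comonoid morphism with itself is composing it with Δ. -/
instance (a : ℕ) : SemilatticeSup (M.CopyHom a) :=
  SemilatticeSup.mk'
    (fun f g => Subtype.ext <| by
      rw [coe_sup, coe_sup, ← lift_symm f.2 g.2, P.assoc]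
      exact congrArg _ M.symm_nabla.symm)
    (fun f g h => Subtype.ext <| by
      have h₁ := M.lift_comp_tensor (M.lift f.1 g.1) h.1 M.nabla (P.id 1)
      have h₂ := M.lift_comp_tensor f.1 (M.lift g.1 h.1) (P.id 1) M.nabla
      rw [P.comp_id] at h₁ h₂
      rw [coe_sup, coe_sup, coe_sup, coe_sup, ← h₁, ← h₂, P.assoc, P.assoc, lift_assoc f.2 g.2 h.2]
      exact congrArg _ M.nabla_assoc)
    (fun f => Subtype.ext <| by
      rw [coe_sup, lift_self f.2, P.assoc, M.delta_nabla, P.comp_id])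

/-- Discarding the input and then applying η is neutral for convolution by the unit law. -/
instance (a : ℕ) : OrderBot (M.CopyHom a) where
  bot := ⟨P.comp (M.discard a) M.eta, (IsCopy.discard a).comp .eta⟩
  bot_le f := by
    rw [← sup_eq_right]
    refine Subtype.ext ?_
    have h := M.lift_comp_tensor (M.discard a) f.1 M.eta (P.id 1)
    rw [P.comp_id] at h
    rw [coe_sup, ← h, P.assoc]
    refine (congrArg _ (M.eta_nabla.trans M.snd_zero_one.symm)).trans ?_
    exact IsCopy.lift_snd (.discard a) _

end GenAlg

/-! ### Relations as morphisms. -/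

/-- The disjoint union of two relations between finite ordinals. -/
def relSum {a b c d : ℕ} (r : Fin a → Fin b → Prop) (s : Fin c → Fin d → Prop) :
    Fin (a + c) → Fin (b + d) → Prop :=
  fun x y => Sum.LiftRel r s (finSumFinEquiv.symm x) (finSumFinEquiv.symm y)

namespace GenAlg

variable {P : PROP.{w}} {M : GenAlg dagTheory P}

/-- Precomposition with a morphism of comonoids. -/
def IsCopy.pull {a b : ℕ} {t : P.Hom a b} (ht : M.IsCopy t) (f : M.CopyHom b) : M.CopyHom a :=
  ⟨P.comp t f.1, ht.comp f.2⟩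

/-- Joins are built by copying and the bottom by discarding, and a comonoid morphism placed in front
commutes with both. -/
theorem IsCopy.pull_finset_sup {a b : ℕ} {t : P.Hom a b} (ht : M.IsCopy t) {ι : Type*}
    (s : Finset ι) (F : ι → M.CopyHom b) : ht.pull (s.sup F) = s.sup fun i => ht.pull (F i) := by
  refine Finset.apply_sup_eq_sup_comp ht.pull (fun f g => Subtype.ext ?_) (Subtype.ext ?_)
  · change P.comp t (P.comp _ _) = P.comp _ _
    rw [← P.assoc, ht.comp_lift]
    rfl
  · change P.comp t (P.comp _ _) = P.comp _ _
    rw [← P.assoc, ht.comp_discard]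

variable (M) in
/-- The projections as morphisms of comonoids. -/
def projHom {n : ℕ} (j : Fin n) : M.CopyHom n := ⟨M.proj j, .proj j⟩

open Classical in
variable (M) in
/-- The join of the projections to the elements of a set. -/
noncomputable def col {n : ℕ} (p : Fin n → Prop) : M.CopyHom n :=
  (Finset.univ.filter p).sup M.projHom

/-- The universal property of the join. The identities for `mat` below are proved by comparing the
upper bounds of each coordinate, which turns them into statements about relations. -/
theorem col_le_iff {n : ℕ} {p : Fin n → Prop} {f : M.CopyHom n} :
    M.col p ≤ f ↔ ∀ i, p i → M.projHom i ≤ f := by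
  simp [col]

theorem pull_col_le_iff {a b : ℕ} {t : P.Hom a b} (ht : M.IsCopy t) {p : Fin b → Prop}
    {f : M.CopyHom a} : ht.pull (M.col p) ≤ f ↔ ∀ j, p j → ht.pull (M.projHom j) ≤ f := by
  simp [col, ht.pull_finset_sup]

variable (M) in
/-- The morphism of a relation. -/
noncomputable def mat {a : ℕ} : ∀ {b : ℕ}, (Fin a → Fin b → Prop) → P.Hom a b
  | 0, _ => M.discard a
  | b + 1, r => M.lift (mat fun i j => r i (Fin.castSucc j)) (M.col fun i => r i (Fin.last b)).1

theorem IsCopy.mat {a b : ℕ} (r : Fin a → Fin b → Prop) : M.IsCopy (M.mat r) := by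
  induction b with
  | zero => exact .discard a
  | succ b ih => exact (ih _).lift (M.col _).2

theorem mat_proj {a b : ℕ} (r : Fin a → Fin b → Prop) (j : Fin b) :
    P.comp (M.mat r) (M.proj j) = (M.col fun i => r i j).1 := by
  induction b with
  | zero => exact j.elim0
  | succ b ih =>
    refine Fin.lastCases ?_ (fun j => ?_) j
    · rw [proj_last, mat, IsCopy.lift_snd (.mat _)]
    · rw [proj_castSucc, ← P.assoc, mat, IsCopy.lift_fst _ (M.col _).2, ih]

theorem pull_projHom {a b : ℕ} (r : Fin a → Fin b → Prop) (j : Fin b) :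
    (IsCopy.mat (M := M) r).pull (M.projHom j) = M.col fun i => r i j :=
  Subtype.ext (mat_proj r j)

theorem IsCopy.eq_mat {a b : ℕ} {f : P.Hom a b} (hf : M.IsCopy f) {r : Fin a → Fin b → Prop}
    (h : ∀ j, hf.pull (M.projHom j) = M.col fun i => r i j) : f = M.mat r :=
  hf.ext (.mat r) fun j => (congrArg Subtype.val (h j)).trans (mat_proj r j).symm

theorem mat_id (a : ℕ) : M.mat (fun i j : Fin a => i = j) = P.id a := by
  refine ((IsCopy.id a).eq_mat fun j => eq_of_forall_ge_iff fun c => ?_).symm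
  have h : (IsCopy.id (M := M) a).pull (M.projHom j) = M.projHom j := Subtype.ext (P.id_comp _)
  rw [h]
  simp [col_le_iff]

/-- In coordinate `k`, an upper bound of either side is a bound of all projections `i` for which
some `j` satisfies `r i j` and `s j k`. -/
theorem mat_comp {a b c : ℕ} (r : Fin a → Fin b → Prop) (s : Fin b → Fin c → Prop) :
    M.mat (Relation.Comp r s) = P.comp (M.mat r) (M.mat s) := by
  refine (((IsCopy.mat r).comp (.mat s)).eq_mat fun k => eq_of_forall_ge_iff fun f => ?_).symm
  have h : ((IsCopy.mat (M := M) r).comp (.mat s)).pull (M.projHom k) =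
      (IsCopy.mat r).pull (M.col fun j => s j k) := by
    rw [← pull_projHom]
    exact Subtype.ext (P.assoc _ _ _)
  rw [h, pull_col_le_iff]
  simp only [pull_projHom, col_le_iff, Relation.Comp]
  grind

theorem mat_relSum {a b c d : ℕ} (r : Fin a → Fin b → Prop) (s : Fin c → Fin d → Prop) :
    M.mat (relSum r s) = P.tensor (M.mat r) (M.mat s) := by
  refine (((IsCopy.mat r).tensor (.mat s)).eq_mat fun k => eq_of_forall_ge_iff fun f => ?_).symm
  have hl (i : Fin a) : (IsCopy.fst (M := M) a c).pull (M.projHom i) =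
      M.projHom (Fin.castAdd c i) := Subtype.ext (proj_castAdd i).symm
  have hr (i : Fin c) : (IsCopy.snd (M := M) a c).pull (M.projHom i) =
      M.projHom (Fin.natAdd a i) := Subtype.ext (proj_natAdd i).symm
  rw [col_le_iff]
  refine Fin.addCases (fun j => ?_) (fun j => ?_) k
  · have h : ((IsCopy.mat (M := M) r).tensor (.mat s)).pull (M.projHom (Fin.castAdd d j)) =
        (IsCopy.fst a c).pull (M.col fun i => r i j) := Subtype.ext <| by
      change P.comp _ (M.proj _) = P.comp _ _
      rw [proj_castAdd, ← P.assoc, IsCopy.tensor_fst _ (.mat s), P.assoc, mat_proj]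
    rw [h, pull_col_le_iff]
    simp only [hl]
    refine ⟨fun H => Fin.addCases (fun i hi => H i ?_) (fun i hi => ?_), fun H i hi => H _ ?_⟩
    all_goals simp_all [relSum]
  · have h : ((IsCopy.mat (M := M) r).tensor (.mat s)).pull (M.projHom (Fin.natAdd b j)) =
        (IsCopy.snd a c).pull (M.col fun i => s i j) := Subtype.ext <| by
      change P.comp _ (M.proj _) = P.comp _ _
      rw [proj_natAdd, ← P.assoc, IsCopy.tensor_snd (.mat r), P.assoc, mat_proj]
    rw [h, pull_col_le_iff]
    simp only [hr]
    refine ⟨fun H => Fin.addCases (fun i hi => ?_) (fun i hi => H i ?_), fun H i hi => H _ ?_⟩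
    all_goals simp_all [relSum]

theorem mat_finAddFlip (a b : ℕ) :
    M.mat (fun (x : Fin (a + b)) y => finAddFlip x = y) = P.symm a b := by
  refine ((IsCopy.symm a b).eq_mat fun k => eq_of_forall_ge_iff fun f => ?_).symm
  have h : (IsCopy.symm (M := M) a b).pull (M.projHom k) = M.projHom (finAddFlip k) := by
    refine Subtype.ext ?_
    change P.comp _ (M.proj _) = M.proj _
    refine Fin.addCases (fun j => ?_) (fun j => ?_) k
    · rw [proj_castAdd, ← P.assoc, symm_fst, finAddFlip_apply_castAdd, proj_natAdd]
    · rw [proj_natAdd, ← P.assoc, symm_snd, finAddFlip_apply_natAdd, proj_castAdd]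
  have e (x : Fin (a + b)) : finAddFlip x = k ↔ x = finAddFlip k := by
    rw [← Equiv.eq_symm_apply]
    rfl
  rw [h, col_le_iff]
  simp [e]

theorem mat_eta : M.mat (fun (_ : Fin 0) (_ : Fin 1) => True) = M.eta := by
  refine (IsCopy.eta.eq_mat fun k => eq_of_forall_ge_iff fun f => ?_).symm
  have h : IsCopy.eta.pull (M.projHom k) = ⊥ := by
    refine Subtype.ext ?_
    rw [Subsingleton.elim k 0]
    have h₁ : P.comp M.eta (M.proj (0 : Fin 1)) = M.eta := by rw [proj_zero_one, P.comp_id]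
    -- On the object `0` discarding is the identity, so the bottom element is η itself.
    exact h₁.trans (P.id_comp _).symm
  rw [h, col_le_iff]
  simp

theorem mat_eps : M.mat (fun (_ : Fin 1) (_ : Fin 0) => True) = M.eps := M.discard_one

theorem mat_nabla : M.mat (fun (_ : Fin 2) (_ : Fin 1) => True) = M.nabla := by
  refine (IsCopy.nabla.eq_mat fun k => eq_of_forall_ge_iff fun f => ?_).symm
  have h : IsCopy.nabla.pull (M.projHom k) = M.projHom 0 ⊔ M.projHom 1 := by
    refine Subtype.ext ?_
    rw [Subsingleton.elim k 0]
    have h₁ : P.comp M.nabla (M.proj (0 : Fin 1)) = M.nabla := by rw [proj_zero_one, P.comp_id]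
    -- The pairing of the two projections is the identity, so their join is ∇.
    have h₂ : M.lift (M.proj (Fin.castAdd 1 (0 : Fin 1))) (M.proj (Fin.natAdd 1 (0 : Fin 1))) =
        P.id (1 + 1) := by
      rw [proj_castAdd, proj_natAdd, proj_zero_one, P.comp_id, P.comp_id]
      refine ((IsCopy.fst 1 1).lift (.snd 1 1)).add_ext (.id _) ?_ ?_
      · rw [IsCopy.lift_fst _ (.snd 1 1), P.id_comp]
      · rw [IsCopy.lift_snd (.fst 1 1), P.id_comp]
    exact h₁.trans ((P.id_comp _).symm.trans (congrArg (P.comp · M.nabla) h₂.symm))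
  rw [h, col_le_iff]
  simp

theorem mat_delta : M.mat (fun (_ : Fin 1) (_ : Fin 2) => True) = M.delta := by
  rw [← P.id_comp M.delta, ← lift_self (.id 1)]
  refine (((IsCopy.id 1).lift (.id 1)).eq_mat fun k => eq_of_forall_ge_iff fun f => ?_).symm
  have h : ((IsCopy.id (M := M) 1).lift (.id 1)).pull (M.projHom k) = M.projHom 0 := by
    refine Subtype.ext ?_
    refine Eq.trans ?_ proj_zero_one.symm
    refine Fin.addCases (m := 1) (n := 1) (fun i => ?_) (fun i => ?_) k
    · refine (congrArg (P.comp _) (proj_castAdd i)).trans ?_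
      rw [← P.assoc, IsCopy.lift_fst _ (.id 1), P.id_comp, Subsingleton.elim i 0, proj_zero_one]
    · refine (congrArg (P.comp _) (proj_natAdd i)).trans ?_
      rw [← P.assoc, IsCopy.lift_snd (.id 1), P.id_comp, Subsingleton.elim i 0, proj_zero_one]
  rw [h, col_le_iff]
  simp

end GenAlg

/-! ### Relations that add or exchange wires. -/

/-- The relation that keeps all wires and adds a last one joined to a set of wires. -/
def dupRel {a : ℕ} (p : Fin a → Prop) (i : Fin a) (j : Fin (a + 1)) : Prop :=
  Fin.lastCases (motive := fun _ => Prop) (p i) (fun j => i = j) j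

theorem dupRel_last {a : ℕ} (p : Fin a → Prop) (i : Fin a) :
    dupRel p i (Fin.last a) ↔ p i := by
  simp [dupRel]

theorem dupRel_castSucc {a : ℕ} (p : Fin a → Prop) (i j : Fin a) :
    dupRel p i j.castSucc ↔ i = j := by
  simp [dupRel]

/-- A predicate on `Fin a`, extended to be false on the last element of `Fin (a + 1)`. -/
def extendFalse {a : ℕ} (p : Fin a → Prop) (j : Fin (a + 1)) : Prop :=
  Fin.lastCases (motive := fun _ => Prop) False p j

theorem extendFalse_last {a : ℕ} (p : Fin a → Prop) : ¬ extendFalse p (Fin.last a) := by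
  simp [extendFalse]

theorem extendFalse_castSucc {a : ℕ} (p : Fin a → Prop) (i : Fin a) :
    extendFalse p i.castSucc ↔ p i := by
  simp [extendFalse]

/-- The exchange of the last two wires. -/
def swapRel (a : ℕ) : Fin (a + 2) → Fin (a + 2) → Prop :=
  relSum (fun i j : Fin a => i = j) (fun (x : Fin (1 + 1)) y => finAddFlip x = y)

theorem relSum_castAdd_castAdd {a b c d : ℕ} (r : Fin a → Fin b → Prop) (s : Fin c → Fin d → Prop)
    (i : Fin a) (j : Fin b) : relSum r s (Fin.castAdd c i) (Fin.castAdd d j) ↔ r i j := by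
  simp [relSum]

theorem relSum_castAdd_natAdd {a b c d : ℕ} (r : Fin a → Fin b → Prop) (s : Fin c → Fin d → Prop)
    (i : Fin a) (j : Fin d) : ¬ relSum r s (Fin.castAdd c i) (Fin.natAdd b j) := by
  simp [relSum]

theorem relSum_natAdd_castAdd {a b c d : ℕ} (r : Fin a → Fin b → Prop) (s : Fin c → Fin d → Prop)
    (i : Fin c) (j : Fin b) : ¬ relSum r s (Fin.natAdd a i) (Fin.castAdd d j) := by
  simp [relSum]

theorem relSum_natAdd_natAdd {a b c d : ℕ} (r : Fin a → Fin b → Prop) (s : Fin c → Fin d → Prop)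
    (i : Fin c) (j : Fin d) : relSum r s (Fin.natAdd a i) (Fin.natAdd b j) ↔ s i j := by
  simp [relSum]

theorem relSum_id_castSucc_iff {a b : ℕ} (r : Fin a → Fin b → Prop) (i : Fin a) (j : Fin (b + 1)) :
    relSum r (fun x y : Fin 1 => x = y) i.castSucc j ↔ ∃ k, j = k.castSucc ∧ r i k := by
  refine Fin.lastCases ?_ (fun j => ?_) j
  · refine iff_of_false (relSum_castAdd_natAdd r _ i (0 : Fin 1)) ?_
    rintro ⟨k, h, _⟩
    exact (Fin.castSucc_lt_last k).ne h.symm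
  · exact (relSum_castAdd_castAdd r _ i j).trans (by simp)

theorem relSum_id_last_iff {a b : ℕ} (r : Fin a → Fin b → Prop) (j : Fin (b + 1)) :
    relSum r (fun x y : Fin 1 => x = y) (Fin.last a) j ↔ j = Fin.last b := by
  refine Fin.lastCases ?_ (fun j => ?_) j
  · exact iff_of_true ((relSum_natAdd_natAdd r _ (0 : Fin 1) 0).2 rfl) rfl
  · exact iff_of_false (relSum_natAdd_castAdd r _ (0 : Fin 1) j) (Fin.castSucc_lt_last j).ne

theorem swapRel_castSucc_castSucc (a : ℕ) (i : Fin a) (j : Fin (a + 2)) :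
    swapRel a i.castSucc.castSucc j ↔ j = i.castSucc.castSucc := by
  refine Fin.addCases (fun j => ?_) (fun j => ?_) j
  · refine (relSum_castAdd_castAdd _ _ i j).trans ?_
    simp [Fin.ext_iff, eq_comm]
  · refine iff_of_false (relSum_castAdd_natAdd _ _ i j) fun h => ?_
    have := congrArg Fin.val h
    simp at this
    omega

theorem swapRel_castSucc_last (a : ℕ) (j : Fin (a + 2)) :
    swapRel a (Fin.last a).castSucc j ↔ j = Fin.last (a + 1) := by
  refine Fin.addCases (fun j => ?_) (fun j => ?_) j
  · refine iff_of_false (relSum_natAdd_castAdd _ _ (0 : Fin 2) j) fun h => ?_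
    have := congrArg Fin.val h
    simp at this
    omega
  · refine (relSum_natAdd_natAdd _ _ (0 : Fin 2) j).trans ?_
    rw [show finAddFlip (0 : Fin (1 + 1)) = 1 from rfl, Fin.ext_iff, Fin.ext_iff, Fin.val_natAdd,
      Fin.val_last, Fin.val_one]
    omega

theorem swapRel_last (a : ℕ) (j : Fin (a + 2)) :
    swapRel a (Fin.last (a + 1)) j ↔ j = (Fin.last a).castSucc := by
  refine Fin.addCases (fun j => ?_) (fun j => ?_) j
  · refine iff_of_false (relSum_natAdd_castAdd _ _ (1 : Fin 2) j) fun h => ?_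
    have := congrArg Fin.val h
    simp at this
    omega
  · refine (relSum_natAdd_natAdd _ _ (1 : Fin 2) j).trans ?_
    rw [show finAddFlip (1 : Fin (1 + 1)) = 0 from rfl, Fin.ext_iff, Fin.ext_iff, Fin.val_natAdd,
      Fin.val_castSucc, Fin.val_last, Fin.val_zero]
    omega

/-- The new wire can be split off before `r` instead of after it, provided that it is joined to the
preimage of `p` under `r`. -/
theorem comp_dupRel {a b : ℕ} (r : Fin a → Fin b → Prop) (p : Fin b → Prop) :
    Relation.Comp r (dupRel p) = Relation.Comp (dupRel fun i => ∃ j, r i j ∧ p j)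
      (relSum r fun x y : Fin 1 => x = y) := by
  ext i j
  refine Fin.lastCases ?_ (fun j => ?_) j <;>
  simp [Relation.Comp, Fin.exists_fin_succ', dupRel_last, dupRel_castSucc,
      relSum_id_castSucc_iff, relSum_id_last_iff, (Fin.castSucc_ne_last _).symm]

/-- A new wire that ignores the present last wire can be inserted in front of it and then exchanged
with it. This is what makes independent nodes commute. -/
theorem dupRel_extendFalse {a : ℕ} (p : Fin a → Prop) :
    dupRel (extendFalse p) = Relation.Comp (relSum (dupRel p) fun x y : Fin 1 => x = y)
      (swapRel a) := by
  ext i j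
  have h (q : Fin (a + 2) → Prop) (s : Fin (a + 1) → Prop) :
      (∃ b, (∃ k : Fin (a + 1), b = k.castSucc ∧ s k) ∧ q b) ↔ ∃ k, s k ∧ q k.castSucc := by
    grind
  refine Fin.lastCases ?_ (fun i => ?_) i
  · simp only [Relation.Comp, relSum_id_last_iff, exists_eq_left, swapRel_last]
    refine Fin.lastCases ?_ (fun j => ?_) j
    · simp [dupRel_last, extendFalse_last, Fin.ext_iff]
    · simp [dupRel_castSucc, eq_comm]
  · simp only [Relation.Comp, relSum_id_castSucc_iff, h]
    simp only [Fin.exists_fin_succ', dupRel_last, dupRel_castSucc, swapRel_castSucc_last,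
      swapRel_castSucc_castSucc, exists_eq_left']
    refine Fin.lastCases ?_ (fun j => ?_) j
    · simp [dupRel_last, extendFalse_castSucc, Fin.ext_iff]
      grind
    · simp [dupRel_castSucc, eq_comm]

/-- A description in which the two new wires play symmetric roles. -/
theorem dupRel_comp_dupRel {a : ℕ} (p q : Fin a → Prop) (i : Fin a) (j : Fin (a + 2)) :
    Relation.Comp (dupRel p) (dupRel (extendFalse q)) i j ↔ j = i.castSucc.castSucc ∨
      (p i ∧ j = (Fin.last a).castSucc) ∨ (q i ∧ j = Fin.last (a + 1)) := by
  refine Fin.lastCases ?_ (fun j => Fin.lastCases ?_ (fun j => ?_) j) j <;>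
  simp [Relation.Comp, Fin.exists_fin_succ', dupRel_last, dupRel_castSucc, extendFalse_last,
      extendFalse_castSucc, eq_comm]

theorem dupRel_comp_dupRel_comp_swapRel {a : ℕ} (p q : Fin a → Prop) :
    Relation.Comp (Relation.Comp (dupRel p) (dupRel (extendFalse q))) (swapRel a) =
      Relation.Comp (dupRel q) (dupRel (extendFalse p)) := by
  ext i j
  rw [dupRel_comp_dupRel]
  change (∃ k, Relation.Comp (dupRel p) (dupRel (extendFalse q)) i k ∧ swapRel a k j) ↔ _
  simp only [dupRel_comp_dupRel, or_and_right, exists_or, and_assoc, exists_and_left,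
    exists_eq_left, swapRel_last, swapRel_castSucc_last, swapRel_castSucc_castSucc]
  grind

/-! ### Adding one node, and the commutation of two independent nodes. -/

namespace GenAlg

variable {P : PROP.{w}} {M : GenAlg dagTheory P}

variable (M) in
/-- The morphism that keeps all wires and adds a node joined to a set of wires. -/
noncomputable def step {a : ℕ} (p : Fin a → Prop) : P.Hom a (a + 1) :=
  P.comp (M.mat (dupRel p)) (P.tensor (P.id a) M.lam)

theorem tensor_comm {a b c d : ℕ} (f : P.Hom a b) (g : P.Hom c d) :
    P.comp (P.tensor f (P.id c)) (P.tensor (P.id b) g) =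
      P.comp (P.tensor (P.id a) g) (P.tensor f (P.id d)) := by
  simp only [← P.tensor_comp, P.id_comp, P.comp_id]

theorem mat_comp_step {a b : ℕ} (r : Fin a → Fin b → Prop) (p : Fin b → Prop) :
    P.comp (M.mat r) (M.step p) = P.comp (M.step fun i => ∃ j, r i j ∧ p j)
      (M.mat (relSum r fun x y : Fin 1 => x = y)) := by
  rw [step, step, ← P.assoc, ← mat_comp, comp_dupRel, mat_comp, P.assoc, P.assoc, mat_relSum,
    mat_id, tensor_comm]

theorem mat_swapRel (a : ℕ) : M.mat (swapRel a) = P.tensor (P.id a) (P.symm 1 1) := by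
  rw [← mat_id, ← mat_finAddFlip, ← mat_relSum]
  rfl

/-- The second wire does not depend on the output of the first node, so both nodes can wait until
both wires have been added: the first λ slides past the second insertion by interchange and through
the symmetry by naturality. -/
theorem step_comp_step {a : ℕ} (p q : Fin a → Prop) :
    P.comp (M.step p) (M.step (extendFalse q)) =
      P.comp (M.mat (Relation.Comp (dupRel p) (dupRel (extendFalse q))))
        (P.tensor (P.id a) (P.tensor M.lam M.lam) : P.Hom (a + (1 + 1)) (a + (1 + 1))) := by
  have h₁ := tensor_comm (M.mat (dupRel q)) M.lam
  have h₀ : P.tensor (P.id (a + 1)) M.lam =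
      (P.tensor (P.id a) (P.tensor (P.id 1) M.lam) : P.Hom (a + (1 + 1)) (a + (1 + 1))) := by
    rw [← P.tensor_id]
    exact P.tensor_assoc (P.id a) (P.id 1) M.lam
  have h₂ : P.comp (P.tensor (P.id a) (P.tensor (P.id 1) M.lam))
      (P.tensor (P.id a) (P.symm 1 1)) =
      P.comp (P.tensor (P.id a) (P.symm 1 1)) (P.tensor (P.id a) (P.tensor M.lam (P.id 1))) := by
    rw [← P.tensor_comp, ← P.tensor_comp, P.symm_naturality]
  have h₃ : P.comp (P.tensor (P.id a) (P.tensor M.lam (P.id 1)))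
      (P.tensor (P.id a) (P.tensor (P.id 1) M.lam)) =
      P.tensor (P.id a) (P.tensor M.lam M.lam) := by
    simp only [← P.tensor_comp, P.id_comp, P.comp_id]
  have h₄ : M.mat (dupRel (extendFalse q)) =
      P.comp (P.tensor (M.mat (dupRel q)) (P.id 1)) (M.mat (swapRel a)) := by
    rw [dupRel_extendFalse, mat_comp, mat_relSum, mat_id]
  rw [mat_comp, step, step, h₄, mat_swapRel, h₀]
  rw [h₀] at h₁
  -- The objects `a + (1 + 1)` and `a + 1 + 1` agree by definition but not in form. With names for
  -- the tensors, all hom-sets can be restated over the second one.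
  generalize (P.tensor (P.id a) (P.tensor (P.id 1) M.lam) :
    P.Hom (a + (1 + 1)) (a + (1 + 1))) = L at h₁ h₂ h₃ ⊢
  generalize (P.tensor (P.id a) (P.tensor M.lam (P.id 1)) :
    P.Hom (a + (1 + 1)) (a + (1 + 1))) = L' at h₂ h₃
  generalize (P.tensor (P.id a) (P.tensor M.lam M.lam) :
    P.Hom (a + (1 + 1)) (a + (1 + 1))) = LL at h₃ ⊢
  generalize (P.tensor (P.id a) (P.symm 1 1) :
    P.Hom (a + (1 + 1)) (a + (1 + 1))) = S at h₂ ⊢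
  subst h₃
  change P.Hom (a + 1 + 1) (a + 1 + 1) at L L' S
  change P.comp L S = P.comp S L' at h₂
  change P.comp _ L = _ at h₁
  change P.comp (P.comp _ _) (P.comp (P.comp _ S) L) = P.comp (P.comp _ (P.comp _ S)) (P.comp L' L)
  simp only [P.assoc]
  rw [← P.assoc S L' L, ← h₂, P.assoc, ← P.assoc _ L (P.comp S L), h₁, P.assoc]

/-- By naturality, `λ ⊗ λ` commutes with the symmetry; the relation in front of it is symmetric up
to the exchange of the new wires. -/
theorem step_comm {a : ℕ} (p q : Fin a → Prop) :
    P.comp (M.step p) (M.step (extendFalse q)) =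
      P.comp (P.comp (M.step q) (M.step (extendFalse p))) (M.mat (swapRel a)) := by
  rw [step_comp_step, step_comp_step, P.assoc]
  have h : P.comp (P.tensor (P.id a) (P.tensor M.lam M.lam)) (P.tensor (P.id a) (P.symm 1 1)) =
      P.comp (P.tensor (P.id a) (P.symm 1 1)) (P.tensor (P.id a) (P.tensor M.lam M.lam)) := by
    rw [← P.tensor_comp, ← P.tensor_comp, P.symm_naturality]
  rw [← dupRel_comp_dupRel_comp_swapRel q p, mat_comp, mat_swapRel]
  exact (P.assoc _ _ _).trans (congrArg _ h.symm)

end GenAlg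

namespace PROP

variable (P : PROP.{w})

/-- Reduces identities on the right to identities on the left, so that only the latter need an
induction over nodes. -/
theorem tensor_id_eq {a b : ℕ} (f : P.Hom a b) (n : ℕ) : P.tensor f (P.id n) =
    P.comp (P.symm a n) (P.comp (P.tensor (P.id n) f) (P.symm n b)) := by
  rw [P.symm_naturality, ← P.assoc, P.symm_symm, P.id_comp]

theorem tensor_eq_comp {a b c d : ℕ} (f : P.Hom a b) (g : P.Hom c d) : P.tensor f g =
    P.comp (P.tensor f (P.id c)) (P.tensor (P.id b) g) := by
  rw [← P.tensor_comp, P.id_comp, P.comp_id]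

end PROP

/-! ### Removal of nodes without internal predecessors. -/

namespace IDag

/-- The idag `E`, with internal nodes embedded into those of `D` by `e`, is obtained from `D` by
turning an internal node `x` without internal predecessors into a last input. -/
structure Peel {a b : ℕ} (D : IDag (Fin a) (Fin b)) (x : D.N) (E : IDag (Fin (a + 1)) (Fin b))
    (e : E.N → D.N) : Prop where
  injective : Function.Injective e
  ne : ∀ z, e z ≠ x
  exists_eq : ∀ y, y ≠ x → ∃ z, e z = y
  minimal : ∀ y, ¬ D.R (.inr y) (.inr x)
  input : ∀ i v, E.R (.inl (Fin.castSucc i)) v ↔ D.R (.inl i) (Sum.map id e v)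
  last : ∀ v, E.R (.inl (Fin.last a)) v ↔ D.R (.inr x) (Sum.map id e v)
  inner : ∀ z v, E.R (.inr z) v ↔ D.R (.inr (e z)) (Sum.map id e v)

theorem Peel.card_lt {a b : ℕ} {D : IDag (Fin a) (Fin b)} {x : D.N}
    {E : IDag (Fin (a + 1)) (Fin b)} {e : E.N → D.N} (h : Peel D x E e) :
    Nat.card E.N < Nat.card D.N := by
  have := D.finite
  have := E.finite
  have := Fintype.ofFinite D.N
  have := Fintype.ofFinite E.N
  rw [Nat.card_eq_fintype_card, Nat.card_eq_fintype_card]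
  exact Fintype.card_lt_of_injective_of_notMem e h.injective (b := x) fun ⟨z, hz⟩ => h.ne z hz

theorem exists_peel {a b : ℕ} (D : IDag (Fin a) (Fin b)) (x : D.N)
    (hx : ∀ y, ¬ D.R (.inr y) (.inr x)) :
    ∃ (E : IDag (Fin (a + 1)) (Fin b)) (e : E.N → D.N), Peel D x E e := by
  have := D.finite
  -- The last input takes over the outgoing edges of `x`. The edges into `x`, which come from inputs
  -- only, are forgotten and are recorded by `step`.
  let src : Fin (a + 1) ⊕ {y // y ≠ x} → Fin a ⊕ D.N :=
    Sum.elim (Fin.snoc (α := fun _ => Fin a ⊕ D.N) Sum.inl (.inr x)) fun z => .inr z.1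
  refine ⟨⟨{y // y ≠ x}, inferInstance, fun u v => D.R (src u) (Sum.map id Subtype.val v),
    fun n hn => D.acyclic n.1 (hn.lift Subtype.val fun _ _ h => h)⟩, Subtype.val,
    Subtype.val_injective, fun z => z.2, fun y hy => ⟨⟨y, hy⟩, rfl⟩, hx, ?_, ?_, ?_⟩
  all_goals simp [src]

/-- The transitive closure of the internal edges is a strict order on a finite set, hence
well-founded. -/
theorem exists_minimal {a b : ℕ} (D : IDag (Fin a) (Fin b)) [Nonempty D.N] :
    ∃ x : D.N, ∀ y, ¬ D.R (.inr y) (.inr x) := by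
  have := D.finite
  let r := Relation.TransGen fun x y : D.N => D.R (.inr x) (.inr y)
  have : IsTrans D.N r := ⟨fun _ _ _ => Relation.TransGen.trans⟩
  have : Std.Irrefl r := ⟨D.acyclic⟩
  obtain ⟨x, -, hx⟩ := (Finite.wellFounded_of_trans_of_irrefl r).has_min Set.univ
    Set.univ_nonempty
  exact ⟨x, fun y hy => hx y trivial (.single hy)⟩

/-- Induction on idags by removal of minimal nodes. -/
theorem peel_induction {b : ℕ} {motive : ∀ {a : ℕ}, IDag (Fin a) (Fin b) → Prop}
    (base : ∀ {a : ℕ} (D : IDag (Fin a) (Fin b)), IsEmpty D.N → motive D)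
    (peel : ∀ {a : ℕ} {D : IDag (Fin a) (Fin b)} {x : D.N} {E : IDag (Fin (a + 1)) (Fin b)}
      {e : E.N → D.N}, Peel D x E e → motive E → motive D)
    {a : ℕ} (D : IDag (Fin a) (Fin b)) : motive D := by
  induction hn : Nat.card D.N using Nat.strong_induction_on generalizing a with
  | _ n ih =>
    subst hn
    rcases isEmpty_or_nonempty D.N with h | h
    · exact base D h
    · obtain ⟨x, hx⟩ := D.exists_minimal
      obtain ⟨E, e, h⟩ := D.exists_peel x hx
      exact peel h (ih _ h.card_lt E rfl)

/-- The edges of the composite of a relation and an idag. -/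
def preRel {I J O N : Type} (r : I → J → Prop) (R : J ⊕ N → O ⊕ N → Prop) : I ⊕ N → O ⊕ N → Prop
  | .inl i, v => ∃ j, r i j ∧ R (.inl j) v
  | .inr z, v => R (.inr z) v

/-- The composite of a relation and an idag. -/
def pre {I J O : Type} (r : I → J → Prop) (D : IDag J O) : IDag I O where
  N := D.N
  finite := D.finite
  R := preRel r D.R
  acyclic := D.acyclic

theorem Peel.pre {a a' b : ℕ} {D : IDag (Fin a) (Fin b)} {x : D.N}
    {E : IDag (Fin (a + 1)) (Fin b)} {e : E.N → D.N} (h : Peel D x E e)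
    (r : Fin a' → Fin a → Prop) :
    Peel (D.pre r) x (E.pre (relSum r fun x y : Fin 1 => x = y)) e where
  injective := h.injective
  ne := h.ne
  exists_eq := h.exists_eq
  minimal := h.minimal
  input i v := by
    simp only [IDag.pre, preRel, relSum_id_castSucc_iff]
    constructor
    · rintro ⟨_, ⟨k, rfl, hk⟩, H⟩
      exact ⟨k, hk, (h.input k v).1 H⟩
    · rintro ⟨k, hk, H⟩
      exact ⟨_, ⟨k, rfl, hk⟩, (h.input k v).2 H⟩
  last v := by
    simp only [IDag.pre, preRel, relSum_id_last_iff, exists_eq_left]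
    exact h.last v
  inner := h.inner

theorem Peel.iso {a b : ℕ} {D D' : IDag (Fin a) (Fin b)} {x : D.N}
    {E : IDag (Fin (a + 1)) (Fin b)} {e : E.N → D.N} (h : Peel D x E e) {σ : D.N ≃ D'.N}
    (hσ : ∀ x y, D.R x y ↔ D'.R (Sum.map id σ x) (Sum.map id σ y)) :
    Peel D' (σ x) E (σ ∘ e) where
  injective := σ.injective.comp h.injective
  ne z hz := h.ne z (σ.injective hz)
  exists_eq y hy := by
    obtain ⟨z, hz⟩ := h.exists_eq (σ.symm y) (fun H => hy (by simp [← H]))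
    exact ⟨z, by simp [hz]⟩
  minimal y hy := h.minimal (σ.symm y) ((hσ _ _).2 (by simpa using hy))
  input i v := by
    rw [h.input, hσ, Sum.map_map]
    rfl
  last v := by
    rw [h.last, hσ, Sum.map_map]
    rfl
  inner z v := by
    rw [h.inner, hσ, Sum.map_map]
    rfl

/-- Concatenation creates no edge from the second idag to the internal nodes of the first, so a
minimal node of the first stays minimal. -/
theorem Peel.concat {a b c : ℕ} {D : IDag (Fin a) (Fin b)} {x : D.N}
    {E : IDag (Fin (a + 1)) (Fin b)} {e : E.N → D.N} (h : Peel D x E e)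
    (D' : IDag (Fin b) (Fin c)) :
    Peel (D.concat D') (.inl x) (E.concat D') (Sum.map e id) where
  injective := h.injective.sumMap Function.injective_id
  ne := by
    rintro (z | z) hz
    · exact h.ne z (Sum.inl_injective hz)
    · cases hz
  exists_eq := by
    rintro (y | y) hy
    · obtain ⟨z, hz⟩ := h.exists_eq y (fun H => hy (by rw [H]))
      exact ⟨.inl z, congrArg Sum.inl hz⟩
    · exact ⟨.inr y, rfl⟩
  minimal := by
    rintro (y | y)
    · exact h.minimal y
    · exact id
  input i v := by
    rcases v with v | v | v <;> simp [IDag.concat, concatRel, h.input]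
  last v := by
    rcases v with v | v | v <;> simp [IDag.concat, concatRel, h.last]
  inner z v := by
    rcases z with z | z <;> rcases v with v | v | v <;> simp [IDag.concat, concatRel, h.inner]

theorem Peel.juxtFin {a b : ℕ} {D : IDag (Fin a) (Fin b)} {x : D.N}
    {E : IDag (Fin (a + 1)) (Fin b)} {e : E.N → D.N} (h : Peel D x E e) (n : ℕ) :
    Peel (IDag.juxtFin (a := n) (b := n) (ofRel Eq) D) (.inr x)
      (IDag.juxtFin (a := n) (c := a + 1) (ofRel Eq) E) (Sum.map id e) where
  injective := Function.injective_id.sumMap h.injective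
  ne := by
    rintro (⟨⟨⟩⟩ | z) hz
    exact h.ne z (Sum.inr_injective hz)
  exists_eq := by
    rintro (⟨⟨⟩⟩ | y) hy
    obtain ⟨z, hz⟩ := h.exists_eq y (fun H => hy (by rw [H]))
    exact ⟨.inr z, congrArg Sum.inr hz⟩
  minimal := by
    rintro (⟨⟨⟩⟩ | y)
    exact h.minimal y
  input i v := by
    refine Fin.addCases (fun i => ?_) (fun i => ?_) i
    · rw [show (Fin.castAdd a i).castSucc = Fin.castAdd (a + 1) i from rfl]
      rcases v with v | ⟨⟨⟩⟩ | v
      · refine Fin.addCases (fun v => ?_) (fun v => ?_) v <;>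
        simp [IDag.juxtFin, juxt, reindex, reindexRel, juxtRel, ofRel]
      · simp [IDag.juxtFin, juxt, reindex, reindexRel, juxtRel, ofRel]
    · rw [show (Fin.natAdd n i).castSucc = Fin.natAdd n i.castSucc from rfl]
      rcases v with v | ⟨⟨⟩⟩ | v
      · refine Fin.addCases (fun v => ?_) (fun v => ?_) v <;>
        simp [IDag.juxtFin, juxt, reindex, reindexRel, juxtRel, ofRel, h.input]
      · simp [IDag.juxtFin, juxt, reindex, reindexRel, juxtRel, ofRel, h.input]
  last v := by
    rw [show Fin.last (n + a) = Fin.natAdd n (Fin.last a) from rfl]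
    rcases v with v | ⟨⟨⟩⟩ | v
    · refine Fin.addCases (fun v => ?_) (fun v => ?_) v <;>
      simp [IDag.juxtFin, juxt, reindex, reindexRel, juxtRel, ofRel, h.last, -Fin.natAdd_last]
    · simp [IDag.juxtFin, juxt, reindex, reindexRel, juxtRel, ofRel, h.last, -Fin.natAdd_last]
  inner z v := by
    rcases z with ⟨⟨⟩⟩ | z
    rcases v with v | ⟨⟨⟩⟩ | v
    · refine Fin.addCases (fun v => ?_) (fun v => ?_) v <;>
      simp [IDag.juxtFin, juxt, reindex, reindexRel, juxtRel, ofRel, h.inner]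
    · simp [IDag.juxtFin, juxt, reindex, reindexRel, juxtRel, ofRel, h.inner]

/-- The nodes of both idags are the nodes of `D` other than `x`, and their edges are read off from
`D`. -/
theorem Peel.iso_of_peel {a b : ℕ} {D : IDag (Fin a) (Fin b)} {x : D.N}
    {E E' : IDag (Fin (a + 1)) (Fin b)} {e : E.N → D.N} {e' : E'.N → D.N}
    (h : Peel D x E e) (h' : Peel D x E' e') : E.Iso E' := by
  choose f hf using fun z => h'.exists_eq (e z) (h.ne z)
  have hb : Function.Bijective f := by
    refine ⟨fun s t hst => h.injective (by rw [← hf, ← hf, hst]), fun t => ?_⟩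
    obtain ⟨z, hz⟩ := h.exists_eq (e' t) (h'.ne t)
    exact ⟨z, h'.injective ((hf z).trans hz)⟩
  have hm (v : Fin b ⊕ E.N) : Sum.map id e v = Sum.map id e' (Sum.map id f v) := by
    rcases v with v | v <;> simp [hf]
  refine ⟨Equiv.ofBijective f hb, fun u v => ?_⟩
  change _ ↔ E'.R (Sum.map id f u) (Sum.map id f v)
  rcases u with u | u
  · refine Fin.lastCases ?_ (fun u => ?_) u
    · rw [h.last, hm, ← h'.last]
      rfl
    · rw [h.input, hm, ← h'.input]
      rfl
  · rw [h.inner, hm, ← hf, ← h'.inner]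
    rfl

/-- Two different minimal nodes can be removed in either order. -/
theorem Peel.exchange {a b : ℕ} {D : IDag (Fin a) (Fin b)} {x y : D.N}
    {E E' : IDag (Fin (a + 1)) (Fin b)} {e : E.N → D.N} {e' : E'.N → D.N}
    (h : Peel D x E e) (h' : Peel D y E' e') {y' : E.N} (hy : e y' = y) {x' : E'.N}
    (hx : e' x' = x) {F : IDag (Fin (a + 2)) (Fin b)} {f : F.N → E.N} (hF : Peel E y' F f) :
    ∃ f', Peel E' x' (F.pre (swapRel a)) f' := by
  -- The nodes of `F` are those of `D` other than `x` and `y`, so they embed into `E'`.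
  have hf (z : F.N) : ∃ t, e' t = e (f z) :=
    h'.exists_eq _ fun H => hF.ne z (h.injective (H.trans hy.symm))
  choose f' hf' using hf
  have hm (v : Fin b ⊕ F.N) : Sum.map id e (Sum.map id f v) = Sum.map id e' (Sum.map id f' v) := by
    rcases v with v | v <;> simp [hf']
  refine ⟨f', ?_, ?_, ?_, ?_, ?_, ?_, ?_⟩
  · intro (s : F.N) (t : F.N) hst
    refine hF.injective (h.injective ?_)
    rw [← hf', ← hf', hst]
  · intro (z : F.N) hz
    exact h.ne (f z) (by rw [← hf', hz, hx])
  · intro t ht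
    obtain ⟨s, hs⟩ := h.exists_eq (e' t) fun H => ht (h'.injective (H.trans hx.symm))
    obtain ⟨z, rfl⟩ := hF.exists_eq s fun H => h'.ne t (by rw [← hs, H, hy])
    exact ⟨z, h'.injective ((hf' z).trans hs)⟩
  · intro t ht
    have := (h'.inner t (.inr x')).1 ht
    rw [Sum.map_inr, hx] at this
    exact h.minimal _ this
  -- In `F` the last two inputs stand for `x` and `y`, in this order. Removing `y` first produces
  -- them in the opposite order, whence the exchange.
  · intro i (v : Fin b ⊕ F.N)
    refine Fin.lastCases ?_ (fun i => ?_) i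
    · simp only [IDag.pre, preRel, swapRel_castSucc_last, exists_eq_left]
      rw [hF.last, h.inner, hm, hy, h'.last]
    · simp only [IDag.pre, preRel, swapRel_castSucc_castSucc, exists_eq_left]
      rw [hF.input, h.input, hm, h'.input]
  · intro (v : Fin b ⊕ F.N)
    simp only [IDag.pre, preRel, swapRel_last, exists_eq_left]
    rw [hF.input, h.last, hm, h'.inner, hx]
  · intro (z : F.N) (v : Fin b ⊕ F.N)
    simp only [IDag.pre, preRel]
    rw [hF.inner, h.inner, hm, h'.inner, hf']

end IDag

/-! ### Normal forms: existence, uniqueness, and stability under the operations. -/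

namespace GenAlg

open IDag

variable {P : PROP.{w}}

/-- The morphisms obtained from an idag by adding its internal nodes one by one, in some order. -/
inductive Nf (M : GenAlg dagTheory P) {b : ℕ} :
    ∀ {a : ℕ}, IDag (Fin a) (Fin b) → P.Hom a b → Prop
  | rel {a : ℕ} {D : IDag (Fin a) (Fin b)} : IsEmpty D.N →
      Nf M D (M.mat fun i j => D.R (.inl i) (.inl j))
  | step {a : ℕ} {D : IDag (Fin a) (Fin b)} {x : D.N} {E : IDag (Fin (a + 1)) (Fin b)}
      {e : E.N → D.N} {f : P.Hom (a + 1) b} : Peel D x E e → Nf M E f →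
      Nf M D (P.comp (M.step fun i => D.R (.inl i) (.inr x)) f)

variable {M : GenAlg dagTheory P}

/-- Idle wires on the left do not interfere with adding a last wire, as `n + (a + 1)` is `n + a + 1`
by definition. -/
theorem id_tensor_step {n a : ℕ} {p : Fin a → Prop} {p' : Fin (n + a) → Prop}
    (h₁ : ∀ i, ¬ p' (Fin.castAdd a i)) (h₂ : ∀ i, p' (Fin.natAdd n i) ↔ p i) :
    P.tensor (P.id n) (M.step p) = M.step p' := by
  have hr : relSum (fun i j : Fin n => i = j) (dupRel p) = dupRel p' := by
    ext i j
    refine Fin.addCases (fun i => ?_) (fun i => ?_) i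
    · refine Fin.addCases (fun j => ?_) (fun j => Fin.lastCases ?_ (fun j => ?_) j) j
      · rw [relSum_castAdd_castAdd]
        refine Iff.trans ?_ (dupRel_castSucc p' (Fin.castAdd a i) (Fin.castAdd a j)).symm
        simp
      · exact iff_of_false (relSum_castAdd_natAdd _ _ _ _)
          ((dupRel_last p' (Fin.castAdd a i)).not.2 (h₁ i))
      · refine iff_of_false (relSum_castAdd_natAdd _ _ _ _)
          ((dupRel_castSucc p' (Fin.castAdd a i) (Fin.natAdd n j)).not.2 fun h => ?_)
        have := congrArg Fin.val h
        simp at this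
        omega
    · refine Fin.addCases (fun j => ?_) (fun j => Fin.lastCases ?_ (fun j => ?_) j) j
      · refine iff_of_false (relSum_natAdd_castAdd _ _ _ _)
          ((dupRel_castSucc p' (Fin.natAdd n i) (Fin.castAdd a j)).not.2 fun h => ?_)
        have := congrArg Fin.val h
        simp at this
        omega
      · rw [relSum_natAdd_natAdd, dupRel_last, ← h₂]
        exact (dupRel_last p' (Fin.natAdd n i)).symm
      · rw [relSum_natAdd_natAdd, dupRel_castSucc]
        refine Iff.trans ?_ (dupRel_castSucc p' (Fin.natAdd n i) (Fin.natAdd n j)).symm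
        simp
  have ht : P.tensor (P.id n) (P.tensor (P.id a) M.lam) = P.tensor (P.id (n + a)) M.lam := by
    rw [← P.tensor_id]
    exact (P.tensor_assoc (P.id n) (P.id a) M.lam).symm
  have hc := P.tensor_comp (P.id n) (P.id n) (M.mat (dupRel p)) (P.tensor (P.id a) M.lam)
  rw [P.id_comp, ht] at hc
  refine hc.trans ?_
  rw [← mat_id, ← mat_relSum, hr]
  rfl

theorem exists_nf {a b : ℕ} (D : IDag (Fin a) (Fin b)) : ∃ f, M.Nf D f := by
  induction D using peel_induction with
  | base D h => exact ⟨_, .rel h⟩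
  | peel h ih =>
    obtain ⟨f, hf⟩ := ih
    exact ⟨_, .step h hf⟩

namespace Nf

theorem iso {a b : ℕ} {D D' : IDag (Fin a) (Fin b)} {f : P.Hom a b} (h : M.Nf D f)
    (hD : D.Iso D') : M.Nf D' f := by
  obtain ⟨σ, hσ⟩ := hD
  cases h with
  | rel h =>
    simp only [hσ]
    exact .rel (σ.symm.isEmpty)
  | step h hf =>
    simp only [hσ]
    exact .step (h.iso hσ) hf

theorem pre {a a' b : ℕ} {D : IDag (Fin a) (Fin b)} {f : P.Hom a b} (h : M.Nf D f)
    (r : Fin a' → Fin a → Prop) : M.Nf (D.pre r) (P.comp (M.mat r) f) := by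
  induction h generalizing a' with
  | rel h =>
    rw [← mat_comp]
    exact .rel (D := IDag.pre r _) h
  | step h hf ih =>
    rw [← P.assoc, mat_comp_step, P.assoc]
    exact .step (h.pre r) (ih _)

/-- Strong induction on the number of nodes. If the two forms start with the same node, the rests
belong to isomorphic idags. Otherwise each first node can be followed by the other one; both rests
then continue with the same idag `F`, up to an exchange of inputs, and `step_comm` closes the
diamond. -/
theorem unique {a b : ℕ} {D : IDag (Fin a) (Fin b)} {f g : P.Hom a b} (hf : M.Nf D f)
    (hg : M.Nf D g) : f = g := by
  induction hn : Nat.card D.N using Nat.strong_induction_on generalizing a with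
  | _ n ih =>
    subst hn
    cases hf with
    | rel h =>
      cases hg with
      | rel => rfl
      | @step _ _ x => exact h.elim x
    | @step _ _ x E e f h hf =>
      cases hg with
      | rel h => exact h.elim x
      | @step _ _ y E' e' g h' hg =>
        by_cases hxy : x = y
        · subst hxy
          rw [ih _ h'.card_lt (hf.iso (h.iso_of_peel h')) hg rfl]
        · obtain ⟨y', hy⟩ := h.exists_eq y (Ne.symm hxy)
          obtain ⟨x', hx⟩ := h'.exists_eq x hxy
          obtain ⟨F, f₁, hF⟩ := E.exists_peel y' fun z hz => h'.minimal (e z) <| by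
            have := (h.inner z (.inr y')).1 hz
            rwa [Sum.map_inr, hy] at this
          obtain ⟨k, hk⟩ := exists_nf (M := M) F
          obtain ⟨f₂, hF'⟩ := h.exchange h' hy hx hF
          have h₁ := ih _ h.card_lt hf (.step hF hk) rfl
          have h₂ := ih _ h'.card_lt hg (.step hF' (hk.pre _)) rfl
          -- The last input of `E` stands for `x`, and no edge leads from `x` to `y` because `y` is
          -- minimal in `D`.
          have e₁ : (fun i => E.R (.inl i) (.inr y')) =
              extendFalse fun i => D.R (.inl i) (.inr y) := by
            ext i
            refine Fin.lastCases ?_ (fun i => ?_) i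
            · rw [h.last, Sum.map_inr, hy]
              exact iff_of_false (h'.minimal x) (extendFalse_last _)
            · rw [h.input, Sum.map_inr, hy, extendFalse_castSucc]
          have e₂ : (fun i => E'.R (.inl i) (.inr x')) =
              extendFalse fun i => D.R (.inl i) (.inr x) := by
            ext i
            refine Fin.lastCases ?_ (fun i => ?_) i
            · rw [h'.last, Sum.map_inr, hx]
              exact iff_of_false (h.minimal y) (extendFalse_last _)
            · rw [h'.input, Sum.map_inr, hx, extendFalse_castSucc]
          rw [h₁, h₂, e₁, e₂, ← P.assoc, step_comm, P.assoc, P.assoc]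

/-- The nodes of the first idag are added first. Once none is left, that idag is a relation, and
`Nf.pre` applies. -/
theorem concat {a b c : ℕ} {D : IDag (Fin a) (Fin b)} {D' : IDag (Fin b) (Fin c)}
    {f : P.Hom a b} {g : P.Hom b c} (hf : M.Nf D f) (hg : M.Nf D' g) :
    M.Nf (D.concat D') (P.comp f g) := by
  induction hf with
  | @rel a D h =>
    refine (hg.pre _).iso ⟨(Equiv.emptySum D.N D'.N).symm, fun x y => ?_⟩
    rcases x with x | x <;> rcases y with y | y <;> exact Iff.rfl
  | step h hf ih =>
    rw [P.assoc]
    exact .step (h.concat D') ih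

theorem id_tensor {a b : ℕ} {D : IDag (Fin a) (Fin b)} {f : P.Hom a b} (hf : M.Nf D f) (n : ℕ) :
    M.Nf (IDag.juxtFin (a := n) (b := n) (ofRel Eq) D) (P.tensor (P.id n) f) := by
  induction hf with
  | @rel a D h =>
    rw [← mat_id, ← mat_relSum]
    have : IsEmpty (Empty ⊕ D.N) := isEmpty_sum.2 ⟨inferInstance, h⟩
    convert Nf.rel (M := M) (D := IDag.juxtFin (a := n) (b := n) (ofRel Eq) D) this with i j
    refine Fin.addCases (fun i => ?_) (fun i => ?_) i <;>
    refine Fin.addCases (fun j => ?_) (fun j => ?_) j <;>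
    simp [relSum, IDag.juxtFin, juxt, reindex, reindexRel, juxtRel, ofRel, ofRelRel]
  | @step a D x E e f h hf ih =>
    have hp := id_tensor_step (M := M) (n := n) (p := fun i => D.R (.inl i) (.inr x))
      (p' := fun i => (IDag.juxtFin (a := n) (b := n) (ofRel Eq) D).R (.inl i) (.inr (.inr x)))
      (fun i => by simp [IDag.juxtFin, juxt, reindex, reindexRel, juxtRel])
      (fun i => by simp [IDag.juxtFin, juxt, reindex, reindexRel, juxtRel])
    have hc := P.tensor_comp (P.id n) (P.id n) (M.step fun i => D.R (.inl i) (.inr x)) f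
    rw [P.id_comp, hp] at hc
    rw [hc]
    exact .step (h.juxtFin n) ih

theorem of_mk_eq {a b : ℕ} {D D' : IDag (Fin a) (Fin b)} {f : P.Hom a b} (hf : M.Nf D f)
    (h : AbsIDag.mk D = AbsIDag.mk D') : M.Nf D' f :=
  hf.iso (Quotient.exact h)

theorem ofRel {a b : ℕ} (r : Fin a → Fin b → Prop) : M.Nf (IDag.ofRel r) (M.mat r) :=
  .rel (D := IDag.ofRel r) (inferInstanceAs (IsEmpty Empty))

theorem ofRel_of_eq {a b : ℕ} {r : Fin a → Fin b → Prop} {f : P.Hom a b} (h : M.mat r = f) :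
    M.Nf (IDag.ofRel r) f :=
  h ▸ ofRel r

theorem symm (a b : ℕ) :
    M.Nf (IDag.ofRel fun (x : Fin (a + b)) y => finAddFlip x = y) (P.symm a b) :=
  ofRel_of_eq (mat_finAddFlip a b)

/-- The law that moves an identity from right to left holds in `dagProp` as well as in `P`, so the
required isomorphism of idags comes for free. -/
theorem tensor_id {a b : ℕ} {D : IDag (Fin a) (Fin b)} {f : P.Hom a b} (hf : M.Nf D f) (n : ℕ) :
    M.Nf (IDag.juxtFin (c := n) (d := n) D (IDag.ofRel Eq)) (P.tensor f (P.id n)) := by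
  rw [P.tensor_id_eq]
  exact ((symm a n).concat ((hf.id_tensor n).concat (symm n b))).of_mk_eq
    (dagProp.tensor_id_eq (AbsIDag.mk D) n).symm

theorem tensor {a b c d : ℕ} {D : IDag (Fin a) (Fin b)} {D' : IDag (Fin c) (Fin d)}
    {f : P.Hom a b} {g : P.Hom c d} (hf : M.Nf D f) (hg : M.Nf D' g) :
    M.Nf (D.juxtFin D') (P.tensor f g) := by
  rw [P.tensor_eq_comp]
  exact ((hf.tensor_id c).concat (hg.id_tensor b)).of_mk_eq
    (dagProp.tensor_eq_comp (AbsIDag.mk D) (AbsIDag.mk D')).symm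

/-- The normal form of the node copies the wire, applies λ to the copy and discards the original,
which is λ again by interchange and the counit law. -/
theorem node : M.Nf IDag.node M.lam := by
  -- Discards the original wire and keeps the output of the node.
  let r : Fin (1 + 1) → Fin 1 → Prop :=
    relSum (b := 0) (fun (_ : Fin 1) (_ : Fin 0) => True) fun x y : Fin 1 => x = y
  have hr : M.mat r = P.tensor M.eps (P.id 1) := by
    rw [← mat_eps, ← mat_id, ← mat_relSum]
  have hl : P.tensor (P.id 0) M.lam = M.lam := P.unit_tensor M.lam
  have hs : Relation.Comp (dupRel fun _ => True) r = fun x y : Fin 1 => x = y := by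
    ext i j
    refine iff_of_true ⟨Fin.last 1, (dupRel_last _ i).2 trivial, ?_⟩ (Subsingleton.elim i j)
    rw [Subsingleton.elim j 0]
    exact (relSum_natAdd_natAdd (b := 0) _ _ (0 : Fin 1) 0).2 rfl
  have hc : P.comp (M.step fun i : Fin 1 => IDag.node.R (.inl i) (.inr ())) (M.mat r) = M.lam := by
    change P.comp (M.step fun i : Fin 1 => True) (M.mat r) = M.lam
    have h := (tensor_comm M.eps M.lam).symm.trans (congrArg₂ P.comp hr.symm hl)
    rw [GenAlg.step, P.assoc, hr]
    refine (congrArg (P.comp _) h).trans ((P.assoc _ _ _).symm.trans ?_)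
    rw [← mat_comp, hs, mat_id]
    exact P.id_comp _
  rw [← hc]
  refine .step (D := IDag.node) (x := ()) (E := IDag.ofRel r) (e := fun _ => ())
    ⟨?_, ?_, ?_, ?_, ?_, ?_, ?_⟩ (ofRel r)
  · exact fun z => Empty.elim z
  · exact fun z => Empty.elim z
  · exact fun y hy => (hy rfl).elim
  · exact fun _ => id
  · rintro i (v | ⟨⟨⟩⟩)
    refine iff_of_false ?_ id
    rw [Subsingleton.elim v 0]
    exact relSum_castAdd_natAdd (b := 0) _ _ i 0
  · rintro (v | ⟨⟨⟩⟩)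
    refine iff_of_true ?_ trivial
    rw [Subsingleton.elim v 0]
    exact (relSum_natAdd_natAdd (b := 0) _ _ (0 : Fin 1) 0).2 rfl
  · exact fun z => Empty.elim z

theorem op (o : dagTheory.Op) : ∃ D, AbsIDag.mk D = dagOp o ∧ M.Nf D (M.op o) := by
  rcases o with (_ | _ | _ | _) | ⟨⟩
  · exact ⟨_, rfl, ofRel_of_eq mat_eta⟩
  · exact ⟨_, rfl, ofRel_of_eq mat_nabla⟩
  · exact ⟨_, rfl, ofRel_of_eq mat_eps⟩
  · exact ⟨_, rfl, ofRel_of_eq mat_delta⟩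
  · exact ⟨_, rfl, node⟩

/-- The link between the two interpretations: the value in `P` is a normal form of the idag denoted.
With uniqueness, that idag determines the value. -/
theorem evalProp {a b : ℕ} (t : Expr dagTheory.toSignature a b) :
    ∃ D, AbsIDag.mk D = t.evalProp dagProp dagOp ∧ M.Nf D (t.evalProp P M.op) := by
  induction t with
  | op o => exact op o
  | id a => exact ⟨_, rfl, ofRel_of_eq (mat_id a)⟩
  | comp f g hf hg =>
    obtain ⟨D, hD, hf⟩ := hf
    obtain ⟨D', hD', hg⟩ := hg
    exact ⟨_, congrArg₂ dagProp.comp hD hD', hf.concat hg⟩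
  | tensor f g hf hg =>
    obtain ⟨D, hD, hf⟩ := hf
    obtain ⟨D', hD', hg⟩ := hg
    exact ⟨_, congrArg₂ dagProp.tensor hD hD', hf.tensor hg⟩
  | symm a b => exact ⟨_, rfl, symm a b⟩

end Nf

theorem evalProp_eq_of_evalProp_eq {a b : ℕ} {s t : Expr dagTheory.toSignature a b}
    (h : s.evalProp dagProp dagOp = t.evalProp dagProp dagOp) :
    s.evalProp P M.op = t.evalProp P M.op := by
  obtain ⟨D, hD, hs⟩ := Nf.evalProp (M := M) s
  obtain ⟨D', hD', ht⟩ := Nf.evalProp (M := M) t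
  exact (hs.of_mk_eq (hD.trans (h.trans hD'.symm))).unique ht

end GenAlg

/-! ### The equations of the theory hold for idags. -/

namespace AbsIDag

theorem comp_ofRel {a b c : ℕ} (r : Fin a → Fin b → Prop) (s : Fin b → Fin c → Prop) :
    dagProp.comp (mk (.ofRel r)) (mk (.ofRel s)) = mk (.ofRel (Relation.Comp r s)) := by
  refine Quotient.sound ⟨Equiv.sumEmpty Empty Empty, ?_⟩
  rintro (x | ⟨⟨⟩⟩ | ⟨⟨⟩⟩) (y | ⟨⟨⟩⟩ | ⟨⟨⟩⟩)
  exact Iff.rfl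

theorem tensor_ofRel {a b c d : ℕ} (r : Fin a → Fin b → Prop) (s : Fin c → Fin d → Prop) :
    dagProp.tensor (mk (.ofRel r)) (mk (.ofRel s)) = mk (.ofRel (relSum r s)) := by
  refine Quotient.sound ⟨Equiv.sumEmpty Empty Empty, ?_⟩
  rintro (x | ⟨⟨⟩⟩ | ⟨⟨⟩⟩) (y | ⟨⟨⟩⟩ | ⟨⟨⟩⟩)
  change IDag.juxtRel (IDag.ofRelRel r) (IDag.ofRelRel s) (.inl (finSumFinEquiv.symm x))
    (.inl (finSumFinEquiv.symm y)) ↔ Sum.LiftRel r s (finSumFinEquiv.symm x)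
      (finSumFinEquiv.symm y)
  rcases finSumFinEquiv.symm x with x | x <;> rcases finSumFinEquiv.symm y with y | y <;>
    simp [IDag.juxtRel, IDag.ofRelRel]

end AbsIDag

/-- The interpretation of the expressions of bialgebras as relations. -/
def Expr.evalRel : ∀ {a b : ℕ}, Expr bialgSig a b → Fin a → Fin b → Prop
  | _, _, .op _ => fun _ _ => True
  | _, _, .id _ => fun i j => i = j
  | _, _, .comp f g => Relation.Comp f.evalRel g.evalRel
  | _, _, .tensor f g => relSum f.evalRel g.evalRel
  | _, _, .symm _ _ => fun x y => finAddFlip x = y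

theorem Expr.evalProp_inl {a b : ℕ} (f : Expr bialgSig a b) :
    (f.inl (S' := (nodes Unit).toSignature)).evalProp dagProp dagOp =
      AbsIDag.mk (.ofRel f.evalRel) := by
  induction f with
  | op o => cases o <;> rfl
  | id a => rfl
  | comp f g hf hg => exact (congrArg₂ dagProp.comp hf hg).trans (AbsIDag.comp_ofRel _ _)
  | tensor f g hf hg => exact (congrArg₂ dagProp.tensor hf hg).trans (AbsIDag.tensor_ofRel _ _)
  | symm a b => rfl

instance Relation.decidableRelComp {a b c : ℕ} (r : Fin a → Fin b → Prop) (s : Fin b → Fin c → Prop)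
    [DecidableRel r] [DecidableRel s] : DecidableRel (Relation.Comp r s) :=
  fun i k => inferInstanceAs (Decidable (∃ j, r i j ∧ s j k))

instance decidableRelRelSum {a b c d : ℕ} (r : Fin a → Fin b → Prop) (s : Fin c → Fin d → Prop)
    [DecidableRel r] [DecidableRel s] : DecidableRel (relSum r s) :=
  fun i j => inferInstanceAs
    (Decidable (Sum.LiftRel r s (finSumFinEquiv.symm i) (finSumFinEquiv.symm j)))

instance Expr.decidableRelEvalRel : ∀ {a b : ℕ} (f : Expr bialgSig a b), DecidableRel f.evalRel
  | _, _, .op _ => fun _ _ => inferInstanceAs (Decidable True)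
  | _, _, .id _ => fun i j => inferInstanceAs (Decidable (i = j))
  | _, _, .comp f g =>
    have := decidableRelEvalRel f
    have := decidableRelEvalRel g
    Relation.decidableRelComp f.evalRel g.evalRel
  | _, _, .tensor f g =>
    have := decidableRelEvalRel f
    have := decidableRelEvalRel g
    decidableRelRelSum f.evalRel g.evalRel
  | _, _, .symm _ _ => fun x y => inferInstanceAs (Decidable (finAddFlip x = y))

/-- Each equation compares two explicit relations between fixed finite ordinals, so it can be
settled by evaluation. -/
theorem Bialg.Eqn.evalRel_iff {a b : ℕ} {f g : Expr bialgSig a b} (h : Bialg.Eqn f g) :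
    ∀ i j, f.evalRel i j ↔ g.evalRel i j := by
  cases h <;> decide

/-- The algebra of the theory of degenerate commutative bialgebras with a node in the PROP of
idags. -/
def dagAlg : GenAlg dagTheory dagProp where
  op := dagOp
  eqn h := by
    rcases h with h | h
    · refine (Expr.evalProp_inl _).trans (Eq.trans ?_ (Expr.evalProp_inl _).symm)
      congr 2
      ext i j
      exact Bialg.Eqn.evalRel_iff h i j
    · exact h.elim

/-! ### Every idag is generated by the operators. -/

/-- The idags generated by the operators. -/
def IsGen {a b : ℕ} (x : dagProp.Hom a b) : Prop :=
  ∃ t : Expr dagTheory.toSignature a b, t.evalProp dagProp dagOp = x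

namespace IsGen

theorem op (o : dagTheory.Op) : IsGen (dagOp o) := ⟨.op o, rfl⟩

theorem id (a : ℕ) : IsGen (dagProp.id a) := ⟨.id a, rfl⟩

theorem symm (a b : ℕ) : IsGen (dagProp.symm a b) := ⟨.symm a b, rfl⟩

theorem comp {a b c : ℕ} {x : dagProp.Hom a b} {y : dagProp.Hom b c} (hx : IsGen x)
    (hy : IsGen y) : IsGen (dagProp.comp x y) := by
  obtain ⟨s, rfl⟩ := hx
  obtain ⟨t, rfl⟩ := hy
  exact ⟨s.comp t, rfl⟩

theorem tensor {a b c d : ℕ} {x : dagProp.Hom a b} {y : dagProp.Hom c d} (hx : IsGen x)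
    (hy : IsGen y) : IsGen (dagProp.tensor x y) := by
  obtain ⟨s, rfl⟩ := hx
  obtain ⟨t, rfl⟩ := hy
  exact ⟨s.tensor t, rfl⟩

theorem ofRel_comp {a b c : ℕ} {r : Fin a → Fin b → Prop} {s : Fin b → Fin c → Prop}
    (hr : IsGen (AbsIDag.mk (.ofRel r))) (hs : IsGen (AbsIDag.mk (.ofRel s))) :
    IsGen (AbsIDag.mk (.ofRel (Relation.Comp r s))) :=
  AbsIDag.comp_ofRel r s ▸ hr.comp hs

theorem ofRel_relSum {a b c d : ℕ} {r : Fin a → Fin b → Prop} {s : Fin c → Fin d → Prop}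
    (hr : IsGen (AbsIDag.mk (.ofRel r))) (hs : IsGen (AbsIDag.mk (.ofRel s))) :
    IsGen (AbsIDag.mk (.ofRel (relSum r s))) :=
  AbsIDag.tensor_ofRel r s ▸ hr.tensor hs

theorem ofRel_id (a : ℕ) : IsGen (AbsIDag.mk (.ofRel fun i j : Fin a => i = j)) := id a

theorem ofRel_swapRel (a : ℕ) : IsGen (AbsIDag.mk (.ofRel (swapRel a))) :=
  (ofRel_id a).ofRel_relSum (symm 1 1)

theorem ofRel_evalRel {a b : ℕ} (f : Expr bialgSig a b) :
    IsGen (AbsIDag.mk (.ofRel f.evalRel)) :=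
  ⟨f.inl, f.evalProp_inl⟩

/-- The expression that adds an edge from the first to the second wire. -/
def addEdge : Expr bialgSig 2 2 := (Bialg.Δ.tensor Bialg.i).comp (Bialg.i.tensor Bialg.m)

theorem addEdge_iff : ∀ i j : Fin 2, addEdge.evalRel i j ↔ i = j ∨ j = 1 := by
  unfold addEdge
  decide

/-- The relation that adds an edge from the last but one wire to the last one. -/
def addEdgeRel (a : ℕ) : Fin (a + 2) → Fin (a + 2) → Prop :=
  relSum (fun i j : Fin a => i = j) addEdge.evalRel

theorem addEdgeRel_castSucc_castSucc (a : ℕ) (i : Fin a) (j : Fin (a + 2)) :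
    addEdgeRel a i.castSucc.castSucc j ↔ j = i.castSucc.castSucc := by
  refine Fin.addCases (fun j => ?_) (fun j => ?_) j
  · refine (relSum_castAdd_castAdd _ _ i j).trans ?_
    simp [Fin.ext_iff, eq_comm]
  · refine iff_of_false (relSum_castAdd_natAdd _ _ i j) fun h => ?_
    have := congrArg Fin.val h
    simp at this
    omega

theorem addEdgeRel_castSucc_last (a : ℕ) (j : Fin (a + 2)) :
    addEdgeRel a (Fin.last a).castSucc j ↔ j = (Fin.last a).castSucc ∨ j = Fin.last (a + 1) := by
  refine Fin.addCases (fun j => ?_) (fun j => ?_) j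
  · refine iff_of_false (relSum_natAdd_castAdd _ _ (0 : Fin 2) j) fun h => ?_
    simp only [Fin.ext_iff, Fin.val_castAdd, Fin.val_castSucc, Fin.val_last] at h
    omega
  · refine (relSum_natAdd_natAdd _ _ (0 : Fin 2) j).trans ?_
    rw [addEdge_iff]
    simp only [Fin.ext_iff, Fin.val_natAdd, Fin.val_castSucc, Fin.val_last, Fin.val_zero,
      Fin.val_one]
    omega

theorem addEdgeRel_last (a : ℕ) (j : Fin (a + 2)) :
    addEdgeRel a (Fin.last (a + 1)) j ↔ j = Fin.last (a + 1) := by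
  refine Fin.addCases (fun j => ?_) (fun j => ?_) j
  · refine iff_of_false (relSum_natAdd_castAdd _ _ (1 : Fin 2) j) fun h => ?_
    simp only [Fin.ext_iff, Fin.val_castAdd, Fin.val_last] at h
    omega
  · refine (relSum_natAdd_natAdd _ _ (1 : Fin 2) j).trans ?_
    rw [addEdge_iff]
    simp only [Fin.ext_iff, Fin.val_natAdd, Fin.val_last, Fin.val_one]
    omega

/-- If the last wire belongs to `p`, its edge to the new wire can be added separately, after the new
wire has been joined to the other members. -/
theorem dupRel_eq_comp {a : ℕ} (p : Fin (a + 1) → Prop) (hp : p (Fin.last a)) :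
    dupRel p = Relation.Comp (dupRel (extendFalse fun i => p i.castSucc)) (addEdgeRel a) := by
  ext i j
  simp only [Relation.Comp, Fin.exists_fin_succ', addEdgeRel_castSucc_castSucc,
    addEdgeRel_castSucc_last, addEdgeRel_last, dupRel_castSucc, dupRel_last]
  refine Fin.lastCases ?_ (fun i => ?_) i <;>
  refine Fin.lastCases ?_ (fun j => Fin.lastCases ?_ (fun j => ?_) j) j <;>
  simp [dupRel_last, dupRel_castSucc, hp, extendFalse_last, extendFalse_castSucc,
    (Fin.castSucc_ne_last _).symm, (Fin.castSucc_ne_last _)]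
  all_goals grind

/-- Induction on the number of wires. With none, the new wire is η; otherwise the last wire is
exchanged past the new one, and an edge between the two is added if needed. -/
theorem ofRel_dupRel {a : ℕ} (p : Fin a → Prop) : IsGen (AbsIDag.mk (.ofRel (dupRel p))) := by
  induction a with
  | zero =>
    have : dupRel p = fun _ _ => True := funext fun i => i.elim0
    rw [this]
    exact op (.inl .eta)
  | succ a ih =>
    have h : IsGen (AbsIDag.mk (.ofRel (dupRel (extendFalse fun i => p i.castSucc)))) := by
      rw [dupRel_extendFalse]
      exact ((ih _).ofRel_relSum (ofRel_id 1)).ofRel_comp (ofRel_swapRel a)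
    by_cases hp : p (Fin.last a)
    · rw [dupRel_eq_comp p hp]
      exact h.ofRel_comp ((ofRel_id a).ofRel_relSum (ofRel_evalRel addEdge))
    · have : p = extendFalse fun i => p i.castSucc := by
        ext i
        refine Fin.lastCases ?_ (fun i => ?_) i
        · exact iff_of_false hp (extendFalse_last _)
        · rw [extendFalse_castSucc]
      rwa [this]

/-- Induction on the number of outputs: the last output is split off as a new wire. Without outputs
the relation is a tensor power of ε. -/
theorem ofRel {a b : ℕ} (r : Fin a → Fin b → Prop) : IsGen (AbsIDag.mk (.ofRel r)) := by
  induction b with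
  | zero =>
    have : r = fun _ _ => True := by
      ext i j
      exact j.elim0
    rw [this]
    clear this r
    induction a with
    | zero =>
      have : (fun (_ _ : Fin 0) => True) = fun i j => i = j := funext fun i => i.elim0
      rw [this]
      exact id 0
    | succ a ih =>
      have : (fun (_ : Fin (a + 1)) (_ : Fin (0 + 0)) => True) =
          relSum (fun (_ : Fin a) (_ : Fin 0) => True) fun (_ : Fin 1) (_ : Fin 0) => True := by
        ext i j
        exact j.elim0
      exact this ▸ ih.ofRel_relSum (op (.inl .eps))
  | succ b ih =>
    have : r = Relation.Comp (dupRel fun i => r i (Fin.last b))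
        (relSum (fun i j => r i (Fin.castSucc j)) fun i j : Fin 1 => i = j) := by
      ext i j
      refine Fin.lastCases ?_ (fun j => ?_) j <;>
      simp [Relation.Comp, Fin.exists_fin_succ', dupRel_last, dupRel_castSucc,
        relSum_id_castSucc_iff, relSum_id_last_iff, (Fin.castSucc_ne_last _).symm]
    rw [this]
    exact (ofRel_dupRel _).ofRel_comp ((ih _).ofRel_relSum (ofRel_id 1))

/-- The counterpart of `Nf.step` in the PROP of idags itself: a minimal node is split off as a
factor λ. -/
theorem mk_eq_comp {a b : ℕ} {D : IDag (Fin a) (Fin b)} {x : D.N}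
    {E : IDag (Fin (a + 1)) (Fin b)} {e : E.N → D.N} (h : D.Peel x E e) :
    AbsIDag.mk D = dagProp.comp (AbsIDag.mk (.ofRel (dupRel fun i => D.R (.inl i) (.inr x))))
      (dagProp.comp (dagProp.tensor (dagProp.id a) (AbsIDag.mk IDag.node)) (AbsIDag.mk E)) := by
  let J : IDag (Fin (a + 1)) (Fin (a + 1)) :=
    (IDag.ofRel (Eq : Fin a → Fin a → Prop)).juxtFin IDag.node
  let K := (IDag.ofRel (dupRel fun i => D.R (.inl i) (.inr x))).concat (J.concat E)
  -- The relation contributes no nodes, the node λ becomes `x`, and `E` supplies all the others.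
  let g : K.N → D.N := Sum.elim Empty.elim (Sum.elim (fun _ => x) e)
  have hg : Function.Bijective g := by
    refine ⟨?_, fun y => ?_⟩
    · rintro (⟨⟨⟩⟩ | (⟨⟨⟩⟩ | ⟨⟩) | y) (⟨⟨⟩⟩ | (⟨⟨⟩⟩ | ⟨⟩) | z) hyz
      · rfl
      · exact (h.ne z hyz.symm).elim
      · exact (h.ne y hyz).elim
      · rw [h.injective hyz]
    · by_cases hy : y = x
      · exact ⟨.inr (.inl (.inr ())), hy.symm⟩
      · obtain ⟨z, rfl⟩ := h.exists_eq y hy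
        exact ⟨.inr (.inr z), rfl⟩
  have hcast (k : Fin a) : (finSumFinEquiv (n := 1)).symm k.castSucc = .inl k :=
    finSumFinEquiv_symm_apply_castAdd k
  have hlast : (finSumFinEquiv (m := a) (n := 1)).symm (Fin.last a) = .inr 0 :=
    finSumFinEquiv_symm_apply_natAdd 0
  refine Eq.symm (Quotient.sound ⟨Equiv.ofBijective g hg, ?_⟩)
  suffices H : ∀ u v, K.R u v ↔ D.R (Sum.map _root_.id g u) (Sum.map _root_.id g v) from H
  have hdup := dupRel_castSucc fun i => D.R (.inl i) (.inr x)
  have hdup' := dupRel_last fun i => D.R (.inl i) (.inr x)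
  have h1 := h.input
  have h2 := h.last
  have h3 := h.inner
  have h4 := h.minimal
  rintro (u | ⟨⟨⟩⟩ | (⟨⟨⟩⟩ | ⟨⟩) | u) (v | ⟨⟨⟩⟩ | (⟨⟨⟩⟩ | ⟨⟩) | v) <;>
    simp [K, J, g, IDag.concat, IDag.concatRel, IDag.ofRel, IDag.ofRelRel, IDag.juxtFin,
      IDag.reindex, IDag.reindexRel, IDag.juxt, IDag.juxtRel, IDag.node, IDag.nodeRel,
      Fin.exists_fin_succ', hcast, hlast, h1, h2, h3, h4, hdup, hdup']

theorem mk {a b : ℕ} (D : IDag (Fin a) (Fin b)) : IsGen (AbsIDag.mk D) := by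
  induction D using IDag.peel_induction with
  | @base a D h =>
    have : AbsIDag.mk D = AbsIDag.mk (.ofRel fun i j => D.R (.inl i) (.inl j)) := by
      refine Quotient.sound ⟨Equiv.equivOfIsEmpty D.N Empty, fun u v => ?_⟩
      rcases u with u | u
      · rcases v with v | v
        · exact Iff.rfl
        · exact h.elim v
      · exact h.elim u
    rw [this]
    exact ofRel _
  | peel h ih =>
    rw [mk_eq_comp h]
    exact (ofRel_dupRel _).comp (((id _).tensor (op (.inr ()))).comp ih)

end IsGen

/-! ### Soundness, completeness, and the isomorphism with the free PROP. -/

theorem GenAlg.evalProp_eq_of_provable {T : SMTheory} {P : PROP.{w}} (M : GenAlg T P) {a b : ℕ}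
    {f g : Expr T.toSignature a b} (h : T.Provable f g) :
    f.evalProp P M.op = g.evalProp P M.op := by
  have cast {a a' b b' : ℕ} (ha : a = a') (hb : b = b') (f : Expr T.toSignature a b) :
      (castHom ha hb f : Expr T.toSignature a' b').evalProp P M.op =
        castHom ha hb (f.evalProp P M.op) :=
    (castHom_natural (fun {a b} (f : Expr T.toSignature a b) => f.evalProp P M.op) ha hb f).symm
  induction h with
  | eqn h => exact M.eqn h
  | refl f => rfl
  | symm _ h => exact h.symm
  | trans _ _ h h' => exact h.trans h'
  | comp_congr _ _ h h' => exact congrArg₂ P.comp h h'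
  | tensor_congr _ _ h h' => exact congrArg₂ P.tensor h h'
  | id_comp f => exact P.id_comp _
  | comp_id f => exact P.comp_id _
  | assoc f g h => exact P.assoc _ _ _
  | tensor_id a b => exact P.tensor_id a b
  | tensor_comp f g f' g' => exact P.tensor_comp _ _ _ _
  | tensor_assoc f g h => exact (cast _ _ _).trans (P.tensor_assoc _ _ _)
  | unit_tensor f => exact (cast _ _ _).trans (P.unit_tensor _)
  | tensor_unit f => exact P.tensor_unit _
  | symm_naturality f g => exact P.symm_naturality _ _
  | symm_symm a b => exact P.symm_symm a b
  | hexagon a b c =>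
    exact (P.hexagon a b c).trans (congrArg₂ P.comp
      (cast _ _ ((Expr.symm a b).tensor (Expr.id c)))
      (cast _ _ ((Expr.id b).tensor (Expr.symm a c)))).symm

/-- The morphism from the free PROP that is determined by an algebra. -/
def GenAlg.freeLift {T : SMTheory} {P : PROP.{w}} (M : GenAlg T P) : T.freeProp.Morphism P where
  map := Quotient.lift (fun f => f.evalProp P M.op) fun _ _ h => M.evalProp_eq_of_provable h
  map_id _ := rfl
  map_comp := by rintro a b c ⟨f⟩ ⟨g⟩; rfl
  map_tensor := by rintro a b c d ⟨f⟩ ⟨g⟩; rfl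
  map_symm _ _ := rfl

theorem SMTheory.evalProp_gen (T : SMTheory) {a b : ℕ} (f : Expr T.toSignature a b) :
    f.evalProp T.freeProp T.gen = Quotient.mk (T.setoid a b) f := by
  induction f with
  | op o => rfl
  | id a => rfl
  | comp f g hf hg => exact congrArg₂ T.freeProp.comp hf hg
  | tensor f g hf hg => exact congrArg₂ T.freeProp.tensor hf hg
  | symm a b => rfl

/-- The generic algebra of a theory in its free PROP. -/
def SMTheory.genAlg (T : SMTheory) : GenAlg T T.freeProp where
  op := T.gen
  eqn h := by
    rw [T.evalProp_gen, T.evalProp_gen]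
    exact Quotient.sound (.eqn h)

/-- Completeness: the comparison of values is applied to the generic algebra in the free PROP, where
the value of an expression is its own class. -/
theorem provable_of_evalProp_eq {a b : ℕ} {s t : Expr dagTheory.toSignature a b}
    (h : s.evalProp dagProp dagOp = t.evalProp dagProp dagOp) : dagTheory.Provable s t := by
  have h := GenAlg.evalProp_eq_of_evalProp_eq (M := dagTheory.genAlg) h
  change s.evalProp dagTheory.freeProp dagTheory.gen =
    t.evalProp dagTheory.freeProp dagTheory.gen at h
  rw [SMTheory.evalProp_gen, SMTheory.evalProp_gen] at h
  exact Quotient.exact h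

theorem exists_evalProp_eq {a b : ℕ} (x : dagProp.Hom a b) :
    ∃ t : Expr dagTheory.toSignature a b, t.evalProp dagProp dagOp = x :=
  Quotient.inductionOn x IsGen.mk

theorem dagAlg_freeLift_isIso : dagAlg.freeLift.IsIso := fun a b => by
  refine ⟨?_, fun x => ?_⟩
  · rintro ⟨s⟩ ⟨t⟩ h
    exact Quotient.sound (provable_of_evalProp_eq h)
  · obtain ⟨t, ht⟩ := exists_evalProp_eq x
    exact ⟨Quotient.mk _ t, ht⟩

/-! ### The PROP of morphisms between tensor powers. -/

section EndomorphismProp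

variable {C : Type u} [Category.{v} C] [MonoidalCategory C] (A : C)

theorem castHom_tpow {a a' b b' : ℕ} (ha : a = a') (hb : b = b') (f : tpow A a ⟶ tpow A b) :
    castHom (H := fun a b => tpow A a ⟶ tpow A b) ha hb f =
      eqToHom (congrArg (tpow A) ha.symm) ≫ f ≫ eqToHom (congrArg (tpow A) hb) := by
  subst ha hb
  simp [castHom]

theorem eqToHom_tpow_succ {a a' : ℕ} (h : a = a') (h' : tpow A (a + 1) = tpow A (a' + 1)) :
    (eqToHom h' : tpow A a ⊗ A ⟶ tpow A a' ⊗ A) = eqToHom (congrArg (tpow A) h) ▷ A := by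
  subst h
  simp
  rfl

theorem tpowAdd_zero_left (n : ℕ) : tpowAdd A 0 n =
    eqToIso (congrArg (tpow A) (Nat.zero_add n)) ≪≫ (λ_ (tpow A n)).symm := by
  -- Stated for arbitrary objects because `0 + n` equals `n` only propositionally, so the
  -- isomorphism between the two powers stays abstract.
  have key {X Y : C} (t : X ≅ 𝟙_ C ⊗ Y) (e : X ≅ Y) (h : t = e ≪≫ (λ_ Y).symm) :
      t.hom ▷ A ≫ (α_ (𝟙_ C) Y A).hom = e.hom ▷ A ≫ (λ_ (Y ⊗ A)).inv := by
    subst h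
    simp
  ext
  induction n with
  | zero =>
    change (ρ_ (𝟙_ C)).inv = 𝟙 (𝟙_ C) ≫ (λ_ (𝟙_ C)).inv
    simp [unitors_inv_equal]
  | succ n ih =>
    refine (key _ _ (Iso.ext ih)).trans ?_
    exact congrArg (· ≫ (λ_ (tpow A n ⊗ A)).inv) (eqToHom_tpow_succ A (Nat.zero_add n)
      (congrArg (tpow A) (Nat.zero_add (n + 1)))).symm

/-- Associativity of the splitting of tensor powers; the inductive step is the pentagon. The
`eqToHom` matches the casts in the laws of a PROP. -/
theorem tpowAdd_add (a b c : ℕ) :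
    (tpowAdd A (a + b) c).hom ≫ (tpowAdd A a b).hom ▷ tpow A c ≫
        (α_ (tpow A a) (tpow A b) (tpow A c)).hom =
      eqToHom (congrArg (tpow A) (Nat.add_assoc a b c)) ≫ (tpowAdd A a (b + c)).hom ≫
        tpow A a ◁ (tpowAdd A b c).hom := by
  induction c with
  | zero =>
    change (ρ_ (tpow A (a + b))).inv ≫ (tpowAdd A a b).hom ▷ 𝟙_ C ≫
        (α_ (tpow A a) (tpow A b) (𝟙_ C)).hom =
      𝟙 (tpow A (a + b)) ≫ (tpowAdd A a b).hom ≫ tpow A a ◁ (ρ_ (tpow A b)).inv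
    simp
  | succ c ih =>
    change ((tpowAdd A (a + b) c).hom ▷ A ≫ (α_ (tpow A (a + b)) (tpow A c) A).hom) ≫
        (tpowAdd A a b).hom ▷ (tpow A c ⊗ A) ≫ (α_ (tpow A a) (tpow A b) (tpow A c ⊗ A)).hom =
      (eqToHom (congrArg (tpow A) (Nat.add_assoc a b (c + 1))) :
        tpow A (a + b + c) ⊗ A ⟶ tpow A (a + (b + c)) ⊗ A) ≫
        ((tpowAdd A a (b + c)).hom ▷ A ≫ (α_ (tpow A a) (tpow A (b + c)) A).hom) ≫
        tpow A a ◁ ((tpowAdd A b c).hom ▷ A ≫ (α_ (tpow A b) (tpow A c) A).hom)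
    rw [eqToHom_tpow_succ A (Nat.add_assoc a b c)]
    have h := congrArg (· ▷ A ≫ (α_ (tpow A a) (tpow A b ⊗ tpow A c) A).hom ≫
      tpow A a ◁ (α_ (tpow A b) (tpow A c) A).hom) ih
    simp only [comp_whiskerRight, Category.assoc] at h
    simp only [MonoidalCategory.whiskerLeft_comp, Category.assoc]
    rw [← associator_naturality_middle_assoc]
    refine Eq.trans ?_ h
    rw [pentagon]
    simp

variable [SymmetricCategory C]

/-- The PROP of the morphisms between the tensor powers of an object. -/
def endProp : PROP.{v} where
  Hom a b := tpow A a ⟶ tpow A b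
  id a := 𝟙 (tpow A a)
  comp f g := f ≫ g
  tensor {a b c d} f g := (tpowAdd A a c).hom ≫ (f ⊗ₘ g) ≫ (tpowAdd A b d).inv
  symm a b := (tpowAdd A a b).hom ≫ (β_ (tpow A a) (tpow A b)).hom ≫ (tpowAdd A b a).inv
  id_comp := Category.id_comp
  comp_id := Category.comp_id
  assoc := Category.assoc
  tensor_id a b := by simp
  tensor_comp f g f' g' := by simp
  tensor_assoc {a b a' b' a'' b''} f g h := by
    rw [castHom_tpow]
    have h1 := tpowAdd_add A a a' a''
    have h2 := tpowAdd_add A b b' b''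
    rw [← cancel_mono ((tpowAdd A b (b' + b'')).hom ≫ tpow A b ◁ (tpowAdd A b' b'').hom),
      ← cancel_epi (eqToHom (congrArg (tpow A) (Nat.add_assoc a a' a'')))]
    simp only [Category.assoc, eqToHom_trans_assoc, eqToHom_refl, Category.id_comp, ← h2]
    simp [MonoidalCategory.tensorHom_def]
    rw [whisker_exchange_assoc (tpowAdd A b b').hom h,
      ← whisker_exchange_assoc f (tpowAdd A a' a'').hom, ← reassoc_of% h1]
    simp
  unit_tensor {a b} f := by
    have key {X X' Y Y' : C} (e : X ≅ Y) (e' : X' ≅ Y') (f : Y ⟶ Y') :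
        e.inv ≫ ((e ≪≫ (λ_ Y).symm).hom ≫ (𝟙 (𝟙_ C) ⊗ₘ f) ≫ (e' ≪≫ (λ_ Y').symm).inv) ≫ e'.hom =
          f := by
      simp
    rw [castHom_tpow, tpowAdd_zero_left, tpowAdd_zero_left]
    exact key (eqToIso (congrArg (tpow A) (Nat.zero_add a)))
      (eqToIso (congrArg (tpow A) (Nat.zero_add b))) f
  tensor_unit {a b} f := by
    change (ρ_ (tpow A a)).inv ≫ (f ⊗ₘ 𝟙 (𝟙_ C)) ≫ (ρ_ (tpow A b)).hom = f
    simp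
  symm_naturality f g := by simp
  symm_symm a b := by simp
  hexagon a b c := by
    rw [castHom_tpow, castHom_tpow]
    have h1 := tpowAdd_add A a b c
    have h2 := tpowAdd_add A b a c
    have h3 := tpowAdd_add A b c a
    rw [← cancel_mono ((tpowAdd A (b + c) a).hom ≫ (tpowAdd A b c).hom ▷ tpow A a ≫
        (α_ (tpow A b) (tpow A c) (tpow A a)).hom),
      ← cancel_epi (eqToHom (congrArg (tpow A) (Nat.add_assoc a b c)))]
    conv_rhs => rw [h3]
    simp only [Category.assoc, eqToHom_trans_assoc, eqToHom_refl, Category.id_comp, id_tensorHom,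
      tensorHom_id, comp_whiskerRight, MonoidalCategory.whiskerLeft_comp, Iso.inv_hom_id_assoc,
      whiskerLeft_inv_hom, Category.comp_id]
    rw [← reassoc_of% h2]
    simp only [inv_hom_whiskerRight_assoc, Iso.inv_hom_id_assoc]
    -- After all powers have been split into three factors, the hexagon of `C` is what remains.
    rw [← BraidedCategory.hexagon_forward, reassoc_of% h1,
      BraidedCategory.braiding_naturality_right_assoc]

end EndomorphismProp

/-! ### Symmetric monoidal functors and algebras. -/

section UniversalProperty

open Functor.LaxMonoidal Functor.OplaxMonoidal Functor.Monoidal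

variable {C : Type u} [Category.{v} C] [MonoidalCategory C]

theorem tpowMap_add {A B : C} (h : A ⟶ B) (a b : ℕ) :
    tpowMap h (a + b) ≫ (tpowAdd B a b).hom =
      (tpowAdd A a b).hom ≫ (tpowMap h a ⊗ₘ tpowMap h b) := by
  induction b with
  | zero =>
    change tpowMap h a ≫ (ρ_ (tpow B a)).inv = (ρ_ (tpow A a)).inv ≫ (tpowMap h a ⊗ₘ 𝟙 (𝟙_ C))
    simp
  | succ b ih =>
    change (tpowMap h (a + b) ⊗ₘ h) ≫ (tpowAdd B a b).hom ▷ B ≫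
        (α_ (tpow B a) (tpow B b) B).hom =
      ((tpowAdd A a b).hom ▷ A ≫ (α_ (tpow A a) (tpow A b) A).hom) ≫
        (tpowMap h a ⊗ₘ (tpowMap h b ⊗ₘ h))
    rw [Category.assoc, ← associator_naturality, ← tensorHom_id, ← tensorHom_id,
      tensorHom_comp_tensorHom_assoc, tensorHom_comp_tensorHom_assoc, ih]
    simp

/-- The first tensor power of `X` is `𝟙 ⊗ X`, not `X`. The left unitor of the PROP at `1` is an
identity, so left unitality of `F` gives the formula. -/
theorem genIso_one {P : PROP.{w}} (F : P.Obj ⥤ C) [F.Monoidal] :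
    (genIso F 1).hom = (λ_ (F.obj ⟨1⟩)).hom := by
  have h : F.map (λ_ (⟨1⟩ : P.Obj)).hom = 𝟙 (F.obj ⟨1⟩) := F.map_id _
  have h' := Functor.LaxMonoidal.left_unitality F (⟨1⟩ : P.Obj)
  rw [h] at h'
  exact ((h'.trans (congrArg (_ ≫ ·) (Category.comp_id _))).symm :)

theorem tpowMap_one {A B : C} (h : A ⟶ B) :
    tpowMap h 1 ≫ (λ_ B).hom = (λ_ A).hom ≫ h := by
  change (𝟙 (𝟙_ C) ⊗ₘ h) ≫ (λ_ B).hom = (λ_ A).hom ≫ h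
  simp

theorem tpowAdd_inv_tpowMap {A B : C} (h : A ⟶ B) (a b : ℕ) :
    (tpowAdd A a b).inv ≫ tpowMap h (a + b) =
      (tpowMap h a ⊗ₘ tpowMap h b) ≫ (tpowAdd B a b).inv := by
  rw [Iso.inv_comp_eq, ← reassoc_of% tpowMap_add, Iso.hom_inv_id, Category.comp_id]

theorem genIso_comp {P : PROP.{w}} {D : Type u'} [Category.{v'} D] [MonoidalCategory D]
    (F : P.Obj ⥤ D) [F.Monoidal] (G : D ⥤ C) [G.Monoidal] (n : ℕ) :
    genIso (F ⋙ G) n = tpowIso G (F.obj ⟨1⟩) n ≪≫ G.mapIso (genIso F n) := by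
  ext
  induction n with
  | zero => exact Functor.LaxMonoidal.comp_ε F G
  | succ n ih =>
    have key {X Y Z : C} (s : X ⟶ Z) (t : X ⟶ Y) (r : Y ⟶ Z) (h : s = t ≫ r) :
        s ▷ G.obj (F.obj ⟨1⟩) = t ▷ _ ≫ r ▷ _ := by
      rw [h, comp_whiskerRight]
    change (genIso (F ⋙ G) n).hom ▷ G.obj (F.obj ⟨1⟩) ≫ μ (F ⋙ G) ⟨n⟩ ⟨1⟩ =
      ((tpowIso G (F.obj ⟨1⟩) n).hom ▷ G.obj (F.obj ⟨1⟩) ≫ μ G (tpow (F.obj ⟨1⟩) n) (F.obj ⟨1⟩)) ≫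
        G.map ((genIso F n).hom ▷ F.obj ⟨1⟩ ≫ μ F ⟨n⟩ ⟨1⟩)
    rw [Functor.LaxMonoidal.comp_μ, G.map_comp, Category.assoc, ← μ_natural_left_assoc]
    have h := key _ _ _ ih
    exact (congrArg (· ≫ μ G (F.obj ⟨n⟩) (F.obj ⟨1⟩) ≫ G.map (μ F ⟨n⟩ ⟨1⟩)) h).trans
      (Category.assoc _ _ _)

variable [SymmetricCategory C]

theorem Expr.interp_eq_evalProp {S : Signature} (A : C)
    (m : ∀ o : S.Op, tpow A (S.dom o) ⟶ tpow A (S.cod o)) {a b : ℕ} (f : Expr S a b) :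
    f.interp A m = f.evalProp (endProp A) m := by
  induction f with
  | op o => rfl
  | id a => rfl
  | comp f g hf hg => exact congrArg₂ (endProp A).comp hf hg
  | tensor f g hf hg => exact congrArg₂ (endProp A).tensor hf hg
  | symm a b => rfl

namespace Alg

variable {T : SMTheory}

/-- An algebra, as an algebra in the PROP of morphisms between the tensor powers of the carrier. -/
def toGenAlg (A : Alg C T) : GenAlg T (endProp A.carrier) where
  op := A.op
  eqn h := by
    rw [← Expr.interp_eq_evalProp, ← Expr.interp_eq_evalProp]
    exact A.eqn h

/-- Commuting with the operators implies commuting with all expressions; this supplies naturality in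
the proof of fullness. -/
theorem Hom.interp_comm {A B : Alg C T} (h : Hom A B) {a b : ℕ} (f : Expr T.toSignature a b) :
    tpowMap h.hom a ≫ f.interp B.carrier B.op = f.interp A.carrier A.op ≫ tpowMap h.hom b := by
  induction f with
  | op o => exact h.comm o
  | id a => exact (Category.comp_id _).trans (Category.id_comp _).symm
  | comp f g hf hg => simp only [Expr.interp, Category.assoc, ← hg, reassoc_of% hf]
  | tensor f g hf hg =>
    simp only [Expr.interp, Category.assoc, tpowAdd_inv_tpowMap, reassoc_of% tpowMap_add,
      tensorHom_comp_tensorHom_assoc, hf, hg]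
  | symm a b =>
    simp only [Expr.interp, Category.assoc, tpowAdd_inv_tpowMap, reassoc_of% tpowMap_add,
      BraidedCategory.braiding_naturality_assoc]

/-- An isomorphism of carriers that commutes with the operators. -/
def isoMk {A B : Alg C T} (e : A.carrier ≅ B.carrier)
    (h : ∀ o : T.Op, tpowMap e.hom (T.dom o) ≫ B.op o = A.op o ≫ tpowMap e.hom (T.cod o)) :
    A ≅ B where
  hom := ⟨e.hom, h⟩
  inv := ⟨e.inv, fun o => by
    have key (n : ℕ) : tpowMap e.hom n ≫ tpowMap e.inv n = 𝟙 _ := by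
      rw [← tpowMap_comp, e.hom_inv_id, tpowMap_id]
    have key' (n : ℕ) : tpowMap e.inv n ≫ tpowMap e.hom n = 𝟙 _ := by
      rw [← tpowMap_comp, e.inv_hom_id, tpowMap_id]
    calc
      _ = tpowMap e.inv (T.dom o) ≫ (A.op o ≫ tpowMap e.hom (T.cod o)) ≫
          tpowMap e.inv (T.cod o) := by rw [Category.assoc, key, Category.comp_id]
      _ = _ := by rw [← h, Category.assoc, reassoc_of% key']⟩
  hom_inv_id := Hom.ext e.hom_inv_id
  inv_hom_id := Hom.ext e.inv_hom_id

end Alg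

/-- An algebra in a PROP is free when all morphisms are values of expressions, and expressions
with equal values are provably equal. -/
structure GenAlg.IsFree {T : SMTheory} {P : PROP.{w}} (M : GenAlg T P) : Prop where
  exists_evalProp_eq {a b : ℕ} (x : P.Hom a b) :
    ∃ t : Expr T.toSignature a b, t.evalProp P M.op = x
  provable {a b : ℕ} {s t : Expr T.toSignature a b} :
    s.evalProp P M.op = t.evalProp P M.op → T.Provable s t

namespace GenAlg

variable {T : SMTheory} {P : PROP.{w}} {M : GenAlg T P}

-- Up to the isomorphisms `genIso`, the component at `n` is the `n`-th tensor power of the component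
-- at `1`.
variable (C) in
instance : (M.ev C).Faithful where
  map_injective {F G α β} h := by
    refine SymMonFunctor.Hom.ext (NatTrans.ext (funext fun n => ?_))
    have h : α.nat.app ⟨1⟩ = β.nat.app ⟨1⟩ := congrArg Alg.Hom.hom h
    rw [← cancel_epi (genIso F.F n.n).hom]
    exact (genIso_natural α.nat n.n).symm.trans
      ((congrArg (fun f => tpowMap f n.n ≫ (genIso G.F n.n).hom) h).trans
        (genIso_natural β.nat n.n))

/-- The monoidal natural transformation determined by its component at the generating object. -/
def homOfApp {F G : SymMonFunctor P.Obj C} (k : F.F.obj ⟨1⟩ ⟶ G.F.obj ⟨1⟩)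
    (hk : ∀ {a b : P.Obj} (x : a ⟶ b),
      tpowMap k a.n ≫ (genIso G.F a.n).hom ≫ G.F.map x ≫ (genIso G.F b.n).inv =
        ((genIso F.F a.n).hom ≫ F.F.map x ≫ (genIso F.F b.n).inv) ≫ tpowMap k b.n) :
    F ⟶ G where
  nat :=
    { app n := (genIso F.F n.n).inv ≫ tpowMap k n.n ≫ (genIso G.F n.n).hom
      naturality a b x := by
        rw [← cancel_epi (genIso F.F a.n).hom, ← cancel_mono (genIso G.F b.n).inv]
        simpa using (hk x).symm }
  isMonoidal :=
    { unit := (Iso.hom_inv_id_assoc (εIso F.F) _).trans (Category.id_comp _)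
      tensor a b := by
        change μ F.F a b ≫ (genIso F.F (a.n + b.n)).inv ≫ tpowMap k (a.n + b.n) ≫
          (genIso G.F (a.n + b.n)).hom = _
        rw [genIso_add, genIso_add]
        simp [reassoc_of% tpowMap_add] }

/-- Every morphism of `P` is the value of an expression, so naturality of the tensor powers of a
homomorphism reduces to `Alg.Hom.interp_comm`. -/
theorem IsFree.full_ev (hM : M.IsFree) : (M.ev C).Full where
  map_surjective {F G} h := by
    have hk {a b : P.Obj} (x : a ⟶ b) :
        tpowMap h.hom a.n ≫ (genIso G.F a.n).hom ≫ G.F.map x ≫ (genIso G.F b.n).inv =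
          ((genIso F.F a.n).hom ≫ F.F.map x ≫ (genIso F.F b.n).inv) ≫ tpowMap h.hom b.n := by
      obtain ⟨t, rfl⟩ := hM.exists_evalProp_eq x
      have hF : t.interp ((M.ev C).obj F).carrier ((M.ev C).obj F).op = _ :=
        interp_gen F.F M.op t
      have hG : t.interp ((M.ev C).obj G).carrier ((M.ev C).obj G).op = _ :=
        interp_gen G.F M.op t
      have hh := h.interp_comm t
      rw [hF, hG] at hh
      exact hh
    refine ⟨homOfApp h.hom hk, Alg.Hom.ext ?_⟩
    have key (k : F.F.obj ⟨1⟩ ⟶ G.F.obj ⟨1⟩) :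
        (genIso F.F 1).inv ≫ tpowMap k 1 ≫ (genIso G.F 1).hom = k := by
      rw [Iso.inv_comp_eq, genIso_one, genIso_one]
      exact tpowMap_one k
    exact key h.hom

/-- The morphism of PROPs determined by an algebra. -/
noncomputable def IsFree.morphism (hM : M.IsFree) {Q : PROP.{w'}} (N : GenAlg T Q) :
    P.Morphism Q :=
  -- Any expression with value `x` gives the same result, as two of them are provably equal. Each
  -- law then follows from a suitable choice of expression.
  have key {a b : ℕ} {x : P.Hom a b} {t : Expr T.toSignature a b}
      (h : t.evalProp P M.op = x) :
      (hM.exists_evalProp_eq x).choose.evalProp Q N.op = t.evalProp Q N.op :=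
    N.evalProp_eq_of_provable (hM.provable ((hM.exists_evalProp_eq x).choose_spec.trans h.symm))
  { map x := (hM.exists_evalProp_eq x).choose.evalProp Q N.op
    map_id a := key (t := .id a) rfl
    map_comp f g := key (t := (hM.exists_evalProp_eq f).choose.comp
      (hM.exists_evalProp_eq g).choose) (congrArg₂ P.comp
      (hM.exists_evalProp_eq f).choose_spec (hM.exists_evalProp_eq g).choose_spec)
    map_tensor f g := key (t := (hM.exists_evalProp_eq f).choose.tensor
      (hM.exists_evalProp_eq g).choose) (congrArg₂ P.tensor
      (hM.exists_evalProp_eq f).choose_spec (hM.exists_evalProp_eq g).choose_spec)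
    map_symm a b := key (t := .symm a b) rfl }

theorem IsFree.morphism_map_op (hM : M.IsFree) {Q : PROP.{w'}} (N : GenAlg T Q) (o : T.Op) :
    (hM.morphism N).map (M.op o) = N.op o :=
  N.evalProp_eq_of_provable (g := .op o)
    (hM.provable (hM.exists_evalProp_eq (M.op o)).choose_spec)

end GenAlg

namespace PROP.Morphism

variable {P : PROP.{w}} {A : C} (φ : P.Morphism (endProp A))

/-- The functor determined by a morphism of PROPs. -/
def functor : P.Obj ⥤ C where
  obj n := tpow A n.n
  map x := φ.map x
  map_id a := φ.map_id a.n
  map_comp f g := φ.map_comp f g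

theorem functor_map_eqToHom {a b : P.Obj} (h : a = b) :
    φ.functor.map (eqToHom h) = eqToHom (congrArg (fun n : P.Obj => tpow A n.n) h) :=
  eqToHom_map φ.functor h

theorem functor_map_whiskerRight {a b : P.Obj} (f : a ⟶ b) (c : P.Obj) :
    φ.functor.map (f ▷ c) = (tpowAdd A a.n c.n).hom ≫ (φ.functor.map f ▷ tpow A c.n) ≫
      (tpowAdd A b.n c.n).inv := by
  refine (φ.map_tensor f (P.id c.n)).trans ?_
  rw [φ.map_id]
  exact congrArg (fun k => (tpowAdd A a.n c.n).hom ≫ k ≫ (tpowAdd A b.n c.n).inv)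
    (tensorHom_id (φ.functor.map f) (tpow A c.n))

theorem functor_map_whiskerLeft (c : P.Obj) {a b : P.Obj} (f : a ⟶ b) :
    φ.functor.map (c ◁ f) = (tpowAdd A c.n a.n).hom ≫ (tpow A c.n ◁ φ.functor.map f) ≫
      (tpowAdd A c.n b.n).inv := by
  refine (φ.map_tensor (P.id c.n) f).trans ?_
  rw [φ.map_id]
  exact congrArg (fun k => (tpowAdd A c.n a.n).hom ≫ k ≫ (tpowAdd A c.n b.n).inv)
    (id_tensorHom (tpow A c.n) (φ.functor.map f))

/-- The functor determined by a morphism of PROPs is monoidal. -/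
def coreMonoidal : φ.functor.CoreMonoidal where
  εIso := Iso.refl _
  μIso a b := (tpowAdd A a.n b.n).symm
  μIso_hom_natural_left f c := by
    rw [functor_map_whiskerRight]
    exact (Iso.inv_hom_id_assoc _ _).symm
  μIso_hom_natural_right c f := by
    rw [functor_map_whiskerLeft]
    exact (Iso.inv_hom_id_assoc _ _).symm
  associativity a b c := by
    rw [P.associator_hom_eq, functor_map_eqToHom]
    change (tpowAdd A a.n b.n).inv ▷ tpow A c.n ≫ (tpowAdd A (a.n + b.n) c.n).inv ≫
        eqToHom (congrArg (tpow A) (Nat.add_assoc a.n b.n c.n)) =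
      (α_ (tpow A a.n) (tpow A b.n) (tpow A c.n)).hom ≫
        tpow A a.n ◁ (tpowAdd A b.n c.n).inv ≫ (tpowAdd A a.n (b.n + c.n)).inv
    have h := tpowAdd_add A a.n b.n c.n
    rw [← cancel_mono ((tpowAdd A a.n (b.n + c.n)).hom ≫ tpow A a.n ◁ (tpowAdd A b.n c.n).hom)]
    simp [← h]
  left_unitality a := by
    rw [P.leftUnitor_hom_eq, functor_map_eqToHom]
    have key {X Y : C} (t : X ≅ 𝟙_ C ⊗ Y) (e : X ≅ Y) (h : t = e ≪≫ (λ_ Y).symm) :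
        (λ_ Y).hom = 𝟙 (𝟙_ C) ▷ Y ≫ t.inv ≫ e.hom := by
      subst h
      simp
    exact key _ _ (tpowAdd_zero_left A a.n)
  right_unitality a := by
    rw [P.rightUnitor_hom_eq, functor_map_eqToHom]
    change (ρ_ (tpow A a.n)).hom =
      tpow A a.n ◁ 𝟙 (𝟙_ C) ≫ (ρ_ (tpow A a.n)).hom ≫ 𝟙 (tpow A a.n)
    simp

instance : φ.functor.Monoidal := φ.coreMonoidal.toMonoidal

instance : φ.functor.Braided where
  braided a b := by
    have h : φ.functor.map (β_ a b).hom = (tpowAdd A a.n b.n).hom ≫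
      (β_ (tpow A a.n) (tpow A b.n)).hom ≫ (tpowAdd A b.n a.n).inv := φ.map_symm a.n b.n
    rw [h]
    exact Iso.inv_hom_id_assoc (tpowAdd A a.n b.n) _

theorem genIso_functor (n : ℕ) : (genIso φ.functor n).hom = tpowMap (λ_ A).hom n := by
  induction n with
  | zero => rfl
  | succ n ih =>
    have key {X : C} (f : X ⟶ tpow A n) : f ▷ (𝟙_ C ⊗ A) ≫
        (α_ (tpow A n) (𝟙_ C) A).inv ≫ (ρ_ (tpow A n)).hom ▷ A = f ⊗ₘ (λ_ A).hom := by
      simp [MonoidalCategory.tensorHom_def]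
    refine Eq.trans ?_ (key _)
    rw [← ih]
    rfl

end PROP.Morphism

/-- The functor built from the algebra takes the value `𝟙 ⊗ A` at `1`. The left unitor identifies it
with `A`, compatibly with the operators by `genIso_functor`. -/
theorem GenAlg.IsFree.essSurj_ev {T : SMTheory} {P : PROP.{w}} {M : GenAlg T P} (hM : M.IsFree) :
    (M.ev C).EssSurj where
  mem_essImage A := by
    let φ := hM.morphism A.toGenAlg
    refine ⟨⟨φ.functor, inferInstance⟩, ⟨Alg.isoMk (λ_ A.carrier) fun o => ?_⟩⟩
    have h : φ.functor.map (M.op o : (⟨T.dom o⟩ : P.Obj) ⟶ ⟨T.cod o⟩) = A.op o :=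
      hM.morphism_map_op A.toGenAlg o
    change tpowMap (λ_ A.carrier).hom (T.dom o) ≫ A.op o = ((genIso φ.functor (T.dom o)).hom ≫
      φ.functor.map (M.op o : (⟨T.dom o⟩ : P.Obj) ⟶ ⟨T.cod o⟩) ≫
        (genIso φ.functor (T.cod o)).inv) ≫ tpowMap (λ_ A.carrier).hom (T.cod o)
    rw [h, ← φ.genIso_functor, ← φ.genIso_functor]
    have key {X Y Z W : C} (e : X ≅ Y) (e' : Z ≅ W) (x : Y ⟶ W) :
        e.hom ≫ x = (e.hom ≫ x ≫ e'.inv) ≫ e'.hom := by simp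
    exact key _ _ _

theorem GenAlg.IsFree.isEquivalence_ev {T : SMTheory} {P : PROP.{w}} {M : GenAlg T P}
    (hM : M.IsFree) : (M.ev C).IsEquivalence where
  full := hM.full_ev
  essSurj := hM.essSurj_ev

/-- Evaluation at an algebra in a PROP is natural in the symmetric monoidal category. -/
def GenAlg.evNatIso {T : SMTheory} {P : PROP.{w}} (M : GenAlg T P) {D : Type u'} [Category.{v'} D]
    [MonoidalCategory D] [SymmetricCategory D] (G : SymMonFunctor D C) :
    M.ev D ⋙ Alg.map G ≅ G.postcomp ⋙ M.ev C :=
  NatIso.ofComponents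
    (fun F => Alg.isoMk (Iso.refl (G.F.obj (F.F.obj ⟨1⟩))) fun o => by
      -- The two algebras have the same carrier and, by `genIso_comp`, the same operators, so the
      -- identity is an isomorphism between them.
      have h : ((M.ev D ⋙ Alg.map G).obj F).op o = ((G.postcomp ⋙ M.ev C).obj F).op o := by
        change (tpowIso G.F (F.F.obj ⟨1⟩) (T.dom o)).hom ≫ G.F.map ((genIso F.F (T.dom o)).hom ≫
            F.F.map (M.op o : (⟨T.dom o⟩ : P.Obj) ⟶ ⟨T.cod o⟩) ≫ (genIso F.F (T.cod o)).inv) ≫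
              (tpowIso G.F (F.F.obj ⟨1⟩) (T.cod o)).inv =
          (genIso (F.F ⋙ G.F) (T.dom o)).hom ≫
            G.F.map (F.F.map (M.op o : (⟨T.dom o⟩ : P.Obj) ⟶ ⟨T.cod o⟩)) ≫
              (genIso (F.F ⋙ G.F) (T.cod o)).inv
        rw [genIso_comp, genIso_comp]
        simp
      have key {X : C} {a b : ℕ} (x : tpow X a ⟶ tpow X b) :
          tpowMap (𝟙 X) a ≫ x = x ≫ tpowMap (𝟙 X) b := by simp [tpowMap_id]
      exact (key _).trans (congrArg (· ≫ tpowMap (𝟙 (G.F.obj (F.F.obj ⟨1⟩))) (T.cod o)) h.symm))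
    fun α => Alg.Hom.ext ((Category.comp_id _).trans (Category.id_comp _).symm)

end UniversalProperty

theorem dagAlg_isFree : dagAlg.IsFree where
  exists_evalProp_eq := exists_evalProp_eq
  provable := provable_of_evalProp_eq

theorem mainTheorem1 :
    -- the five idags make the object `1` an algebra of the theory in the PROP of idags,
    ∃ M : GenAlg dagTheory dagProp, M.op = dagOp ∧
      -- the PROP of idags is isomorphic to the free PROP (expressions modulo provable equality),
      -- by an isomorphism of PROPs that sends every operator to its idag,
      (∃ Φ : dagTheory.freeProp.Morphism dagProp,
        (∀ o, Φ.map (dagTheory.gen o) = dagOp o) ∧ Φ.IsIso) ∧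
      -- it has the universal property of the free PROP: evaluation at this algebra is an
      -- equivalence between functorial models and algebras in every symmetric monoidal category,
      (∀ (C : Type u) [Category.{v} C] [MonoidalCategory C] [SymmetricCategory C],
        (M.ev C).IsEquivalence) ∧
      -- and these equivalences are natural in the symmetric monoidal category.
      (∀ (D : Type u') [Category.{v'} D] [MonoidalCategory D] [SymmetricCategory D]
        (C : Type u) [Category.{v} C] [MonoidalCategory C] [SymmetricCategory C]
        (G : SymMonFunctor D C),
        ∃ i : M.ev D ⋙ Alg.map G ≅ G.postcomp ⋙ M.ev C,
          ∀ F : SymMonFunctor dagProp.Obj D,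
            Alg.Hom.hom (i.hom.app F) = 𝟙 (G.F.obj (F.F.obj ⟨1⟩))) := by
  exact ⟨dagAlg, rfl, ⟨dagAlg.freeLift, fun _ => rfl, dagAlg_freeLift_isIso⟩,
    fun _ => dagAlg_isFree.isEquivalence_ev,
    fun _ _ _ _ _ _ _ _ G => ⟨dagAlg.evNatIso G, fun _ => rfl⟩⟩
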